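/- Let $g\ge 2$, let $\Gamma_g=\pi_1(\Sigma_g)$ be the fundamental group of the closed orientable surface $\Sigma_g$ of genus $g$, and let $\mathrm{Homeo}^+(S^1)$ be the group of orientation-preserving homeomorphisms of the circle with the compact-open topology. Give $\mathrm{Hom}(\Gamma_g,\mathrm{Homeo}^+(S^1))$ the topology of pointwise convergence on $\Gamma_g$. Two representations are called $\chi$-equivalent if they define the same point of the largest Hausdorff quotient of $\mathrm{Hom}(\Gamma_g,\mathrm{Homeo}^+(S^1))/\mathrm{Homeo}^+(S^1)$ (quotient by conjugation), and a representation is called path-rigid if its path component in $\mathrm{Hom}(\Gamma_g,\mathrm{Homeo}^+(S^1))$ is contained in a single $\chi$-equivalence class. Let $\rho\colon\Gamma_g\to\mathrm{Homeo}^+(S^1)$ be path-rigid, let $1\le h\le g-1$, and let $\Sigma'\subset\Sigma_g$ be a one-holed subsurface of genus $h$ (for instance $h=g-1$). Suppose that every one-holed torus $T\subset\Sigma'$ is very good, that is, $\rho(\pi_1 T)$ has a finite orbit in $S^1$. Then $\rho(\pi_1\Sigma')$ has a finite orbit in $S^1$. Here the one-holed subsurfaces of genus $h$ are taken at the level of fundamental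 groups: for the presentation $\Gamma_g=\langle a_1,b_1,\dots,a_g,b_g\mid [a_g,b_g]\cdots[a_1,b_1]=1\rangle$ with $[a,b]=b^{-1}a^{-1}ba$, the subgroups $\pi_1\Sigma'\le\Gamma_g$ are the images of $\langle a_1,b_1,\dots,a_h,b_h\rangle$ under automorphisms of $\Gamma_g$ (equivalently, under self-homeomorphisms of $\Sigma_g$), and $T\subset\Sigma'$ means $\pi_1T\le\pi_1\Sigma'$. -/

import Mathlib

/-! ### The group of orientation-preserving homeomorphisms of the circle -/

/-- `F`, an element of the group of increasing homeomorphisms of the line commuting with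
`x ↦ x + 1` (the units of the monoid `CircleDeg1Lift`), is a lift of the self-homeomorphism `f`
of the circle `ℝ / ℤ`. -/
def IsLiftOf (F : CircleDeg1Liftˣ) (f : UnitAddCircle ≃ₜ UnitAddCircle) : Prop :=
  ∀ x : ℝ, ((F x : ℝ) : UnitAddCircle) = f (x : UnitAddCircle)

/-- The group of orientation-preserving homeomorphisms of the circle `ℝ / ℤ`: those that lift to
an increasing homeomorphism of the line commuting with `x ↦ x + 1`. -/
def HomeoPlus : Subgroup (UnitAddCircle ≃ₜ UnitAddCircle) where
  carrier := {f | ∃ F : CircleDeg1Liftˣ, IsLiftOf F f}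
  mul_mem' := by
    rintro f g ⟨F, hF⟩ ⟨G, hG⟩
    refine ⟨F * G, fun x => ?_⟩
    have h1 := hF ((G : CircleDeg1Lift) x)
    have h2 := hG x
    simp only [Units.val_mul, CircleDeg1Lift.mul_apply, Homeomorph.mul_apply]
    rw [h1, h2]
  one_mem' := ⟨1, fun x => by simp⟩
  inv_mem' := by
    rintro f ⟨F, hF⟩
    refine ⟨F⁻¹, fun x => ?_⟩
    have h1 := hF ((F⁻¹ : CircleDeg1Liftˣ) x)
    rw [CircleDeg1Lift.units_apply_inv_apply] at h1
    rw [h1, Homeomorph.inv_apply, Homeomorph.symm_apply_apply]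

/-- The compact-open topology on the group of orientation-preserving homeomorphisms. -/
instance HomeoPlus.instTopologicalSpace : TopologicalSpace HomeoPlus :=
  TopologicalSpace.induced
    (fun f : HomeoPlus =>
      ((f : UnitAddCircle ≃ₜ UnitAddCircle) : C(UnitAddCircle, UnitAddCircle)))
    inferInstance

/-! ### Surface groups and their one-holed subsurfaces -/

/-- Labels of the standard generators: `(i, false)` stands for `a_(i+1)` and `(i, true)` for
`b_(i+1)`. -/
abbrev SurfaceGen (g : ℕ) : Type := Fin g × Bool

/-- The commutator in the convention `[a, b] = b⁻¹ a⁻¹ b a`. -/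
def surfaceComm {G : Type*} [Group G] (a b : G) : G := b⁻¹ * a⁻¹ * b * a

/-- The word `[a_g, b_g] ⋯ [a_1, b_1]`. -/
def surfaceRelator (g : ℕ) : FreeGroup (SurfaceGen g) :=
  ((List.ofFn fun i : Fin g =>
    surfaceComm (FreeGroup.of (i, false)) (FreeGroup.of (i, true))).reverse).prod

/-- The fundamental group of the closed orientable surface of genus `g`, in its standard
presentation `⟨a_1, b_1, …, a_g, b_g | [a_g, b_g] ⋯ [a_1, b_1] = 1⟩`. -/
abbrev SurfaceGroup (g : ℕ) : Type :=
  PresentedGroup ({surfaceRelator g} : Set (FreeGroup (SurfaceGen g)))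

/-- A standard system of loops of the closed surface of genus `g`, written
`s (i, false) = a_(i+1)`, `s (i, true) = b_(i+1)`: a tuple of elements of the surface group that
is the image of the standard generating tuple under an automorphism. By the theorem of Dehn,
Nielsen and Baer, the automorphisms of the surface group are the maps induced by the
self-homeomorphisms of the surface (together with a choice of a path from the base point to its
image), so these are the homeomorphic images of the picture of standard loops. -/
def IsStandardSystem {g : ℕ} (s : SurfaceGen g → SurfaceGroup g) : Prop :=
  ∃ φ : SurfaceGroup g ≃* SurfaceGroup g, ∀ j, s j = φ (PresentedGroup.of j)

/-- `H` is the fundamental group of a one-holed subsurface of genus `h` of the closed surface of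
genus `g` (where `h < g`), the inclusion of the subsurface being made based by a choice of a path
to it from the base point. Every such subsurface is the image, under a
self-homeomorphism of the surface, of the regular neighbourhood of the loops
`a_1, b_1, …, a_h, b_h` of the standard picture, and its fundamental group is generated by the
first `h` pairs of loops of a standard system. -/
def IsOneHoledSubsurfaceGroup {g : ℕ} (h : ℕ) (H : Subgroup (SurfaceGroup g)) : Prop :=
  ∃ s : SurfaceGen g → SurfaceGroup g, IsStandardSystem s ∧
    H = Subgroup.closure (s '' {j | (j.1 : ℕ) < h})

/-! ### Representation space, character space, path-rigidity -/

section Representations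

/-- The set `Hom(Γ, Homeo⁺(S¹))` of actions of the (discrete) group `Γ` on the circle. -/
abbrev CircleRep (Γ : Type*) [Group Γ] : Type _ := Γ →* HomeoPlus

/-- The compact-open topology on `Hom(Γ, Homeo⁺(S¹))`, `Γ` being discrete: the topology of
pointwise convergence on `Γ`. -/
instance CircleRep.instTopologicalSpace (Γ : Type*) [Group Γ] : TopologicalSpace (CircleRep Γ) :=
  TopologicalSpace.induced (fun (ρ : CircleRep Γ) (γ : Γ) => ρ γ) inferInstance

/-- Conjugacy of representations. -/
def CircleRep.conjSetoid (Γ : Type*) [Group Γ] : Setoid (CircleRep Γ) where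
  r ρ σ := ∃ f : HomeoPlus, ∀ γ, σ γ = f * ρ γ * f⁻¹
  iseqv :=
    { refl := fun ρ => ⟨1, fun γ => by simp⟩
      symm := by
        rintro ρ σ ⟨f, hf⟩
        exact ⟨f⁻¹, fun γ => by rw [hf]; group⟩
      trans := by
        rintro ρ σ τ ⟨f, hf⟩ ⟨k, hk⟩
        exact ⟨k * f, fun γ => by rw [hk, hf]; group⟩ }

/-- The character space: the largest Hausdorff quotient of `Hom(Γ, Homeo⁺(S¹)) / Homeo⁺(S¹)`. -/
abbrev CircleCharacterSpace (Γ : Type*) [Group Γ] : Type _ :=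
  T2Quotient (Quotient (CircleRep.conjSetoid Γ))

/-- The point of the character space given by a representation. -/
def CircleRep.character {Γ : Type*} [Group Γ] (ρ : CircleRep Γ) : CircleCharacterSpace Γ :=
  T2Quotient.mk (Quotient.mk (CircleRep.conjSetoid Γ) ρ)

/-- Two representations are `χ`-equivalent if they give the same point of the character space. -/
def CircleRep.ChiEquiv {Γ : Type*} [Group Γ] (ρ σ : CircleRep Γ) : Prop :=
  ρ.character = σ.character

/-- A representation is path-rigid if its path component in `Hom(Γ, Homeo⁺(S¹))` is contained in a
single `χ`-equivalence class. -/
def CircleRep.PathRigid {Γ : Type*} [Group Γ] (ρ : CircleRep Γ) : Prop :=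
  pathComponent ρ ⊆ {σ | CircleRep.ChiEquiv ρ σ}

/-- The subgroup `H` has a finite orbit on the circle under the action `ρ`. -/
def CircleRep.HasFiniteOrbit {Γ : Type*} [Group Γ] (ρ : CircleRep Γ) (H : Subgroup Γ) : Prop :=
  ∃ x : UnitAddCircle,
    {y : UnitAddCircle | ∃ γ ∈ H, y = (ρ γ : UnitAddCircle ≃ₜ UnitAddCircle) x}.Finite

end Representations

/-! Path-rigidity enters only through rotation numbers. The rotation number of an element is
continuous and conjugation invariant with values in a Hausdorff space, so it descends to the
character space and is constant on the path component of `ρ`. Lift the representation to the free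
group on the standard generators. If `d` commutes with `a`, then replacing `b` by `d * b` does not
change `[a, b]`; letting `d` run along a path from the identity (a bending) gives a path of
representations. All translation numbers are constant along it, so by Ghys' theorem the original
action is semiconjugate to the bent one (`exists_semiconj_of_bend`).

A finite orbit is built by induction on the number of handles. Translation numbers are additive on a
group with a finite orbit, so Euclid's algorithm, carried out by twists inside a handle, makes a
chosen generator have a fixed point. Arrange this for `a₁` of the last old handle and `b₂` of the
new one. By induction the old handles, with the last replaced by the mixed handle `(b₁ a₁, b₁ a₂
b₁⁻¹ a₁⁻¹)`, have a finite orbit `X`.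

Now bend twice at once. A small flow commuting with `b₂` makes a certain set `N` of periodic points
nowhere dense, and a normalized semiconjugacy maps `X` into `N`. A bending that commutes with `a₁`
is chosen to carry points of a nowhere dense image of `N` into `N` only when they are `ε`-almost
fixed, both by the bending and by `a₁` (`exists_path_commute_squeeze`). As `ε → 0`, an ultralimit
`ζ` of the normalized semiconjugacies makes `ζ '' X` finite modulo `ℤ` and invariant under `a₁`,
`b₁`, `a₂` and the remaining old handles (`exists_periodicFinite_of_mix`). The same argument with
the roles of the curves changed adds `b₂` (`exists_periodicFinite_of_pair`). -/

open Filter Topology Set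

/-! ### Pointwise convergence of lifts and continuity of the translation number -/

namespace CircleDeg1Lift

/-- Monotonicity of `G i` compares `G i (u i)` with `G i y` for a fixed `y` slightly to the left or
right of `x`, where pointwise convergence applies. This makes pointwise continuity of families of
lifts stable under products. -/
theorem tendsto_apply_of_pointwise {ι : Type*} {l : Filter ι} {G : ι → CircleDeg1Lift}
    {F : CircleDeg1Lift} (hF : Continuous F) (h : ∀ x, Tendsto (fun i => G i x) l (𝓝 (F x)))
    {u : ι → ℝ} {x : ℝ} (hu : Tendsto u l (𝓝 x)) :
    Tendsto (fun i => G i (u i)) l (𝓝 (F x)) := by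
  rw [tendsto_order]
  constructor
  · intro a ha
    obtain ⟨y, hy, hay⟩ : ∃ y, y < x ∧ a < F y := by
      have h1 : ∀ᶠ y in 𝓝[<] x, a < F y :=
        (hF.continuousAt.eventually (lt_mem_nhds ha)).filter_mono nhdsWithin_le_nhds
      obtain ⟨y, hy⟩ := (h1.and self_mem_nhdsWithin).exists
      exact ⟨y, hy.2, hy.1⟩
    filter_upwards [(h y).eventually (lt_mem_nhds hay), hu.eventually (lt_mem_nhds hy)] with i h1 h2
    exact h1.trans_le ((G i).mono h2.le)
  · intro a ha
    obtain ⟨y, hy, hay⟩ : ∃ y, x < y ∧ F y < a := by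
      have h1 : ∀ᶠ y in 𝓝[>] x, F y < a :=
        (hF.continuousAt.eventually (gt_mem_nhds ha)).filter_mono nhdsWithin_le_nhds
      obtain ⟨y, hy⟩ := (h1.and self_mem_nhdsWithin).exists
      exact ⟨y, hy.2, hy.1⟩
    filter_upwards [(h y).eventually (gt_mem_nhds hay), hu.eventually (gt_mem_nhds hy)] with i h1 h2
    exact ((G i).mono h2.le).trans_lt h1

theorem tendsto_pow_apply_of_pointwise {ι : Type*} {l : Filter ι} {G : ι → CircleDeg1Lift}
    {F : CircleDeg1Lift} (hF : Continuous F) (h : ∀ x, Tendsto (fun i => G i x) l (𝓝 (F x)))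
    (n : ℕ) (x : ℝ) : Tendsto (fun i => (G i ^ n) x) l (𝓝 ((F ^ n) x)) := by
  induction n with
  | zero => simpa using tendsto_const_nhds
  | succ n ih =>
    simp only [pow_succ', mul_apply]
    exact tendsto_apply_of_pointwise hF h ih

/-- The translation number is continuous for pointwise convergence to a continuous limit. -/
theorem tendsto_translationNumber_of_pointwise {ι : Type*} {l : Filter ι} {G : ι → CircleDeg1Lift}
    {F : CircleDeg1Lift} (hF : Continuous F) (h : ∀ x, Tendsto (fun i => G i x) l (𝓝 (F x))) :
    Tendsto (fun i => translationNumber (G i)) l (𝓝 (translationNumber F)) := by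
  rw [Metric.tendsto_nhds]
  intro ε hε
  -- The `N`-th iterate at `0` differs from `N` times the translation number by at most one, for `G
  -- i` and for `F`; the two iterates are eventually within one of each other. The three errors add
  -- up to less than `N * ε`.
  obtain ⟨N, hN⟩ := exists_nat_gt (3 / ε)
  have hN0 : (0 : ℝ) < N := (by positivity : (0 : ℝ) < 3 / ε).trans hN
  have h3 : 3 < N * ε := by rwa [div_lt_iff₀ hε] at hN
  filter_upwards [(Metric.tendsto_nhds.1 (tendsto_pow_apply_of_pointwise hF h N 0)) 1 one_pos]
    with i hi
  have h1 := dist_pow_map_zero_mul_translationNumber_le (G i) N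
  have h2 := dist_pow_map_zero_mul_translationNumber_le F N
  rw [Real.dist_eq] at *
  rw [abs_le] at h1 h2
  rw [abs_lt] at *
  constructor <;> nlinarith

theorem continuous_units (F : CircleDeg1Liftˣ) : Continuous (F : ℝ → ℝ) := by
  rw [← coe_toOrderIso]; exact (toOrderIso F).continuous

theorem strictMono_units (F : CircleDeg1Liftˣ) : StrictMono (F : ℝ → ℝ) := by
  rw [← coe_toOrderIso]; exact (toOrderIso F).strictMono

theorem units_ext {F G : CircleDeg1Liftˣ} (h : ∀ x : ℝ, F x = G x) : F = G :=
  Units.ext (CircleDeg1Lift.ext h)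

theorem units_mul_apply (F G : CircleDeg1Liftˣ) (x : ℝ) : (F * G) x = F (G x) := rfl

theorem units_one_apply (x : ℝ) : (1 : CircleDeg1Liftˣ) x = x := rfl

theorem units_inv_eq_iff (F : CircleDeg1Liftˣ) {x y : ℝ} : F⁻¹ x = y ↔ x = F y := by
  constructor
  · rintro rfl; simp
  · rintro rfl; simp

/-- A family of lifts is pointwise continuous. -/
def PointwiseContinuous {Y : Type*} [TopologicalSpace Y] (G : Y → CircleDeg1Liftˣ) : Prop :=
  ∀ x : ℝ, Continuous fun s => G s x

namespace PointwiseContinuous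

variable {Y : Type*} [TopologicalSpace Y] {G H : Y → CircleDeg1Liftˣ}

theorem const (F : CircleDeg1Liftˣ) : PointwiseContinuous fun _ : Y => F :=
  fun _ => continuous_const

theorem apply (hG : PointwiseContinuous G) {u : Y → ℝ} (hu : Continuous u) :
    Continuous fun s => G s (u s) := by
  rw [continuous_iff_continuousAt]
  intro s
  exact tendsto_apply_of_pointwise (continuous_units (G s)) (fun x => (hG x).tendsto s)
    (hu.tendsto s)

theorem uncurry (hG : PointwiseContinuous G) : Continuous fun p : Y × ℝ => G p.1 p.2 := by
  have : PointwiseContinuous fun p : Y × ℝ => G p.1 := fun x => (hG x).comp continuous_fst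
  exact this.apply continuous_snd

theorem mul (hG : PointwiseContinuous G) (hH : PointwiseContinuous H) :
    PointwiseContinuous fun s => G s * H s :=
  fun x => hG.apply (hH x)

theorem inv (hG : PointwiseContinuous G) : PointwiseContinuous fun s => (G s)⁻¹ := by
  intro x
  rw [continuous_iff_continuousAt]
  intro s
  rw [ContinuousAt, tendsto_order]
  constructor
  · intro a ha
    have h1 : G s a < x := by
      simpa using strictMono_units (G s) ha
    filter_upwards [((hG a).tendsto s).eventually (gt_mem_nhds h1)] with i hi
    simpa using strictMono_units (G i)⁻¹ hi
  · intro a ha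
    have h1 : x < G s a := by
      simpa using strictMono_units (G s) ha
    filter_upwards [((hG a).tendsto s).eventually (lt_mem_nhds h1)] with i hi
    simpa using strictMono_units (G i)⁻¹ hi

theorem translationNumber (hG : PointwiseContinuous G) :
    Continuous fun s => CircleDeg1Lift.translationNumber (G s) := by
  rw [continuous_iff_continuousAt]
  intro s
  exact tendsto_translationNumber_of_pointwise (continuous_units (G s))
    (fun x => (hG x).tendsto s)

end PointwiseContinuous

/-! ### Lifts and homeomorphisms of the circle -/

theorem coe_map_periodic (F : CircleDeg1Lift) :
    Function.Periodic (fun x : ℝ => ((F x : ℝ) : UnitAddCircle)) 1 := by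
  intro x
  simp only [map_add_one, AddCircle.coe_add, AddCircle.coe_period, add_zero]

/-- The self-map of the circle induced by a lift. -/
noncomputable def circleMap (F : CircleDeg1Lift) : UnitAddCircle → UnitAddCircle :=
  F.coe_map_periodic.lift

@[simp] theorem circleMap_coe (F : CircleDeg1Lift) (x : ℝ) :
    circleMap F (x : UnitAddCircle) = ((F x : ℝ) : UnitAddCircle) :=
  Function.Periodic.lift_coe _ _

theorem continuous_circleMap (F : CircleDeg1Liftˣ) : Continuous (circleMap F) := by
  refine Continuous.quotient_lift ?_ _
  exact (AddCircle.continuous_mk' 1).comp (continuous_units F)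

/-- The homeomorphism of the circle induced by an invertible lift. -/
noncomputable def circleHomeomorph (F : CircleDeg1Liftˣ) : UnitAddCircle ≃ₜ UnitAddCircle where
  toFun := circleMap F
  invFun := circleMap (F⁻¹ : CircleDeg1Liftˣ)
  left_inv z := by
    induction z using QuotientAddGroup.induction_on with
    | H x =>
      exact (congrArg _ (circleMap_coe _ _)).trans ((circleMap_coe _ _).trans (by simp))
  right_inv z := by
    induction z using QuotientAddGroup.induction_on with
    | H x =>
      exact (congrArg _ (circleMap_coe _ _)).trans ((circleMap_coe _ _).trans (by simp))
  continuous_toFun := continuous_circleMap F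
  continuous_invFun := continuous_circleMap F⁻¹

@[simp] theorem circleHomeomorph_coe (F : CircleDeg1Liftˣ) (x : ℝ) :
    circleHomeomorph F (x : UnitAddCircle) = ((F x : ℝ) : UnitAddCircle) :=
  circleMap_coe _ _

theorem isLiftOf_iff {F : CircleDeg1Liftˣ} {f : UnitAddCircle ≃ₜ UnitAddCircle} :
    IsLiftOf F f ↔ circleHomeomorph F = f := by
  constructor
  · intro h
    ext z
    induction z using QuotientAddGroup.induction_on with
    | H x => exact (circleHomeomorph_coe F x).trans (h x)
  · rintro rfl x
    exact (circleHomeomorph_coe F x).symm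

/-- The projection from lifts to orientation-preserving homeomorphisms of the circle. -/
noncomputable def toHomeoPlus : CircleDeg1Liftˣ →* HomeoPlus where
  toFun F := ⟨circleHomeomorph F, F, isLiftOf_iff.2 rfl⟩
  map_one' := by
    apply Subtype.ext
    exact isLiftOf_iff.1 fun x => by simp
  map_mul' F G := by
    apply Subtype.ext
    exact isLiftOf_iff.1 fun x => by simp [Homeomorph.mul_apply]

theorem toHomeoPlus_apply (F : CircleDeg1Liftˣ) (x : ℝ) :
    (toHomeoPlus F : UnitAddCircle ≃ₜ UnitAddCircle) (x : UnitAddCircle)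
      = ((F x : ℝ) : UnitAddCircle) :=
  circleHomeomorph_coe F x

theorem toHomeoPlus_surjective : Function.Surjective toHomeoPlus := by
  rintro ⟨f, F, hF⟩
  exact ⟨F, Subtype.ext (isLiftOf_iff.1 hF)⟩

theorem coe_eq_coe_iff {x y : ℝ} :
    (x : UnitAddCircle) = (y : UnitAddCircle) ↔ ∃ n : ℤ, x = y + n := by
  rw [← sub_eq_zero, ← AddCircle.coe_sub, AddCircle.coe_eq_zero_iff]
  constructor
  · rintro ⟨n, hn⟩
    exact ⟨n, by simp at hn; linarith⟩
  · rintro ⟨n, hn⟩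
    exact ⟨n, by simp; linarith⟩

theorem coe_add_int (x : ℝ) (n : ℤ) : ((x + n : ℝ) : UnitAddCircle) = x :=
  coe_eq_coe_iff.2 ⟨n, rfl⟩

/-- The kernel of the projection consists of integer translations: a lift of the identity has
integer displacement, and monotonicity forces equal displacements at points less than one apart. -/
theorem toHomeoPlus_eq_iff {F G : CircleDeg1Liftˣ} :
    toHomeoPlus F = toHomeoPlus G ↔ ∃ n : ℤ, ∀ x : ℝ, F x = G x + n := by
  constructor
  · intro h
    have h1 : toHomeoPlus (G⁻¹ * F) = 1 := by rw [map_mul, map_inv, h, inv_mul_cancel]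
    have h2 : ∀ x : ℝ, (((G⁻¹ * F) x : ℝ) : UnitAddCircle) = x := fun x => by
      rw [← toHomeoPlus_apply, h1]; rfl
    choose n hn using fun x => coe_eq_coe_iff.1 (h2 x)
    have hcont : ∀ x, n x = n 0 := by
      have hm := strictMono_units (G⁻¹ * F)
      have key : ∀ x y : ℝ, x ≤ y → y < x + 1 → n x = n y := by
        intro x y hxy hyx
        have h3 := hm.monotone hxy
        have h4 := hm hyx
        rw [map_add_one] at h4
        rw [hn x, hn y] at h3 h4
        have h5 : n y < n x + 1 := by
          have : (n y : ℝ) < n x + 1 := by linarith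
          exact_mod_cast this
        have h6 : n x < n y + 1 := by
          have : (n x : ℝ) < n y + 1 := by linarith
          exact_mod_cast this
        omega
      intro x
      rw [key 0 (Int.fract x) (Int.fract_nonneg x) (by linarith [Int.fract_lt_one x])]
      have h7 := hn (Int.fract x + ⌊x⌋)
      rw [map_add_int, hn (Int.fract x)] at h7
      have h8 : (n (Int.fract x + ⌊x⌋) : ℝ) = n (Int.fract x) := by linarith
      rw [Int.fract_add_floor] at h8
      exact_mod_cast h8
    refine ⟨n 0, fun x => ?_⟩
    have h9 := hn x
    rw [hcont, units_mul_apply, units_inv_eq_iff, map_add_int] at h9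
    exact h9
  · rintro ⟨n, hn⟩
    apply Subtype.ext
    refine isLiftOf_iff.1 fun x => ?_
    rw [hn x, coe_add_int]
    exact (toHomeoPlus_apply G x).symm

theorem translationNumber_add_int {F G : CircleDeg1Lift} {n : ℤ} (h : ∀ x : ℝ, F x = G x + n) :
    translationNumber F = translationNumber G + n := by
  have h1 : F = translate (Multiplicative.ofAdd (n : ℝ)) * G := by
    ext x; simp [h x, add_comm]
  have h2 : Commute ((translate (Multiplicative.ofAdd (n : ℝ)) : CircleDeg1Liftˣ) : CircleDeg1Lift)
      G := by
    ext x; simp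
  rw [h1, translationNumber_mul_of_commute h2, translationNumber_translate, add_comm]

end CircleDeg1Lift

open CircleDeg1Lift

/-! ### The rotation number and its continuity -/

namespace HomeoPlus

/-- An invertible lift of an orientation-preserving homeomorphism. -/
noncomputable def someLift (f : HomeoPlus) : CircleDeg1Liftˣ :=
  (toHomeoPlus_surjective f).choose

@[simp] theorem toHomeoPlus_someLift (f : HomeoPlus) : toHomeoPlus (someLift f) = f :=
  (toHomeoPlus_surjective f).choose_spec

/-- The rotation number. -/
noncomputable def rotationNumber (f : HomeoPlus) : UnitAddCircle :=
  ((translationNumber (someLift f) : ℝ) : UnitAddCircle)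

theorem rotationNumber_toHomeoPlus (F : CircleDeg1Liftˣ) :
    rotationNumber (toHomeoPlus F) = ((translationNumber F : ℝ) : UnitAddCircle) := by
  obtain ⟨n, hn⟩ := toHomeoPlus_eq_iff.1 (toHomeoPlus_someLift (toHomeoPlus F))
  exact coe_eq_coe_iff.2 ⟨n, translationNumber_add_int hn⟩

theorem rotationNumber_conj (f k : HomeoPlus) :
    rotationNumber (k * f * k⁻¹) = rotationNumber f := by
  obtain ⟨F, rfl⟩ := toHomeoPlus_surjective f
  obtain ⟨K, rfl⟩ := toHomeoPlus_surjective k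
  rw [← map_inv, ← map_mul, ← map_mul, rotationNumber_toHomeoPlus, rotationNumber_toHomeoPlus]
  exact congrArg _ (translationNumber_conj_eq K F)

theorem exists_close_lift (F : CircleDeg1Liftˣ) (f : HomeoPlus) :
    ∃ G : CircleDeg1Liftˣ, toHomeoPlus G = f ∧ |G 0 - F 0| ≤ 1 / 2 := by
  refine ⟨CircleDeg1Lift.translate (Multiplicative.ofAdd (((-round ((someLift f) 0 - F 0) : ℤ) : ℝ))) * (someLift f),
    ?_, ?_⟩
  · refine (toHomeoPlus_eq_iff.2 ⟨-round ((someLift f) 0 - F 0), fun x => ?_⟩).trans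
      (toHomeoPlus_someLift f)
    rw [units_mul_apply, CircleDeg1Lift.translate_apply, add_comm]
  · rw [units_mul_apply, CircleDeg1Lift.translate_apply]
    have h := abs_sub_round ((someLift f) 0 - F 0)
    have e : ((-round (someLift f 0 - F 0) : ℤ) : ℝ) + someLift f 0 - F 0
        = someLift f 0 - F 0 - round (someLift f 0 - F 0) := by push_cast; ring
    rwa [e]

/-- Wherever the lifts are within `1 / 2` of each other, their distance equals the circle distance
and is below `ε`. By the intermediate value theorem the distance can never cross the value `ε`. -/
theorem abs_sub_lt_of_circle_close {F G : CircleDeg1Liftˣ} {ε : ℝ} (hε : ε < 1 / 4)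
    (h0 : |G 0 - F 0| ≤ 1 / 2)
    (h : ∀ z : UnitAddCircle, dist ((toHomeoPlus F : UnitAddCircle ≃ₜ UnitAddCircle) z)
      ((toHomeoPlus G : UnitAddCircle ≃ₜ UnitAddCircle) z) < ε) (x : ℝ) :
    |G x - F x| < ε := by
  have hc : Continuous fun x : ℝ => |G x - F x| :=
    ((continuous_units G).sub (continuous_units F)).abs
  have hn : ∀ y : ℝ, |G y - F y| ≤ 1 / 2 → |G y - F y| < ε := by
    intro y hy
    have h1 := h y
    rw [toHomeoPlus_apply, toHomeoPlus_apply, dist_comm, dist_eq_norm, ← AddCircle.coe_sub,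
      (AddCircle.norm_coe_eq_abs_iff 1 one_ne_zero).2 (by simpa using hy)] at h1
    exact h1
  apply hn
  by_contra! hx
  obtain ⟨y, hy⟩ := mem_range_of_exists_le_of_exists_ge hc ⟨0, (hn 0 h0).le⟩
    ⟨x, (hε.trans (by linarith)).le⟩
  simp only at hy
  have h2 := hn y (by rw [hy]; linarith)
  exact absurd hy (ne_of_lt h2)

theorem continuous_rotationNumber : Continuous rotationNumber := by
  rw [continuous_iff_continuousAt]
  intro f
  choose G hG hG0 using exists_close_lift (someLift f)
  have hpt : ∀ x : ℝ, Tendsto (fun k => G k x) (𝓝 f) (𝓝 ((someLift f) x)) := by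
    intro x
    rw [Metric.tendsto_nhds]
    intro ε hε
    have h1 : Tendsto (fun k : HomeoPlus =>
        ((k : UnitAddCircle ≃ₜ UnitAddCircle) : C(UnitAddCircle, UnitAddCircle))) (𝓝 f)
        (𝓝 ((f : UnitAddCircle ≃ₜ UnitAddCircle) : C(UnitAddCircle, UnitAddCircle))) :=
      continuous_induced_dom.tendsto f
    rw [ContinuousMap.tendsto_iff_tendstoUniformly, Metric.tendstoUniformly_iff] at h1
    filter_upwards [h1 (min ε (1 / 5)) (by positivity)] with k hk
    rw [Real.dist_eq]
    refine (abs_sub_lt_of_circle_close (ε := min ε (1 / 5)) ?_ (hG0 k) ?_ x).trans_le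
      (min_le_left _ _)
    · exact (min_le_right _ _).trans_lt (by norm_num)
    · intro z
      rw [toHomeoPlus_someLift, hG]
      exact hk z
  have h2 : rotationNumber = fun k => ((translationNumber (G k) : ℝ) : UnitAddCircle) := by
    funext k
    rw [← rotationNumber_toHomeoPlus, hG]
  rw [ContinuousAt, rotationNumber]
  rw [h2]
  exact ((AddCircle.continuous_mk' 1).tendsto _).comp
    (tendsto_translationNumber_of_pointwise (continuous_units (someLift f)) hpt)

end HomeoPlus

open HomeoPlus

/-- A continuous conjugation-invariant function with Hausdorff values factors through the largest
Hausdorff quotient. No other property of the character space is needed. -/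
theorem CircleRep.ChiEquiv.rotationNumber_eq {Γ : Type*} [Group Γ] {ρ σ : CircleRep Γ}
    (h : CircleRep.ChiEquiv ρ σ) (γ : Γ) : rotationNumber (ρ γ) = rotationNumber (σ γ) := by
  have hc : Continuous fun ρ : CircleRep Γ => rotationNumber (ρ γ) :=
    continuous_rotationNumber.comp ((continuous_apply γ).comp continuous_induced_dom)
  let q : Quotient (CircleRep.conjSetoid Γ) → UnitAddCircle :=
    Quotient.lift (fun ρ : CircleRep Γ => rotationNumber (ρ γ)) (by
      rintro ρ σ ⟨f, hf⟩
      simp only [hf γ, rotationNumber_conj])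
  have hq : Continuous q := hc.quotient_lift _
  have h1 := congrArg (T2Quotient.lift hq) h
  simpa [CircleRep.character, T2Quotient.lift_mk, q] using h1

/-- The difference `u s - u 0` is an integer, so its absolute value never equals `1 / 2`. This
upgrades constancy of rotation numbers to constancy of translation numbers along a path. -/
theorem eq_of_continuous_of_coe_eq {u : ℝ → ℝ} (hu : Continuous u)
    (h : ∀ s, ((u s : ℝ) : UnitAddCircle) = ((u 0 : ℝ) : UnitAddCircle)) (s : ℝ) : u s = u 0 := by
  choose n hn using fun s => coe_eq_coe_iff.1 (h s)
  by_contra hne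
  have key : ∀ r, |u r - u 0| ≠ 1 / 2 := by
    intro r hr
    rw [hn r, add_sub_cancel_left] at hr
    have h2 : |2 * n r| = 1 := by
      have : |(2 : ℝ) * n r| = 1 := by rw [abs_mul, hr]; norm_num
      exact_mod_cast this
    rw [abs_eq one_pos.le] at h2
    omega
  have h0 : n s ≠ 0 := by
    intro h0
    exact hne (by rw [hn s, h0]; simp)
  have h1 : (1 : ℝ) ≤ |u s - u 0| := by
    rw [hn s, add_sub_cancel_left]
    exact_mod_cast Int.one_le_abs h0
  obtain ⟨r, hr⟩ := mem_range_of_exists_le_of_exists_ge (f := fun r => |u r - u 0|) (c := 1 / 2)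
    (by fun_prop) ⟨0, by simp⟩ ⟨s, by linarith⟩
  exact key r hr

namespace CircleDeg1Lift.PointwiseContinuous

/-- Joint continuity on `Y × ℝ` descends to `Y × UnitAddCircle` because the product of the identity
with the covering map is an open quotient map; currying then gives the compact-open topology. -/
theorem toHomeoPlus {Y : Type*} [TopologicalSpace Y] {G : Y → CircleDeg1Liftˣ}
    (hG : PointwiseContinuous G) : Continuous fun s => CircleDeg1Lift.toHomeoPlus (G s) := by
  rw [continuous_induced_rng]
  refine ContinuousMap.continuous_of_continuous_uncurry _ ?_
  have hq : IsOpenQuotientMap (Prod.map (id : Y → Y) (fun x : ℝ => (x : UnitAddCircle))) :=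
    IsOpenQuotientMap.id.prodMap QuotientAddGroup.isOpenQuotientMap_mk
  rw [hq.isQuotientMap.continuous_iff]
  refine ((AddCircle.continuous_mk' 1).comp hG.uncurry).congr ?_
  rintro ⟨s, x⟩
  exact (toHomeoPlus_apply (G s) x).symm

end CircleDeg1Lift.PointwiseContinuous

/-! ### Charts in which a lift is an integer translation -/

namespace CircleDeg1Lift

/-- A chart of the interval `(l, r)` in which `Z` is the translation by `e`. -/
structure IsTranslationChart (Z : CircleDeg1Liftˣ) (l r : ℝ) (G : ℝ → ℝ) (e : ℤ) : Prop where
  strictMono : StrictMono G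
  range_eq : range G = Ioo l r
  map_apply : ∀ s : ℝ, Z (G s) = G (s + e)
  shift_cases : e = 0 ∨ e = 1 ∨ e = -1

theorem zpow_apply_eq_self {Z : CircleDeg1Liftˣ} {x : ℝ} (h : Z x = x) (k : ℤ) :
    (Z ^ k) x = x := by
  have h' : Z⁻¹ x = x := (units_inv_eq_iff Z).2 h.symm
  induction k with
  | zero => simp
  | succ k ih => rw [zpow_add_one, units_mul_apply, h, ih]
  | pred k ih => rw [zpow_sub_one, units_mul_apply, h', ih]

theorem zpow_add_one_apply (Z : CircleDeg1Liftˣ) (k : ℤ) (x : ℝ) :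
    (Z ^ (k + 1)) x = Z ((Z ^ k) x) := by
  rw [add_comm, zpow_one_add, units_mul_apply]

/-- The interval `[m, Z m)` is a fundamental domain for `Z` on `(l, r)`; parametrize it linearly by
`[0, 1)` and extend equivariantly. -/
theorem exists_translationChart_of_lt {Z : CircleDeg1Liftˣ} {l r : ℝ} (hlr : l < r) (hl : Z l = l)
    (hr : Z r = r) (h : ∀ x ∈ Ioo l r, x < Z x) : ∃ G, IsTranslationChart Z l r G 1 := by
  set m := (l + r) / 2 with hm_def
  have hm : m ∈ Ioo l r := ⟨by linarith, by linarith⟩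
  have hmem : ∀ (k : ℤ) (x : ℝ), x ∈ Ioo l r → (Z ^ k) x ∈ Ioo l r := by
    intro k x hx
    constructor
    · simpa [zpow_apply_eq_self hl] using strictMono_units (Z ^ k) hx.1
    · simpa [zpow_apply_eq_self hr] using strictMono_units (Z ^ k) hx.2
  have hstep : ∀ k : ℤ, (Z ^ k) m < (Z ^ (k + 1)) m := fun k => by
    rw [zpow_add_one_apply]; exact h _ (hmem k m hm)
  have hmono : StrictMono fun k : ℤ => (Z ^ k) m := strictMono_int_of_lt_succ hstep
  have hZm : m < Z m := h m hm
  have hZmr : Z m < r := by simpa using (hmem 1 m hm).2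
  have hup : ∀ x ∈ Ioo l r, ∃ k : ℤ, x < (Z ^ k) m := by
    intro x hx
    by_contra! hle
    have hb : BddAbove (range fun k : ℤ => (Z ^ k) m) := ⟨x, by rintro _ ⟨k, rfl⟩; exact hle k⟩
    set c := sSup (range fun k : ℤ => (Z ^ k) m)
    have hc : c ∈ Ioo l r :=
      ⟨hm.1.trans_le (le_csSup hb ⟨0, by simp⟩),
        (csSup_le (range_nonempty _) (by rintro _ ⟨k, rfl⟩; exact hle k)).trans_lt hx.2⟩
    -- An interior supremum `c` of the orbit is impossible: some orbit point exceeds `Z⁻¹ c`, and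
    -- its successor exceeds `c`.
    have h1 : Z⁻¹ c < c := by simpa using strictMono_units Z⁻¹ (h c hc)
    obtain ⟨_, ⟨k, rfl⟩, hk⟩ := exists_lt_of_lt_csSup (range_nonempty _) h1
    have h2 := strictMono_units Z hk
    rw [units_apply_inv_apply] at h2
    simp only [← zpow_add_one_apply] at h2
    exact absurd (le_csSup hb ⟨k + 1, rfl⟩) (not_le.2 h2)
  have hdown : ∀ x ∈ Ioo l r, ∃ k : ℤ, (Z ^ k) m ≤ x := by
    intro x hx
    by_contra! hle
    have hb : BddBelow (range fun k : ℤ => (Z ^ k) m) :=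
      ⟨x, by rintro _ ⟨k, rfl⟩; exact (hle k).le⟩
    set c := sInf (range fun k : ℤ => (Z ^ k) m)
    have hc : c ∈ Ioo l r :=
      ⟨hx.1.trans_le (le_csInf (range_nonempty _) (by rintro _ ⟨k, rfl⟩; exact (hle k).le)),
        (csInf_le hb ⟨0, by simp⟩).trans_lt hm.2⟩
    obtain ⟨_, ⟨k, rfl⟩, hk⟩ := exists_lt_of_csInf_lt (range_nonempty _) (h c hc)
    have h2 : (Z ^ (k - 1 + 1)) m < Z c := by simpa using hk
    rw [zpow_add_one_apply, (strictMono_units Z).lt_iff_lt] at h2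
    exact absurd (csInf_le hb ⟨k - 1, rfl⟩) (not_le.2 h2)
  let G : ℝ → ℝ := fun s => (Z ^ ⌊s⌋) (m + Int.fract s * (Z m - m))
  have hu : ∀ s : ℝ, m ≤ m + Int.fract s * (Z m - m) ∧ m + Int.fract s * (Z m - m) < Z m := by
    intro s
    have h1 := Int.fract_nonneg s
    have h2 := Int.fract_lt_one s
    constructor <;> nlinarith
  refine ⟨G, ?_, ?_, ?_, Or.inr (Or.inl rfl)⟩
  · intro s t hst
    rcases (Int.floor_mono hst.le).eq_or_lt with heq | hlt
    · have h1 : Int.fract s < Int.fract t := by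
        unfold Int.fract; rw [heq]; linarith
      simp only [G, heq]
      apply strictMono_units
      nlinarith
    · calc G s < (Z ^ ⌊s⌋) (Z m) := strictMono_units _ (hu s).2
        _ = (Z ^ (⌊s⌋ + 1)) m := by rw [zpow_add_one, units_mul_apply]
        _ ≤ (Z ^ ⌊t⌋) m := hmono.monotone hlt
        _ ≤ G t := (strictMono_units _).monotone (hu t).1
  · ext x
    constructor
    · rintro ⟨s, rfl⟩
      exact hmem _ _ ⟨hm.1.trans_le (hu s).1, (hu s).2.trans hZmr⟩
    · intro hx
      obtain ⟨k0, hk0⟩ := hup x hx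
      obtain ⟨k, hk, hkmax⟩ := Int.exists_greatest_of_bdd (P := fun k : ℤ => (Z ^ k) m ≤ x)
        ⟨k0, fun z hz => (hmono.lt_iff_lt.1 (hz.trans_lt hk0)).le⟩ (hdown x hx)
      have hk1 : x < (Z ^ (k + 1)) m := by
        by_contra! hcon
        exact absurd (hkmax _ hcon) (by omega)
      set y := (Z ^ k)⁻¹ x with hy
      have hy1 : m ≤ y := by
        have := (strictMono_units (Z ^ k)⁻¹).monotone hk
        simpa using this
      have hy2 : y < Z m := by
        have := strictMono_units (Z ^ k)⁻¹ hk1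
        rwa [zpow_add_one, units_mul_apply, units_inv_apply_apply] at this
      have hd : 0 < Z m - m := by linarith
      have ht0 : 0 ≤ (y - m) / (Z m - m) := div_nonneg (by linarith) hd.le
      have ht1 : (y - m) / (Z m - m) < 1 := by rw [div_lt_one hd]; linarith
      refine ⟨k + (y - m) / (Z m - m), ?_⟩
      have hfl : ⌊(k : ℝ) + (y - m) / (Z m - m)⌋ = k := by
        rw [Int.floor_eq_iff]; constructor <;> linarith
      simp only [G, Int.fract, hfl]
      rw [add_sub_cancel_left, div_mul_cancel₀ _ hd.ne', add_sub_cancel, hy, units_apply_inv_apply]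
  · intro s
    simp only [G, Int.cast_one, Int.floor_add_one, Int.fract_add_one]
    rw [zpow_add_one_apply]

theorem exists_translationChart {Z : CircleDeg1Liftˣ} {l r : ℝ} (hlr : l < r) (hl : Z l = l)
    (hr : Z r = r)
    (h : (∀ x ∈ Ioo l r, Z x = x) ∨ (∀ x ∈ Ioo l r, x < Z x) ∨ (∀ x ∈ Ioo l r, Z x < x)) :
    ∃ (G : ℝ → ℝ) (e : ℤ), IsTranslationChart Z l r G e := by
  rcases h with h | h | h
  · let G : ℝ → ℝ := fun s => (l + r) / 2 + (r - l) / Real.pi * Real.arctan s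
    have hc : 0 < (r - l) / Real.pi := div_pos (by linarith) Real.pi_pos
    have hrange : range G = Ioo l r := by
      ext x
      constructor
      · rintro ⟨s, rfl⟩
        have h1 := mul_lt_mul_of_pos_left (Real.arctan_lt_pi_div_two s) hc
        have h2 := mul_lt_mul_of_pos_left (Real.neg_pi_div_two_lt_arctan s) hc
        have h3 : (r - l) / Real.pi * (Real.pi / 2) = (r - l) / 2 := by
          field_simp
        have h4 : (r - l) / Real.pi * -(Real.pi / 2) = -((r - l) / 2) := by
          rw [mul_neg, h3]
        rw [h3] at h1
        rw [h4] at h2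
        exact ⟨by simp only [G]; linarith, by simp only [G]; linarith⟩
      · intro hx
        have hlr' : 0 < r - l := by linarith
        refine ⟨Real.tan (Real.pi * ((x - (l + r) / 2) / (r - l))), ?_⟩
        simp only [G]
        rw [Real.arctan_tan]
        · field_simp
          ring
        · have : -(1 / 2) < (x - (l + r) / 2) / (r - l) := by
            rw [lt_div_iff₀ hlr']; linarith [hx.1]
          nlinarith [Real.pi_pos]
        · have : (x - (l + r) / 2) / (r - l) < 1 / 2 := by
            rw [div_lt_iff₀ hlr']; linarith [hx.2]
          nlinarith [Real.pi_pos]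
    refine ⟨G, 0, ?_, hrange, ?_, Or.inl rfl⟩
    · intro s t hst
      have := mul_lt_mul_of_pos_left (Real.arctan_strictMono hst) hc
      simp only [G]; linarith
    · intro s
      rw [h _ (hrange ▸ mem_range_self s)]
      simp
  · obtain ⟨G, hG⟩ := exists_translationChart_of_lt hlr hl hr h
    exact ⟨G, 1, hG⟩
  · obtain ⟨G, hG⟩ := exists_translationChart_of_lt (Z := Z⁻¹) hlr
      ((units_inv_eq_iff Z).2 hl.symm) ((units_inv_eq_iff Z).2 hr.symm) (by
        have hl' := (units_inv_eq_iff Z).2 hl.symm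
        have hr' := (units_inv_eq_iff Z).2 hr.symm
        intro x hx
        have h1 : Z⁻¹ x ∈ Ioo l r :=
          ⟨by simpa [hl'] using strictMono_units Z⁻¹ hx.1,
            by simpa [hr'] using strictMono_units Z⁻¹ hx.2⟩
        simpa using h _ h1)
    refine ⟨G, -1, hG.strictMono, hG.range_eq, fun s => ?_, Or.inr (Or.inr rfl)⟩
    have h1 := hG.map_apply (s + (-1 : ℤ))
    rw [units_inv_eq_iff] at h1
    rw [h1, Int.cast_neg, Int.cast_one, neg_add_cancel_right]

/-! ### Gaps of periodic closed sets -/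

/-- The left endpoint of the gap of `Q` around `x`. -/
noncomputable def gapLeft (Q : Set ℝ) (x : ℝ) : ℝ := sSup (Q ∩ Iic x)

/-- The right endpoint of the gap of `Q` around `x`. -/
noncomputable def gapRight (Q : Set ℝ) (x : ℝ) : ℝ := sInf (Q ∩ Ici x)

/-- A nonempty closed subset of the line invariant under the unit translation. -/
structure IsPeriodicClosed (Q : Set ℝ) : Prop where
  isClosed : IsClosed Q
  nonempty : Q.Nonempty
  add_int : ∀ (x : ℝ) (n : ℤ), x + n ∈ Q ↔ x ∈ Q

namespace IsPeriodicClosed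

variable {Q : Set ℝ}

theorem exists_mem_Iic (hQ : IsPeriodicClosed Q) (x : ℝ) : (Q ∩ Iic x).Nonempty := by
  obtain ⟨q, hq⟩ := hQ.nonempty
  refine ⟨q + (-⌈q - x⌉ : ℤ), (hQ.add_int _ _).2 hq, ?_⟩
  have := Int.le_ceil (q - x)
  simp only [mem_Iic]; push_cast; linarith

theorem exists_mem_Ici (hQ : IsPeriodicClosed Q) (x : ℝ) : (Q ∩ Ici x).Nonempty := by
  obtain ⟨q, hq⟩ := hQ.nonempty
  refine ⟨q + (-⌊q - x⌋ : ℤ), (hQ.add_int _ _).2 hq, ?_⟩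
  have := Int.floor_le (q - x)
  simp only [mem_Ici]; push_cast; linarith

theorem gapLeft_mem (hQ : IsPeriodicClosed Q) (x : ℝ) : gapLeft Q x ∈ Q ∩ Iic x :=
  (hQ.isClosed.inter isClosed_Iic).csSup_mem (hQ.exists_mem_Iic x)
    (bddAbove_Iic.mono inter_subset_right)

theorem gapRight_mem (hQ : IsPeriodicClosed Q) (x : ℝ) : gapRight Q x ∈ Q ∩ Ici x :=
  (hQ.isClosed.inter isClosed_Ici).csInf_mem (hQ.exists_mem_Ici x)
    (bddBelow_Ici.mono inter_subset_right)

theorem le_gapLeft {q x : ℝ} (hq : q ∈ Q) (hqx : q ≤ x) : q ≤ gapLeft Q x :=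
  le_csSup (bddAbove_Iic.mono inter_subset_right) ⟨hq, hqx⟩

theorem gapRight_le {q x : ℝ} (hq : q ∈ Q) (hqx : x ≤ q) : gapRight Q x ≤ q :=
  csInf_le (bddBelow_Ici.mono inter_subset_right) ⟨hq, hqx⟩

theorem mem_gap (hQ : IsPeriodicClosed Q) {x : ℝ} (hx : x ∉ Q) :
    x ∈ Ioo (gapLeft Q x) (gapRight Q x) := by
  obtain ⟨h1, h2⟩ := hQ.gapLeft_mem x
  obtain ⟨h3, h4⟩ := hQ.gapRight_mem x
  exact ⟨lt_of_le_of_ne h2 fun h => hx (h ▸ h1), lt_of_le_of_ne h4 fun h => hx (h ▸ h3)⟩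

theorem notMem_of_mem_gap {x y : ℝ}
    (hy : y ∈ Ioo (gapLeft Q x) (gapRight Q x)) : y ∉ Q := by
  intro hyQ
  rcases le_total y x with h | h
  · exact absurd (le_gapLeft hyQ h) (not_le.2 hy.1)
  · exact absurd (gapRight_le hyQ h) (not_le.2 hy.2)

theorem gapLeft_eq (hQ : IsPeriodicClosed Q) {x y : ℝ}
    (hy : y ∈ Ioo (gapLeft Q x) (gapRight Q x)) : gapLeft Q y = gapLeft Q x := by
  apply le_antisymm
  · by_contra! h
    exact notMem_of_mem_gap ⟨h, (hQ.gapLeft_mem y).2.trans_lt hy.2⟩ (hQ.gapLeft_mem y).1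
  · exact le_gapLeft (hQ.gapLeft_mem x).1 hy.1.le

theorem gapLeft_add_int (hQ : IsPeriodicClosed Q) (x : ℝ) (n : ℤ) :
    gapLeft Q (x + n) = gapLeft Q x + n := by
  apply le_antisymm
  · rw [← sub_le_iff_le_add]
    obtain ⟨h1, h2⟩ := hQ.gapLeft_mem (x + n)
    refine le_gapLeft ?_ (by simpa using h2)
    rw [← hQ.add_int _ n, sub_add_cancel]; exact h1
  · obtain ⟨h1, h2⟩ := hQ.gapLeft_mem x
    exact le_gapLeft ((hQ.add_int _ _).2 h1) (by simpa using h2)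

theorem gapRight_add_int (hQ : IsPeriodicClosed Q) (x : ℝ) (n : ℤ) :
    gapRight Q (x + n) = gapRight Q x + n := by
  apply le_antisymm
  · obtain ⟨h1, h2⟩ := hQ.gapRight_mem x
    exact gapRight_le ((hQ.add_int _ _).2 h1) (by simpa using h2)
  · rw [← le_sub_iff_add_le]
    obtain ⟨h1, h2⟩ := hQ.gapRight_mem (x + n)
    refine gapRight_le ?_ (by simpa [le_sub_iff_add_le] using h2)
    rw [← hQ.add_int _ n, sub_add_cancel]; exact h1

end IsPeriodicClosed

/-! ### Systems of charts for the gaps -/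

/-- Charts of all the gaps of a periodic closed set `Q` of fixed points of `Z`, in which `Z` acts
by integer translations, compatible with the unit translation. -/
structure ChartSystem (Z : CircleDeg1Liftˣ) where
  /-- The complement of the charts. -/
  Q : Set ℝ
  isPeriodicClosed : IsPeriodicClosed Q
  interior_eq : interior Q = ∅
  map_eq : ∀ x ∈ Q, Z x = x
  /-- The chart of the gap with left endpoint `l`. -/
  G : ℝ → ℝ → ℝ
  /-- The translation given by `Z` in the chart with left endpoint `l`. -/
  e : ℝ → ℤ
  isChart : ∀ x ∉ Q, IsTranslationChart Z (gapLeft Q x) (gapRight Q x) (G (gapLeft Q x))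
    (e (gapLeft Q x))
  G_add_int : ∀ (l s : ℝ) (n : ℤ), G (l + n) s = G l s + n

/-- Off the frontier of the fixed point set, the line is covered by three disjoint open sets
according to the sign of the displacement, and an interval is connected. -/
theorem fixed_or_lt_or_gt {Z : CircleDeg1Liftˣ} {l r : ℝ}
    (h : Disjoint (Ioo l r) (frontier {x | Z x = x})) :
    (∀ x ∈ Ioo l r, Z x = x) ∨ (∀ x ∈ Ioo l r, x < Z x) ∨ (∀ x ∈ Ioo l r, Z x < x) := by
  have hc : IsPreconnected (Ioo l r) := isPreconnected_Ioo
  have hZ := continuous_units Z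
  have hcl : IsClosed {x : ℝ | Z x = x} := isClosed_eq hZ continuous_id
  have o1 : IsOpen {x : ℝ | x < Z x} := isOpen_lt continuous_id hZ
  have o2 : IsOpen {x : ℝ | Z x < x} := isOpen_lt hZ continuous_id
  have h1 : Ioo l r ⊆ interior {x | Z x = x} ∪ ({x : ℝ | x < Z x} ∪ {x : ℝ | Z x < x}) := by
    intro x hx
    rcases lt_trichotomy x (Z x) with hlt | heq | hgt
    · exact Or.inr (Or.inl hlt)
    · left
      by_contra hni
      exact disjoint_left.1 h hx ⟨subset_closure heq.symm, hni⟩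
    · exact Or.inr (Or.inr hgt)
  rcases hc.subset_or_subset isOpen_interior (o1.union o2) (by
    rw [disjoint_left]
    intro x hx hx'
    have hx := interior_subset hx
    have hx : Z x = x := hx
    rcases hx' with hx' | hx'
    · exact absurd hx.symm (ne_of_lt hx')
    · exact absurd hx (ne_of_lt hx')) h1 with h2 | h2
  · refine Or.inl fun x hx => ?_
    have h3 := interior_subset (h2 hx)
    exact h3
  · rcases hc.subset_or_subset o1 o2 (by
      rw [disjoint_left]
      intro x hx hx'
      exact absurd (show x < Z x from hx) (not_lt.2 (le_of_lt hx'))) h2 with h3 | h3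
    · exact Or.inr (Or.inl h3)
    · exact Or.inr (Or.inr h3)

theorem nonempty_chartSystem {Z : CircleDeg1Liftˣ} {q : ℝ} (hq : Z q = q) :
    Nonempty (ChartSystem Z) := by
  have hcl : IsClosed {x : ℝ | Z x = x} := isClosed_eq (continuous_units Z) continuous_id
  set R : Set ℝ := (fun x : ℝ => (x : UnitAddCircle)) ⁻¹' {(q : UnitAddCircle)}
  have hR : IsClosed R := isClosed_singleton.preimage (AddCircle.continuous_mk' 1)
  have hRmem : ∀ x, x ∈ R ↔ ∃ n : ℤ, x = q + n := fun x => coe_eq_coe_iff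
  have hRi : interior R = ∅ := by
    rw [interior_eq_empty_iff_dense_compl]
    apply Set.Countable.dense_compl ℝ
    refine (countable_range fun n : ℤ => q + (n : ℝ)).mono ?_
    intro x hx
    obtain ⟨n, rfl⟩ := (hRmem x).1 hx
    exact mem_range_self n
  -- The frontier alone may be empty, for instance if `Z` is the identity. Adding the translates of
  -- the fixed point `q` makes `Q` nonempty and all gaps bounded, and keeps its interior empty.
  set Q : Set ℝ := frontier {x | Z x = x} ∪ R
  have hper : ∀ (x : ℝ) (n : ℤ), x + n ∈ Q ↔ x ∈ Q := by
    intro x n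
    have h1 : x + n ∈ frontier {x | Z x = x} ↔ x ∈ frontier {x | Z x = x} := by
      have := (Homeomorph.addRight (n : ℝ)).preimage_frontier {x | Z x = x}
      have h2 : (Homeomorph.addRight (n : ℝ)) ⁻¹' {x : ℝ | Z x = x} = {x | Z x = x} := by
        ext y; simp
      rw [h2] at this
      conv_rhs => rw [← this]
      rfl
    have h3 : x + n ∈ R ↔ x ∈ R := by
      simp only [R, mem_preimage, mem_singleton_iff, coe_add_int]
    exact or_congr h1 h3
  have hQ : IsPeriodicClosed Q :=
    ⟨isClosed_frontier.union hR, ⟨q, Or.inr rfl⟩, hper⟩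
  have hfix : ∀ x ∈ Q, Z x = x := by
    rintro x (hx | hx)
    · exact hcl.frontier_subset hx
    · obtain ⟨n, rfl⟩ := (hRmem x).1 hx
      rw [map_add_int, hq]
  have hex : ∀ l : ℝ, ∃ (G : ℝ → ℝ) (e : ℤ), ∀ x ∉ Q, gapLeft Q x = l →
      IsTranslationChart Z (gapLeft Q x) (gapRight Q x) G e := by
    intro l
    by_cases hl : ∃ x ∉ Q, gapLeft Q x = l
    · obtain ⟨x, hx, rfl⟩ := hl
      have hlr := hQ.mem_gap hx
      obtain ⟨G, e, hG⟩ := exists_translationChart (Z := Z) (hlr.1.trans hlr.2)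
        (hfix _ (hQ.gapLeft_mem x).1) (hfix _ (hQ.gapRight_mem x).1) (fixed_or_lt_or_gt (by
          rw [disjoint_left]
          intro y hy hy'
          exact IsPeriodicClosed.notMem_of_mem_gap hy (Or.inl hy')))
      refine ⟨G, e, fun y hy hyx => ?_⟩
      have hyr : gapRight Q y = gapRight Q x := by
        have hy1 := hQ.mem_gap hy
        rw [hyx] at hy1
        apply le_antisymm
        · refine IsPeriodicClosed.gapRight_le (hQ.gapRight_mem x).1 ?_
          by_contra! hlt
          exact absurd (IsPeriodicClosed.le_gapLeft (hQ.gapRight_mem x).1 hlt.le)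
            (not_le.2 (hyx ▸ (hlr.1.trans hlr.2)))
        · refine IsPeriodicClosed.gapRight_le (hQ.gapRight_mem y).1 ?_
          by_contra! hlt
          exact absurd (IsPeriodicClosed.le_gapLeft (hQ.gapRight_mem y).1 hlt.le)
            (not_le.2 (hy1.1.trans hy1.2))
      rw [hyx, hyr]
      exact hG
    · exact ⟨fun x => x, 0, fun x hx hxl => absurd ⟨x, hx, hxl⟩ hl⟩
  choose G e hG using hex
  -- Only charts with left endpoint in `[0, 1)` are chosen freely; the others are their integer
  -- translates, so the system is compatible with the unit translation.
  refine ⟨⟨Q, hQ, ?_, hfix, fun l s => G (Int.fract l) s + ⌊l⌋, fun l => e (Int.fract l), ?_, ?_⟩⟩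
  · rw [interior_union_isClosed_of_interior_empty isClosed_frontier hRi, interior_frontier hcl]
  · intro x hx
    set n := ⌊gapLeft Q x⌋ with hn
    have hl : gapLeft Q (x + (-n : ℤ)) = Int.fract (gapLeft Q x) := by
      rw [hQ.gapLeft_add_int, Int.fract]; push_cast; ring
    have h1 := hG (Int.fract (gapLeft Q x)) (x + (-n : ℤ)) (by rwa [hper]) hl
    rw [hQ.gapRight_add_int, hl] at h1
    refine ⟨fun s t hst => by simpa using h1.strictMono hst, ?_, fun s => ?_, h1.shift_cases⟩
    · have h2 : range (fun s => G (Int.fract (gapLeft Q x)) s + (n : ℝ))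
          = (fun y => y + (n : ℝ)) '' range (G (Int.fract (gapLeft Q x))) := by
        rw [← range_comp]; rfl
      rw [h2, h1.range_eq, image_add_const_Ioo, Int.fract, ← hn]
      push_cast
      congr 1 <;> ring_nf
    · rw [map_add_int, h1.map_apply]
  · intro l s n
    simp only [Int.fract_add_intCast, Int.floor_add_intCast]
    push_cast
    ring

/-! ### Elements of the centralizer of `Z` built in the charts -/

namespace ChartSystem

variable {Z : CircleDeg1Liftˣ} (S : ChartSystem Z)

/-- The left endpoint of the gap containing `x`. -/
noncomputable def left (x : ℝ) : ℝ := gapLeft S.Q x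

/-- The coordinate of `x` in the chart of its gap. -/
noncomputable def coord (x : ℝ) : ℝ := Function.invFun (S.G (S.left x)) x

variable {S}

theorem chart {x : ℝ} (hx : x ∉ S.Q) :
    IsTranslationChart Z (S.left x) (gapRight S.Q x) (S.G (S.left x)) (S.e (S.left x)) :=
  S.isChart x hx

theorem G_mem_gap {x : ℝ} (hx : x ∉ S.Q) (s : ℝ) :
    S.G (S.left x) s ∈ Ioo (gapLeft S.Q x) (gapRight S.Q x) := by
  have h := mem_range_self (f := S.G (S.left x)) s
  rwa [(chart hx).range_eq] at h

theorem G_notMem {x : ℝ} (hx : x ∉ S.Q) (s : ℝ) : S.G (S.left x) s ∉ S.Q :=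
  IsPeriodicClosed.notMem_of_mem_gap (G_mem_gap hx s)

theorem left_G {x : ℝ} (hx : x ∉ S.Q) (s : ℝ) : S.left (S.G (S.left x) s) = S.left x :=
  S.isPeriodicClosed.gapLeft_eq (G_mem_gap hx s)

theorem G_coord {x : ℝ} (hx : x ∉ S.Q) : S.G (S.left x) (S.coord x) = x := by
  apply Function.invFun_eq
  have h : x ∈ range (S.G (S.left x)) := by
    rw [(chart hx).range_eq]; exact S.isPeriodicClosed.mem_gap hx
  exact h

theorem coord_G {x : ℝ} (hx : x ∉ S.Q) (s : ℝ) : S.coord (S.G (S.left x) s) = s := by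
  rw [coord, left_G hx]
  exact Function.leftInverse_invFun (chart hx).strictMono.injective s

theorem left_add_int (x : ℝ) (n : ℤ) : S.left (x + n) = S.left x + n :=
  S.isPeriodicClosed.gapLeft_add_int x n

theorem coord_add_int {x : ℝ} (hx : x ∉ S.Q) (n : ℤ) : S.coord (x + n) = S.coord x := by
  have hx' : x + n ∉ S.Q := by rwa [S.isPeriodicClosed.add_int]
  apply (chart hx').strictMono.injective
  rw [G_coord hx', left_add_int, S.G_add_int, G_coord hx]

theorem continuous_G {x : ℝ} (hx : x ∉ S.Q) : Continuous (S.G (S.left x)) :=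
  ((chart hx).strictMono.isEmbedding_of_ordConnected
    (by rw [(chart hx).range_eq]; exact ordConnected_Ioo)).continuous

theorem isOpenEmbedding_G {x : ℝ} (hx : x ∉ S.Q) : IsOpenEmbedding (S.G (S.left x)) :=
  ⟨(chart hx).strictMono.isEmbedding_of_ordConnected
    (by rw [(chart hx).range_eq]; exact ordConnected_Ioo), by
    rw [(chart hx).range_eq]; exact isOpen_Ioo⟩

variable (S)

open Classical in
/-- Move each gap by an element of `CircleDeg1Liftˣ` written in its chart. -/
noncomputable def move (κ : UnitAddCircle → CircleDeg1Liftˣ) (x : ℝ) : ℝ :=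
  if x ∈ S.Q then x else S.G (S.left x) (κ (S.left x : ℝ) (S.coord x))

variable {S}

theorem move_of_mem (κ : UnitAddCircle → CircleDeg1Liftˣ) {x : ℝ} (hx : x ∈ S.Q) :
    S.move κ x = x := if_pos hx

theorem move_of_notMem (κ : UnitAddCircle → CircleDeg1Liftˣ) {x : ℝ} (hx : x ∉ S.Q) :
    S.move κ x = S.G (S.left x) (κ (S.left x : ℝ) (S.coord x)) := if_neg hx

theorem move_G (κ : UnitAddCircle → CircleDeg1Liftˣ) {x : ℝ} (hx : x ∉ S.Q) (s : ℝ) :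
    S.move κ (S.G (S.left x) s) = S.G (S.left x) (κ (S.left x : ℝ) s) := by
  rw [move_of_notMem κ (G_notMem hx s), left_G hx, coord_G hx]

theorem le_move (κ : UnitAddCircle → CircleDeg1Liftˣ) {q x : ℝ} (hq : q ∈ S.Q) (h : q ≤ x) :
    q ≤ S.move κ x := by
  by_cases hx : x ∈ S.Q
  · rwa [move_of_mem κ hx]
  · rw [move_of_notMem κ hx]
    exact (IsPeriodicClosed.le_gapLeft hq h).trans (G_mem_gap hx _).1.le

theorem move_le (κ : UnitAddCircle → CircleDeg1Liftˣ) {q x : ℝ} (hq : q ∈ S.Q) (h : x ≤ q) :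
    S.move κ x ≤ q := by
  by_cases hx : x ∈ S.Q
  · rwa [move_of_mem κ hx]
  · rw [move_of_notMem κ hx]
    exact (G_mem_gap hx _).2.le.trans (IsPeriodicClosed.gapRight_le hq h)

theorem monotone_move (κ : UnitAddCircle → CircleDeg1Liftˣ) : Monotone (S.move κ) := by
  intro x y hxy
  by_cases h : ∃ q ∈ S.Q, x ≤ q ∧ q ≤ y
  · obtain ⟨q, hq, hxq, hqy⟩ := h
    exact (move_le κ hq hxq).trans (le_move κ hq hqy)
  · push Not at h
    have hx : x ∉ S.Q := fun hx => absurd (h x hx le_rfl) (not_lt.2 hxy)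
    have hy : y ∉ S.Q := fun hy => lt_irrefl _ (h y hy hxy)
    obtain ⟨h1, h2⟩ := S.isPeriodicClosed.gapRight_mem x
    have hmem : y ∈ Ioo (gapLeft S.Q x) (gapRight S.Q x) :=
      ⟨(S.isPeriodicClosed.mem_gap hx).1.trans_le hxy, h _ h1 h2⟩
    have hl : S.left y = S.left x := S.isPeriodicClosed.gapLeft_eq hmem
    have hm := (chart hx).strictMono
    rw [move_of_notMem κ hx, move_of_notMem κ hy, hl]
    apply hm.monotone
    apply (strictMono_units _).monotone
    rw [← hm.le_iff_le, G_coord hx, ← hl, G_coord hy]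
    exact hxy

theorem move_add_int (κ : UnitAddCircle → CircleDeg1Liftˣ) (x : ℝ) (n : ℤ) :
    S.move κ (x + n) = S.move κ x + n := by
  by_cases hx : x ∈ S.Q
  · rw [move_of_mem κ hx, move_of_mem κ ((S.isPeriodicClosed.add_int _ _).2 hx)]
  · have hx' : x + n ∉ S.Q := by rwa [S.isPeriodicClosed.add_int]
    rw [move_of_notMem κ hx, move_of_notMem κ hx', coord_add_int hx, left_add_int, coe_add_int,
      S.G_add_int]

variable (S)

/-- The action of families of elements of `CircleDeg1Liftˣ` through the charts. -/
noncomputable def blendHom : (UnitAddCircle → CircleDeg1Liftˣ) →* CircleDeg1Lift where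
  toFun κ := ⟨⟨S.move κ, monotone_move κ⟩, fun x => by
    have := move_add_int (S := S) κ x 1
    simpa using this⟩
  map_one' := by
    ext x
    change S.move 1 x = x
    by_cases hx : x ∈ S.Q
    · exact move_of_mem _ hx
    · rw [move_of_notMem _ hx, Pi.one_apply, units_one_apply, G_coord hx]
  map_mul' κ κ' := by
    ext x
    change S.move (κ * κ') x = S.move κ (S.move κ' x)
    by_cases hx : x ∈ S.Q
    · rw [move_of_mem κ' hx, move_of_mem _ hx, move_of_mem _ hx]
    · rw [move_of_notMem κ' hx, move_of_notMem _ hx, move_G κ hx]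
      rfl

/-- The action of families of elements of `CircleDeg1Liftˣ` through the charts, as units. -/
noncomputable def blend : (UnitAddCircle → CircleDeg1Liftˣ) →* CircleDeg1Liftˣ :=
  S.blendHom.toHomUnits

variable {S}

theorem blend_apply (κ : UnitAddCircle → CircleDeg1Liftˣ) (x : ℝ) :
    S.blend κ x = S.move κ x := rfl

theorem Z_eq {x : ℝ} (hx : x ∉ S.Q) :
    Z x = S.G (S.left x) (S.coord x + S.e (S.left x)) := by
  rw [← (chart hx).map_apply, G_coord hx]

/-- In each chart `Z` is an integer translation, and elements of `CircleDeg1Liftˣ` commute with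
those. -/
theorem commute_blend (κ : UnitAddCircle → CircleDeg1Liftˣ) : Commute (S.blend κ) Z := by
  refine units_ext fun x => ?_
  change S.move κ (Z x) = Z (S.move κ x)
  by_cases hx : x ∈ S.Q
  · rw [S.map_eq x hx, move_of_mem κ hx, S.map_eq x hx]
  · rw [Z_eq hx, move_G κ hx, move_of_notMem κ hx, (chart hx).map_apply, map_add_int]

theorem pointwiseContinuous_blend {Y : Type*} [TopologicalSpace Y]
    {κ : Y → UnitAddCircle → CircleDeg1Liftˣ} (h : ∀ c, PointwiseContinuous fun s => κ s c) :
    PointwiseContinuous fun s => S.blend (κ s) := by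
  intro x
  simp only [blend_apply]
  by_cases hx : x ∈ S.Q
  · simp only [move_of_mem _ hx]; exact continuous_const
  · simp only [move_of_notMem _ hx]
    exact (continuous_G hx).comp (h _ _)

/-! ### The flow commuting with `Z` and generic nowhere density -/

variable (S)

/-- A one-parameter group commuting with `Z` that moves all points of the gaps upwards. -/
noncomputable def flow (t : ℝ) : CircleDeg1Liftˣ :=
  S.blend fun _ => translate (Multiplicative.ofAdd t)

variable {S}

theorem flow_zero : S.flow 0 = 1 := by
  have h : (fun _ : UnitAddCircle => translate (Multiplicative.ofAdd (0 : ℝ))) = 1 := by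
    funext _; simp
  rw [flow, h, map_one]

theorem commute_flow (t : ℝ) : Commute (S.flow t) Z := commute_blend _

theorem pointwiseContinuous_flow : PointwiseContinuous S.flow := by
  refine pointwiseContinuous_blend fun c x => ?_
  simp only [translate_apply]
  fun_prop

theorem flow_lt {x : ℝ} (hx : x ∉ S.Q) {t t' : ℝ} (h : t < t') : S.flow t x < S.flow t' x := by
  simp only [flow, blend_apply, move_of_notMem _ hx, translate_apply]
  exact (chart hx).strictMono (by linarith)

theorem flow_le {t t' : ℝ} (h : t ≤ t') (x : ℝ) : S.flow t x ≤ S.flow t' x := by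
  by_cases hx : x ∈ S.Q
  · simp only [flow, blend_apply, move_of_mem _ hx]; rfl
  · rcases h.eq_or_lt with rfl | h
    · exact le_rfl
    · exact (flow_lt hx h).le

variable (S)

/-- The iterate is strictly increasing in `t` at every point outside the nowhere dense set `A ⁻¹'
Q`, so the interiors for different `t` are disjoint. A disjoint family of nonempty open subsets of
the line is countable. -/
theorem countable_flow_periodic_interior (A : CircleDeg1Liftˣ) {n : ℕ} (hn : n ≠ 0) (m : ℝ) :
    {t : ℝ | (interior {y : ℝ | ((S.flow t * A) ^ n) y = y + m}).Nonempty}.Countable := by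
  refine PairwiseDisjoint.countable_of_isOpen
    (s := fun t => interior {y : ℝ | ((S.flow t * A) ^ n) y = y + m}) ?_
    (fun _ _ => isOpen_interior) (fun _ h => h)
  have key : ∀ t t' : ℝ, t < t' → Disjoint (interior {y : ℝ | ((S.flow t * A) ^ n) y = y + m})
      (interior {y : ℝ | ((S.flow t' * A) ^ n) y = y + m}) := by
    intro t t' htt'
    rw [disjoint_iff_inter_eq_empty, ← interior_inter]
    by_contra hne
    have hd : Dense (A ⁻¹' S.Q : Set ℝ)ᶜ := by
      rw [← interior_eq_empty_iff_dense_compl]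
      have h1 := ((toOrderIso A).toHomeomorph).preimage_interior S.Q
      rw [S.interior_eq, preimage_empty] at h1
      exact h1.symm
    obtain ⟨y, hyU, hy⟩ := hd.inter_open_nonempty _ isOpen_interior (nonempty_iff_ne_empty.2 hne)
    obtain ⟨h1, h2⟩ := interior_subset hyU
    have h1 : ((S.flow t * A) ^ n) y = y + m := h1
    have h2 : ((S.flow t' * A) ^ n) y = y + m := h2
    obtain ⟨k, rfl⟩ := Nat.exists_eq_succ_of_ne_zero hn
    have hle : ((S.flow t * A : CircleDeg1Liftˣ) : CircleDeg1Lift) ≤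
        ((S.flow t' * A : CircleDeg1Liftˣ) : CircleDeg1Lift) := fun x => flow_le htt'.le _
    have h3 : ((S.flow t * A) ^ k.succ) y < ((S.flow t' * A) ^ k.succ) y := by
      rw [pow_succ, pow_succ, units_mul_apply, units_mul_apply]
      calc ((S.flow t * A) ^ k) ((S.flow t * A) y)
          < ((S.flow t * A) ^ k) ((S.flow t' * A) y) := strictMono_units _ (flow_lt hy htt')
        _ ≤ ((S.flow t' * A) ^ k) ((S.flow t' * A) y) := by
          have := pow_mono hle k ((S.flow t' * A) y)
          simpa using this
    exact absurd (h1.trans h2.symm) h3.ne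
  intro t _ t' _ hne
  rcases lt_or_gt_of_ne hne with h | h
  · exact key t t' h
  · exact (key t' t h).symm

theorem exists_flow_periodic_interior_empty (A : CircleDeg1Liftˣ) {n : ℕ} (hn : n ≠ 0) (m : ℝ)
    {δ : ℝ} (hδ : 0 < δ) : ∃ t : ℝ, 0 < t ∧ t < δ ∧
      interior {y : ℝ | ((S.flow t * A) ^ n) y = y + m} = ∅ := by
  have h := (S.countable_flow_periodic_interior A hn m).dense_compl ℝ
  obtain ⟨t, ht, ht'⟩ := h.inter_open_nonempty _ isOpen_Ioo (nonempty_Ioo.2 hδ)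
  exact ⟨t, ht.1, ht.2, not_nonempty_iff_eq_empty.1 ht'⟩

end ChartSystem

/-! ### Displacing one nowhere dense set off another -/

theorem exists_units_eq {f : ℝ → ℝ} (hm : StrictMono f) (hc : Continuous f)
    (h1 : ∀ x, f (x + 1) = f x + 1) : ∃ F : CircleDeg1Liftˣ, ∀ x : ℝ, F x = f x := by
  let F : CircleDeg1Lift := ⟨⟨f, hm.monotone⟩, h1⟩
  have hF : IsUnit F :=
    isUnit_iff_bijective.2 ⟨hm.injective, (continuous_iff_surjective F).1 hc⟩
  obtain ⟨U, hU⟩ := hF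
  exact ⟨U, fun x => by rw [hU]; rfl⟩

theorem exists_path_to (F : CircleDeg1Liftˣ) :
    ∃ κ : ℝ → CircleDeg1Liftˣ, PointwiseContinuous κ ∧ κ 0 = 1 ∧ κ 1 = F := by
  have hp : ∀ s : ℝ, 0 ≤ max 0 (min s 1) ∧ max 0 (min s 1) ≤ 1 := fun s =>
    ⟨le_max_left _ _, max_le zero_le_one (min_le_right _ _)⟩
  have h : ∀ s : ℝ, ∃ K : CircleDeg1Liftˣ, ∀ x : ℝ,
      K x = (1 - max 0 (min s 1)) * x + max 0 (min s 1) * F x := by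
    intro s
    obtain ⟨h0, h1⟩ := hp s
    refine exists_units_eq (fun x y hxy => ?_) ?_ (fun x => ?_)
    · have hF := strictMono_units F hxy
      rcases h0.eq_or_lt with h2 | h2
      · rw [← h2]; linarith
      · nlinarith
    · exact (continuous_const.mul continuous_id).add
        (continuous_const.mul (continuous_units F))
    · rw [map_add_one]; ring
  choose κ hκ using h
  refine ⟨κ, fun x => ?_, units_ext fun x => ?_, units_ext fun x => ?_⟩
  · simp only [hκ]; fun_prop
  · rw [hκ]; simp
  · rw [hκ]; simp

/-- There is an element of `CircleDeg1Liftˣ` with displacement at most one that sends the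
complement of the `r`-neighbourhood of `θ + ℤ` into the `r'`-neighbourhood of `g + ℤ`. -/
theorem exists_contraction (θ g : ℝ) {r r' : ℝ} (hr : 0 < r) (hr' : 0 < r') :
    ∃ κ : CircleDeg1Liftˣ, (∀ x : ℝ, |κ x - x| ≤ 1) ∧
      ∀ x : ℝ, (∀ n : ℤ, r ≤ |x - θ - n|) → ∃ n : ℤ, |κ x - g - n| < r' := by
  set a : ℝ := 1 - min r (1 / 2) with ha
  have ha0 : 0 < a := by linarith [min_le_right r (1 / 2)]
  have ha1 : a < 1 := by
    have : 0 < min r (1 / 2) := by positivity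
    linarith
  have har : 1 - r ≤ a := by linarith [min_le_left r (1 / 2)]
  set c : ℝ := min (r' / 2) (1 / 2) with hc
  have hc0 : 0 < c := by positivity
  have hc1 : c ≤ 1 / 2 := min_le_right _ _
  have hcr : c < r' := (min_le_left _ _).trans_lt (by linarith)
  have h1a : 0 < 1 - a := by linarith
  -- On `[0, 1]`, `f` has the small slope `c < r'` up to `a ≥ 1 - r` and then climbs steeply to `1`.
  -- It squeezes almost the whole period into an interval shorter than `r'`.
  let f : ℝ → ℝ := fun u => (1 - c) * max 0 ((u - a) / (1 - a)) + c * u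
  have hf : StrictMono f := by
    intro u v huv
    have h1 : (u - a) / (1 - a) ≤ (v - a) / (1 - a) := by gcongr
    have h2 : max 0 ((u - a) / (1 - a)) ≤ max 0 ((v - a) / (1 - a)) := max_le_max le_rfl h1
    have h3 := mul_le_mul_of_nonneg_left h2 (by linarith : 0 ≤ 1 - c)
    have h4 := mul_lt_mul_of_pos_left huv hc0
    simp only [f]; linarith
  have hf0 : f 0 = 0 := by
    have : (0 - a) / (1 - a) ≤ 0 := div_nonpos_of_nonpos_of_nonneg (by linarith) h1a.le
    simp only [f, max_eq_left this]; ring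
  have hf1 : f 1 = 1 := by
    simp only [f, div_self h1a.ne', max_eq_right zero_le_one]; ring
  have hfc : Continuous f := by fun_prop
  have hfplateau : ∀ u, u ≤ a → f u = c * u := by
    intro u hu
    have : (u - a) / (1 - a) ≤ 0 := div_nonpos_of_nonpos_of_nonneg (by linarith) h1a.le
    simp only [f, max_eq_left this]; ring
  -- Replacing `g` by its translate in `[θ, θ + 1)` bounds the displacement: it is the sum of `g' -
  -- θ ∈ [0, 1)` and `f u - u ∈ (-1, 0]`.
  set g' : ℝ := θ + Int.fract (g - θ) with hg'
  have hgg : g = g' + ⌊g - θ⌋ := by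
    rw [hg', add_assoc, Int.fract_add_floor]; ring
  let F : ℝ → ℝ := fun x => g' + (⌊x - θ⌋ + f (Int.fract (x - θ)))
  have hFeq : ∀ x, F x = x + (g' - θ) + (f (Int.fract (x - θ)) - Int.fract (x - θ)) := by
    intro x
    have := Int.fract_add_floor (x - θ)
    simp only [F]; linarith
  have hFm : StrictMono F := by
    intro x y hxy
    have hx0 := Int.fract_nonneg (x - θ)
    have hx1 := Int.fract_lt_one (x - θ)
    have hy0 := Int.fract_nonneg (y - θ)
    have hle : ⌊x - θ⌋ ≤ ⌊y - θ⌋ := Int.floor_mono (by linarith)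
    simp only [F]
    rcases hle.eq_or_lt with heq | hlt
    · have h1 : Int.fract (x - θ) < Int.fract (y - θ) := by
        unfold Int.fract; rw [heq]; linarith
      have h2 := hf h1
      rw [heq]; linarith
    · have h1 := hf hx1
      have h2 := hf.monotone hy0
      have h3 : (⌊x - θ⌋ : ℝ) + 1 ≤ ⌊y - θ⌋ := by exact_mod_cast hlt
      linarith
  have hFc : Continuous F := by
    have h1 : Continuous ((fun u => f u - u) ∘ (Int.fract : ℝ → ℝ)) :=
      ContinuousOn.comp_fract'' (hfc.sub continuous_id).continuousOn (by rw [hf0, hf1]; norm_num)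
    have h2 : F = fun x => x + (g' - θ) + ((fun u => f u - u) ∘ Int.fract) (x - θ) := by
      funext x; exact hFeq x
    rw [h2]
    exact (continuous_id.add continuous_const).add (h1.comp (continuous_id.sub continuous_const))
  obtain ⟨κ, hκ⟩ := exists_units_eq hFm hFc (fun x => by
    rw [hFeq, hFeq]
    have : x + 1 - θ = x - θ + 1 := by ring
    rw [this, Int.fract_add_one]; ring)
  refine ⟨κ, fun x => ?_, fun x hx => ?_⟩
  · rw [hκ, hFeq]
    set u := Int.fract (x - θ)
    have hu0 : 0 ≤ u := Int.fract_nonneg _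
    have hu1 : u < 1 := Int.fract_lt_one _
    have h1 : 0 ≤ f u := by rw [← hf0]; exact hf.monotone hu0
    have h2 : max 0 ((u - a) / (1 - a)) ≤ u := by
      refine max_le hu0 ?_
      rw [div_le_iff₀ h1a]; nlinarith
    have h3 : f u ≤ u := by simp only [f]; nlinarith
    have h4 := Int.fract_nonneg (g - θ)
    have h5 := Int.fract_lt_one (g - θ)
    rw [abs_le]
    constructor <;> linarith
  · have hua : Int.fract (x - θ) ≤ a := by
      have h1 := hx (⌊x - θ⌋ + 1)
      have h2 : x - θ - ((⌊x - θ⌋ + 1 : ℤ) : ℝ) = Int.fract (x - θ) - 1 := by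
        unfold Int.fract; push_cast; ring
      rw [h2, abs_of_neg (by linarith [Int.fract_lt_one (x - θ)])] at h1
      linarith
    refine ⟨⌊x - θ⌋ - ⌊g - θ⌋, ?_⟩
    have h3 : F x - g - ((⌊x - θ⌋ - ⌊g - θ⌋ : ℤ) : ℝ) = c * Int.fract (x - θ) := by
      simp only [F, hfplateau _ hua]
      push_cast
      linarith
    rw [hκ, h3, abs_of_nonneg (mul_nonneg hc0.le (Int.fract_nonneg _))]
    nlinarith [Int.fract_lt_one (x - θ)]

/-- A closed set with empty interior, restricted to a bounded interval, stays away from some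
translate of the integers. -/
theorem exists_away_from_int {A : Set ℝ} (hA : IsClosed A) (hAi : interior A = ∅) (M : ℝ) :
    ∃ θ r : ℝ, 0 < r ∧ ∀ x ∈ A, |x| ≤ M → ∀ n : ℤ, r ≤ |x - θ - n| := by
  have hK : IsCompact (A ∩ Icc (-M) M) := isCompact_Icc.inter_left hA
  set P : Set ℝ := (fun x : ℝ => (x : UnitAddCircle)) ⁻¹'
    ((fun x : ℝ => (x : UnitAddCircle)) '' (A ∩ Icc (-M) M))
  have hP : IsClosed P :=
    (hK.image (AddCircle.continuous_mk' 1)).isClosed.preimage (AddCircle.continuous_mk' 1)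
  -- By Baire, some `θ` lies in no integer translate of `A`; compactness of `A ∩ [-M, M]` then
  -- supplies a uniform distance `r`.
  have hdense : Dense (⋂ n : ℤ, ((fun x : ℝ => x + (n : ℝ)) ⁻¹' A)ᶜ) := by
    refine dense_iInter_of_isOpen
      (fun n => (hA.preimage (continuous_id.add continuous_const)).isOpen_compl) (fun n => ?_)
    rw [← interior_eq_empty_iff_dense_compl]
    have h1 := (Homeomorph.addRight (n : ℝ)).preimage_interior A
    rw [hAi, preimage_empty] at h1
    exact h1.symm
  obtain ⟨θ, hθ⟩ := hdense.nonempty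
  have hθP : θ ∈ Pᶜ := by
    rintro ⟨x, ⟨hxA, _⟩, hx⟩
    obtain ⟨n, rfl⟩ := coe_eq_coe_iff.1 hx
    exact mem_iInter.1 hθ n hxA
  obtain ⟨r, hr, hball⟩ := Metric.isOpen_iff.1 hP.isOpen_compl θ hθP
  refine ⟨θ, r, hr, fun x hxA hxM n => ?_⟩
  by_contra! hlt
  have h2 : x - n ∈ Metric.ball θ r := by
    rw [Metric.mem_ball, Real.dist_eq]
    have : x - n - θ = x - θ - n := by ring
    rwa [this]
  refine hball h2 ⟨x, ⟨hxA, abs_le.1 hxM⟩, ?_⟩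
  exact coe_eq_coe_iff.2 ⟨n, by ring⟩

/-- Choose `θ + ℤ` away from the relevant part of `A` and `g + ℤ` away from that of `B`; the
contraction sends everything away from `θ + ℤ` close to `g + ℤ`. Displacement at most one is why `B`
is controlled on `[-(M + 1), M + 1]`. -/
theorem exists_displacement_avoiding {A B : Set ℝ} (hA : IsClosed A) (hAi : interior A = ∅)
    (hB : IsClosed B) (hBi : interior B = ∅) (M : ℝ) :
    ∃ κ : CircleDeg1Liftˣ, (∀ x : ℝ, |κ x - x| ≤ 1) ∧ ∀ x ∈ A, |x| ≤ M → κ x ∉ B := by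
  obtain ⟨θ, r, hr, hθ⟩ := exists_away_from_int hA hAi M
  obtain ⟨g, r', hr', hg⟩ := exists_away_from_int hB hBi (M + 1)
  obtain ⟨κ, hκ1, hκ⟩ := exists_contraction θ g hr hr'
  refine ⟨κ, hκ1, fun x hx hxM hκB => ?_⟩
  obtain ⟨n, hn⟩ := hκ x (hθ x hx hxM)
  refine absurd (hg _ hκB ?_ n) (not_le.2 hn)
  have h1 := hκ1 x
  rw [abs_le] at *
  constructor <;> linarith

namespace ChartSystem

variable {Z : CircleDeg1Liftˣ} (S : ChartSystem Z)

/-- Far out in the charts, coordinate intervals of length two are short. -/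
theorem exists_short_intervals {ε : ℝ} (hε : 0 < ε) :
    ∃ M : ℝ, ∀ x ∉ S.Q, ∀ s : ℝ, M < |s| →
      S.G (S.left x) (s + 1) - S.G (S.left x) (s - 1) < ε := by
  obtain ⟨N, hN⟩ := exists_nat_gt (1 / ε)
  have hN0 : (0 : ℝ) < N := (by positivity : (0 : ℝ) < 1 / ε).trans hN
  have hNε : 1 < N * ε := by rwa [div_lt_iff₀ hε] at hN
  have hNn : (N : ℤ) ≠ 0 := by
    have : (N : ℝ) ≠ 0 := hN0.ne'
    exact_mod_cast this
  -- The points of `(1 / N) ℤ` outside `Q` have only finitely many coordinates, by periodicity. A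
  -- coordinate interval of length two whose image has length at least `ε > 1 / N` contains such a
  -- point, which bounds `s` by `M + 1`. Meaningless coordinates of grid points in `Q` only enlarge
  -- `M`.
  obtain ⟨M, hM⟩ := ((finite_range fun k : Fin N => |S.coord ((k : ℕ) / (N : ℝ))|)).bddAbove
  refine ⟨M + 1, fun x hx s hs => ?_⟩
  by_contra! hle
  have hm := (chart hx).strictMono
  set u := S.G (S.left x) (s - 1)
  set j : ℤ := ⌊u * N⌋ + 1 with hj
  set y : ℝ := j / N with hy
  have huy : u ≤ y := by
    rw [hy, le_div_iff₀ hN0, hj]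
    push_cast
    exact (Int.lt_floor_add_one _).le
  have hyu : y ≤ S.G (S.left x) (s + 1) := by
    have h1 : y ≤ u + 1 / N := by
      rw [hy, div_le_iff₀ hN0, add_mul, one_div_mul_cancel hN0.ne', hj]
      push_cast
      linarith [Int.floor_le (u * N)]
    have h2 : 1 / (N : ℝ) < ε := by rw [div_lt_iff₀ hN0]; linarith
    linarith
  have hymem : y ∈ Ioo (gapLeft S.Q x) (gapRight S.Q x) :=
    ⟨(G_mem_gap hx _).1.trans_le huy, hyu.trans_lt (G_mem_gap hx _).2⟩
  have hyQ : y ∉ S.Q := IsPeriodicClosed.notMem_of_mem_gap hymem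
  have hyl : S.left y = S.left x := S.isPeriodicClosed.gapLeft_eq hymem
  have hGy : S.G (S.left x) (S.coord y) = y := by rw [← hyl]; exact G_coord hyQ
  rw [← hGy] at huy hyu
  have h3 : s - 1 ≤ S.coord y := hm.le_iff_le.1 huy
  have h4 : S.coord y ≤ s + 1 := hm.le_iff_le.1 hyu
  have hk0 : 0 ≤ j % N := Int.emod_nonneg _ hNn
  have hk1 : j % N < N := Int.emod_lt_of_pos _ (by omega)
  obtain ⟨k, hk⟩ := Int.eq_ofNat_of_zero_le hk0
  have hkN : k < N := by omega
  have hyk : (k : ℝ) / N + (j / N : ℤ) = y := by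
    have h5 : j = k + N * (j / N : ℤ) := by
      rw [← hk]; exact (Int.emod_add_mul_ediv j N).symm
    have h6 : (j : ℝ) = k + N * ((j / N : ℤ) : ℝ) := by exact_mod_cast h5
    rw [hy, h6]
    field_simp
  have hkQ : (k : ℝ) / N ∉ S.Q := by
    rw [← S.isPeriodicClosed.add_int _ (j / N : ℤ), hyk]; exact hyQ
  have h7 : S.coord y = S.coord ((k : ℝ) / N) := by rw [← hyk, coord_add_int hkQ]
  have h8 : |S.coord y| ≤ M := by
    rw [h7]; exact hM ⟨⟨k, hkN⟩, rfl⟩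
  rw [abs_le] at h8
  rcases lt_abs.1 hs with h9 | h9 <;> linarith

end ChartSystem

/-! ### The squeezing bending -/

/-- Given closed nowhere dense sets `K₁`, `K₂`, the identity can be joined inside the centralizer
of `Z` to an element that moves points of `K₁` into `K₂` only if they are nearly fixed, both by
the element and by `Z`. -/
theorem exists_path_commute_squeeze {Z : CircleDeg1Liftˣ} {q : ℝ} (hq : Z q = q) {K₁ K₂ : Set ℝ}
    (h₁ : IsClosed K₁) (hi₁ : interior K₁ = ∅) (h₂ : IsClosed K₂) (hi₂ : interior K₂ = ∅)
    (hper₁ : ∀ (x : ℝ) (n : ℤ), x + n ∈ K₁ ↔ x ∈ K₁)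
    (hper₂ : ∀ (x : ℝ) (n : ℤ), x + n ∈ K₂ ↔ x ∈ K₂) {ε : ℝ} (hε : 0 < ε) :
    ∃ δ : ℝ → CircleDeg1Liftˣ, PointwiseContinuous δ ∧ δ 0 = 1 ∧ (∀ s, Commute (δ s) Z) ∧
      ∀ p ∈ K₁, δ 1 p ∈ K₂ → |δ 1 p - p| < ε ∧ |Z p - p| < ε := by
  obtain ⟨S⟩ := nonempty_chartSystem hq
  obtain ⟨M, hM⟩ := S.exists_short_intervals hε
  have hex : ∀ l : ℝ, ∃ κ : CircleDeg1Liftˣ, (∀ x ∉ S.Q, S.left x = l →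
      (∀ s : ℝ, |κ s - s| ≤ 1) ∧ (S.e l = 0 → κ = 1) ∧
      (S.e l ≠ 0 → ∀ s : ℝ, S.G l s ∈ K₁ → |s| ≤ M → S.G l (κ s) ∉ K₂)) := by
    intro l
    by_cases hl : ∃ x ∉ S.Q, S.left x = l
    swap
    · exact ⟨1, fun x hx hxl => absurd ⟨x, hx, hxl⟩ hl⟩
    obtain ⟨x, hx, rfl⟩ := hl
    -- Where `Z` is the identity on the gap nothing is moved and both displacements vanish.
    -- Elsewhere the sets are displaced off each other on `|s| ≤ M`.
    by_cases he : S.e (S.left x) = 0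
    · exact ⟨1, fun _ _ _ => ⟨fun s => by simp, fun _ => rfl, fun h => absurd he h⟩⟩
    · have hpre : ∀ K : Set ℝ, interior K = ∅ → interior (S.G (S.left x) ⁻¹' K) = ∅ := by
        intro K hK
        rw [← (ChartSystem.isOpenEmbedding_G hx).isOpenMap.preimage_interior_eq_interior_preimage
          (ChartSystem.continuous_G hx), hK, preimage_empty]
      obtain ⟨κ, hκ1, hκ⟩ := exists_displacement_avoiding
        (h₁.preimage (ChartSystem.continuous_G hx)) (hpre _ hi₁)
        (h₂.preimage (ChartSystem.continuous_G hx)) (hpre _ hi₂) M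
      exact ⟨κ, fun _ _ _ => ⟨hκ1, fun h => absurd h he, fun _ => hκ⟩⟩
  choose k hk using hex
  let kc : UnitAddCircle → CircleDeg1Liftˣ := fun c => k (Quotient.out c)
  have hout : ∀ x : ℝ, ∃ n : ℤ, (Quotient.out (x : UnitAddCircle) : ℝ) = x + n := by
    intro x
    exact coe_eq_coe_iff.1 (Quotient.out_eq (x : UnitAddCircle))
  choose κ hκc hκ0 hκ1 using fun c => exists_path_to (kc c)
  refine ⟨fun s => S.blend fun c => κ c s, ChartSystem.pointwiseContinuous_blend fun c => hκc c,
    ?_, fun s => ChartSystem.commute_blend _, fun p hp₁ hp₂ => ?_⟩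
  · have : (fun c => κ c 0) = 1 := by funext c; exact hκ0 c
    change S.blend (fun c => κ c 0) = 1
    rw [this, map_one]
  · by_cases hp : p ∈ S.Q
    · have h1 : S.blend (fun c => κ c 1) p = p :=
        (ChartSystem.blend_apply _ _).trans (ChartSystem.move_of_mem _ hp)
      rw [h1, S.map_eq p hp]
      simpa using hε
    -- The moves are indexed by gaps modulo `ℤ`. Translating `p` by an integer brings it to the gap
    -- whose left endpoint is the chosen representative.
    obtain ⟨n, hn⟩ := hout (S.left p)
    have hpn : p + n ∉ S.Q := by rwa [S.isPeriodicClosed.add_int]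
    have hl : Quotient.out (S.left p : UnitAddCircle) = S.left (p + n) := by
      rw [hn, ChartSystem.left_add_int]
    have hc : ((S.left (p + n) : ℝ) : UnitAddCircle) = (S.left p : ℝ) := by
      rw [ChartSystem.left_add_int, coe_add_int]
    have e1 : S.blend (fun c => κ c 1) p - p = S.blend (fun c => κ c 1) (p + n) - (p + n) := by
      rw [map_add_int]; ring
    have e2 : Z p - p = Z (p + n) - (p + n) := by rw [map_add_int]; ring
    have hp₁' := (hper₁ p n).2 hp₁
    have hp₂' : S.blend (fun c => κ c 1) (p + n) ∈ K₂ := by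
      rw [map_add_int]; exact (hper₂ _ n).2 hp₂
    rw [e1, e2]
    generalize p + (n : ℝ) = p' at *
    have hm := (ChartSystem.chart hpn).strictMono
    set l := S.left p' with hl'
    set s := S.coord p' with hs
    have hGs : S.G l s = p' := ChartSystem.G_coord hpn
    have hb : S.blend (fun c => κ c 1) p' = S.G l (k l s) := by
      refine ((ChartSystem.blend_apply _ _).trans (ChartSystem.move_of_notMem _ hpn)).trans ?_
      rw [← hl', ← hs, hκ1]
      change S.G l (k (Quotient.out ((l : ℝ) : UnitAddCircle)) s) = _
      rw [hc, hl]
    have hZ : Z p' = S.G l (s + S.e l) := ChartSystem.Z_eq hpn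
    obtain ⟨hd, hk0, hkne⟩ := hk l p' hpn rfl
    rw [hb] at hp₂' ⊢
    by_cases he : S.e l = 0
    · rw [hZ, he, hk0 he, units_one_apply, hGs]
      simpa [hGs] using hε
    · have hsM : M < |s| := by
        by_contra! hle
        exact hkne he s (by rwa [hGs]) hle hp₂'
      have hshort := hM p' hpn s hsM
      have key : ∀ t : ℝ, |t - s| ≤ 1 → |S.G l t - p'| < ε := by
        intro t ht
        rw [abs_le] at ht
        have h1 : S.G l t ≤ S.G l (s + 1) := hm.monotone (by linarith)
        have h2 : S.G l (s - 1) ≤ S.G l t := hm.monotone (by linarith)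
        have h3 : p' ≤ S.G l (s + 1) := by rw [← hGs]; exact hm.monotone (by linarith)
        have h4 : S.G l (s - 1) ≤ p' := by rw [← hGs]; exact hm.monotone (by linarith)
        rw [abs_lt]
        constructor <;> linarith
      refine ⟨key _ (hd s), ?_⟩
      rw [hZ]
      refine key _ ?_
      rw [add_sub_cancel_left]
      rcases (ChartSystem.chart hpn).shift_cases with h | h | h
      · exact absurd h he
      · rw [h]; simp
      · rw [h]; simp

/-! ### Finite orbits and additivity of translation numbers -/

/-- A nonempty subset of the line invariant under the unit translation and finite modulo it. -/
structure IsPeriodicFinite (X : Set ℝ) : Prop where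
  nonempty : X.Nonempty
  add_int : ∀ (x : ℝ) (n : ℤ), x + n ∈ X ↔ x ∈ X
  finite : (X ∩ Ico 0 1).Finite

namespace IsPeriodicFinite

variable {X : Set ℝ}

theorem fract_mem (hX : IsPeriodicFinite X) {x : ℝ} (hx : x ∈ X) : Int.fract x ∈ X ∩ Ico 0 1 := by
  refine ⟨?_, Int.fract_nonneg x, Int.fract_lt_one x⟩
  rw [← hX.add_int _ ⌊x⌋, Int.fract_add_floor]
  exact hx

theorem image (hX : IsPeriodicFinite X) {η : ℝ → ℝ} (hη : ∀ (x : ℝ) (n : ℤ), η (x + n) = η x + n) :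
    IsPeriodicFinite (η '' X) := by
  refine ⟨hX.nonempty.image η, fun y n => ⟨?_, ?_⟩, ?_⟩
  · rintro ⟨x, hx, hxy⟩
    refine ⟨x + (-n : ℤ), (hX.add_int _ _).2 hx, ?_⟩
    rw [hη, hxy]; push_cast; ring
  · rintro ⟨x, hx, rfl⟩
    exact ⟨x + n, (hX.add_int _ _).2 hx, hη x n⟩
  · refine (hX.finite.image fun x => Int.fract (η x)).subset ?_
    rintro y ⟨⟨x, hx, rfl⟩, hy⟩
    refine ⟨Int.fract x, hX.fract_mem hx, ?_⟩
    have h1 : η x = η (Int.fract x) + ⌊x⌋ := by rw [← hη, Int.fract_add_floor]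
    have h2 : Int.fract (η x) = η x := Int.fract_eq_self.2 hy
    change Int.fract (η (Int.fract x)) = η x
    rw [← h2, h1, Int.fract_add_intCast]

/-- Each `F` permutes `X` modulo `ℤ`, and the order of the permutation group is an exponent valid
for all `F` at once. The resulting integer displacement does not depend on the point, since it is
determined by the translation number. -/
theorem exists_period (hX : IsPeriodicFinite X) : ∃ n : ℕ, n ≠ 0 ∧ ∀ F : CircleDeg1Liftˣ,
    MapsTo F X X → ∃ m : ℤ, (m : ℝ) = n * translationNumber F ∧ ∀ x ∈ X, (F ^ n) x = x + m := by
  classical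
  have := hX.finite.fintype
  refine ⟨Fintype.card (Equiv.Perm ↥(X ∩ Ico (0 : ℝ) 1)), Fintype.card_ne_zero, fun F hF => ?_⟩
  let f : ↥(X ∩ Ico (0 : ℝ) 1) → ↥(X ∩ Ico (0 : ℝ) 1) := fun x =>
    ⟨Int.fract (F x), hX.fract_mem (hF x.2.1)⟩
  have hf : Function.Injective f := by
    intro x y hxy
    have h1 : Int.fract (F x) = Int.fract (F y) := congrArg Subtype.val hxy
    obtain ⟨z, hz⟩ := Int.fract_eq_fract.1 h1
    have h2 : F (x : ℝ) = F ((y : ℝ) + z) := by rw [map_add_int]; linarith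
    have h3 := (strictMono_units F).injective h2
    have h4 := x.2.2
    have h5 := y.2.2
    rw [h3] at h4
    have h6 : z = 0 := by
      have h7 : (z : ℝ) < 1 := by linarith [h4.2, h5.1]
      have h8 : (-1 : ℝ) < z := by linarith [h4.1, h5.2]
      have h9 : z < 1 := by exact_mod_cast h7
      have h10 : -1 < z := by exact_mod_cast h8
      omega
    apply Subtype.ext
    rw [h3, h6]; simp
  let π : Equiv.Perm ↥(X ∩ Ico (0 : ℝ) 1) := Equiv.ofBijective f hf.bijective_of_finite
  have hπ : ∀ x : ↥(X ∩ Ico (0 : ℝ) 1), F (x : ℝ) = (π x : ℝ) + ⌊F (x : ℝ)⌋ := fun x => (Int.fract_add_floor _).symm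
  have hpow : ∀ (k : ℕ) (x : ↥(X ∩ Ico (0 : ℝ) 1)), ∃ j : ℤ, (F ^ k) (x : ℝ) = ((π ^ k) x : ℝ) + j := by
    intro k
    induction k with
    | zero => exact fun x => ⟨0, by simp⟩
    | succ k ih =>
      intro x
      obtain ⟨j, hj⟩ := ih x
      refine ⟨⌊F ((π ^ k) x : ℝ)⌋ + j, ?_⟩
      have h1 := hπ ((π ^ k) x)
      rw [pow_succ', units_mul_apply, hj, map_add_int, pow_succ', Equiv.Perm.mul_apply]
      rw [Int.cast_add]; linarith
  set n := Fintype.card (Equiv.Perm ↥(X ∩ Ico (0 : ℝ) 1)) with hn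
  have hn0 : 0 < n := Fintype.card_pos
  have key : ∀ x ∈ X, ∃ j : ℤ, (F ^ n) x = x + j := by
    intro x hx
    obtain ⟨j, hj⟩ := hpow n ⟨Int.fract x, hX.fract_mem hx⟩
    rw [hn, pow_card_eq_one, ← hn] at hj
    refine ⟨j, ?_⟩
    conv_lhs => rw [← Int.fract_add_floor x]
    rw [map_add_int, hj]
    simp only [Equiv.Perm.one_apply]
    linarith [Int.fract_add_floor x]
  have hτ : ∀ (x : ℝ) (j : ℤ), (F ^ n) x = x + j → (j : ℝ) = n * translationNumber F := by
    intro x j hj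
    rw [translationNumber_of_map_pow_eq_add_int (F : CircleDeg1Lift) (x := x) (m := j)
      (by simpa using hj) hn0]
    field_simp
  obtain ⟨x, hx⟩ := hX.nonempty
  obtain ⟨j, hj⟩ := key x hx
  refine ⟨j, hτ x j hj, fun y hy => ?_⟩
  obtain ⟨i, hi⟩ := key y hy
  rw [hi, hτ y i hi, hτ x j hj]

theorem mapsTo_pow {F : CircleDeg1Liftˣ} (hF : MapsTo F X X) (k : ℕ) :
    MapsTo ((F ^ k : CircleDeg1Liftˣ) : ℝ → ℝ) X X := by
  induction k with
  | zero => intro x hx; simpa using hx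
  | succ k ih => intro x hx; rw [pow_succ']; exact hF (ih hx)

/-- On `X` some power `F ^ n` is an integer translation, so there `F⁻¹` is `F ^ (n - 1)` followed by
the opposite translation. -/
theorem mapsTo_inv (hX : IsPeriodicFinite X) {F : CircleDeg1Liftˣ} (hF : MapsTo F X X) :
    MapsTo (F⁻¹ : CircleDeg1Liftˣ) X X := by
  obtain ⟨n, hn, h⟩ := hX.exists_period
  obtain ⟨m, -, hm⟩ := h F hF
  obtain ⟨k, rfl⟩ := Nat.exists_eq_succ_of_ne_zero hn
  intro x hx
  have hx' : x + (-m : ℤ) ∈ X := (hX.add_int _ _).2 hx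
  have h1 := hm _ hx'
  rw [pow_succ', units_mul_apply] at h1
  have h2 : x = F ((F ^ k) (x + (-m : ℤ))) := by rw [h1]; push_cast; ring
  rw [(units_inv_eq_iff F).2 h2]
  exact mapsTo_pow hF k hx'

/-- If the commutator-like element `(F G)⁻¹ G F` moves one point of `X` up, it moves all of them up,
since one of its powers is a single translation on `X`. Iterating the strict inequality `F G < G F`
until a power of `F` becomes a translation gives a contradiction. By symmetry, lifts preserving `X`
commute on `X`. -/
theorem mul_apply_le (hX : IsPeriodicFinite X) {F G : CircleDeg1Liftˣ} (hF : MapsTo F X X)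
    (hG : MapsTo G X X) {x : ℝ} (hx : x ∈ X) : G (F x) ≤ F (G x) := by
  by_contra! hlt
  obtain ⟨n, hn, hper⟩ := hX.exists_period
  have hn0 : 0 < n := Nat.pos_of_ne_zero hn
  set h := (F * G)⁻¹ * (G * F) with hh
  have hhX : MapsTo h X X := by
    intro y hy
    exact hX.mapsTo_inv (F := F * G) (fun z hz => hF (hG hz)) (hG (hF hy))
  have hlt_iff : ∀ y, y < h y ↔ F (G y) < G (F y) := by
    intro y
    rw [← (strictMono_units (F * G)).lt_iff_lt, hh, units_mul_apply ((F * G)⁻¹),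
      units_apply_inv_apply]
    rfl
  have hiter : ∀ y, y < (h ^ n) y ↔ y < h y := by
    intro y
    have := lt_iterate_pos_iff (h : CircleDeg1Lift) (x := y) (m := 0) hn0
    simpa [← coe_pow] using this
  obtain ⟨m, -, hm⟩ := hper h hhX
  have hm0 : (0 : ℝ) < m := by
    have h1 := (hiter x).2 ((hlt_iff x).2 hlt)
    rw [hm x hx] at h1
    linarith
  have hall : ∀ y ∈ X, F (G y) < G (F y) := by
    intro y hy
    rw [← hlt_iff, ← hiter, hm y hy]
    linarith
  have hpow : ∀ k : ℕ, (F ^ (k + 1)) (G x) < G ((F ^ (k + 1)) x) := by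
    intro k
    induction k with
    | zero => simpa using hall x hx
    | succ k ih =>
      rw [pow_succ' F (k + 1), units_mul_apply, units_mul_apply]
      exact (strictMono_units F ih).trans (hall _ (mapsTo_pow hF (k + 1) hx))
  obtain ⟨k, rfl⟩ := Nat.exists_eq_succ_of_ne_zero hn
  obtain ⟨j, -, hj⟩ := hper F hF
  have h2 := hpow k
  rw [hj _ (hG hx), hj x hx, map_add_int] at h2
  exact lt_irrefl _ h2

/-- Translation numbers are additive on groups with a finite orbit on the circle. -/
theorem translationNumber_mul (hX : IsPeriodicFinite X) {F G : CircleDeg1Liftˣ}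
    (hF : MapsTo F X X) (hG : MapsTo G X X) :
    translationNumber (F * G : CircleDeg1Liftˣ) = translationNumber F + translationNumber G := by
  have hcomm : ∀ x ∈ X, G (F x) = F (G x) := fun x hx =>
    le_antisymm (hX.mul_apply_le hF hG hx) (hX.mul_apply_le hG hF hx)
  have hcomm' : ∀ (k : ℕ), ∀ x ∈ X, (G ^ k) (F x) = F ((G ^ k) x) := by
    intro k
    induction k with
    | zero => intro x _; simp
    | succ k ih =>
      intro x hx
      rw [pow_succ', units_mul_apply, units_mul_apply, ih x hx, hcomm _ (mapsTo_pow hG k hx)]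
  have hpow : ∀ (k : ℕ), ∀ x ∈ X, ((F * G) ^ k) x = (F ^ k) ((G ^ k) x) := by
    intro k
    induction k with
    | zero => intro x _; simp
    | succ k ih =>
      intro x hx
      rw [pow_succ, units_mul_apply, units_mul_apply, ih _ (hF (hG hx)), hcomm' k _ (hG hx),
        pow_succ F, pow_succ G, units_mul_apply, units_mul_apply]
  obtain ⟨n, hn, hper⟩ := hX.exists_period
  obtain ⟨i, hi, hi'⟩ := hper F hF
  obtain ⟨j, hj, hj'⟩ := hper G hG
  obtain ⟨k, hk, hk'⟩ := hper (F * G) fun x hx => hF (hG hx)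
  obtain ⟨x, hx⟩ := hX.nonempty
  have h1 := hk' x hx
  rw [hpow n x hx, hj' x hx, map_add_int, hi' x hx] at h1
  have h2 : (n : ℝ) * translationNumber (F * G : CircleDeg1Liftˣ)
      = n * (translationNumber F + translationNumber G) := by
    rw [mul_add, ← hi, ← hj, ← hk]; linarith
  exact mul_left_cancel₀ (Nat.cast_ne_zero.2 hn) h2

end IsPeriodicFinite

/-- A subgroup acts on the circle with a finite orbit, expressed through lifts to the line. -/
def FiniteOrbitOn {W : Type*} [Group W] (Φ : W →* CircleDeg1Liftˣ) (K : Subgroup W) : Prop :=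
  ∃ X : Set ℝ, IsPeriodicFinite X ∧ ∀ w ∈ K, MapsTo (Φ w) X X

theorem finiteOrbitOn_closure {W : Type*} [Group W] {Φ : W →* CircleDeg1Liftˣ} {S : Set W}
    {X : Set ℝ} (hX : IsPeriodicFinite X) (h : ∀ w ∈ S, MapsTo (Φ w) X X) :
    FiniteOrbitOn Φ (Subgroup.closure S) := by
  refine ⟨X, hX, fun w hw => ?_⟩
  induction hw using Subgroup.closure_induction with
  | mem w hw => exact h w hw
  | one => intro x hx; simpa using hx
  | mul v w _ _ hv hw => intro x hx; rw [map_mul]; exact hv (hw hx)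
  | inv w _ hw => rw [map_inv]; exact hX.mapsTo_inv hw

end CircleDeg1Lift

/-! ### Finite orbits on the circle and on the line -/

open CircleDeg1Lift

theorem hasFiniteOrbit_map_iff {W Γ : Type*} [Group W] [Group Γ] {q : W →* Γ}
    {Φ : W →* CircleDeg1Liftˣ} {σ : CircleRep Γ} (h : ∀ w, toHomeoPlus (Φ w) = σ (q w))
    (K : Subgroup W) : σ.HasFiniteOrbit (K.map q) ↔ FiniteOrbitOn Φ K := by
  have hact : ∀ (w : W) (x : ℝ), (σ (q w) : UnitAddCircle ≃ₜ UnitAddCircle) (x : UnitAddCircle)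
      = ((Φ w x : ℝ) : UnitAddCircle) := fun w x => by rw [← h, toHomeoPlus_apply]
  constructor
  · rintro ⟨z, hz⟩
    set O : Set UnitAddCircle :=
      {y | ∃ γ ∈ K.map q, y = (σ γ : UnitAddCircle ≃ₜ UnitAddCircle) z}
    obtain ⟨x, rfl⟩ := QuotientAddGroup.mk_surjective z
    refine ⟨(fun x : ℝ => (x : UnitAddCircle)) ⁻¹' O, ⟨⟨x, 1, one_mem _, by simp⟩, ?_, ?_⟩, ?_⟩
    · intro y n
      simp only [mem_preimage, coe_add_int]
    · have h1 : (((fun x : ℝ => (x : UnitAddCircle)) ⁻¹' O) ∩ Ico 0 1).Finite := by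
        have h2 : InjOn (fun x : ℝ => (x : UnitAddCircle)) (Ico 0 1) := by
          intro u hu v hv huv
          exact (AddCircle.coe_eq_coe_iff_of_mem_Ico (p := 1) (a := 0) (by simpa using hu)
            (by simpa using hv)).1 huv
        have h3 : ((fun x : ℝ => (x : UnitAddCircle)) ''
            (((fun x : ℝ => (x : UnitAddCircle)) ⁻¹' O) ∩ Ico 0 1)).Finite :=
          hz.subset (by rintro _ ⟨u, ⟨hu, _⟩, rfl⟩; exact hu)
        exact h3.of_finite_image (h2.mono inter_subset_right)
      exact h1
    · intro w hw y hy
      obtain ⟨γ, hγ, hy⟩ := hy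
      have hy : (y : UnitAddCircle) = _ := hy
      refine ⟨q w * γ, mul_mem (Subgroup.mem_map_of_mem q hw) hγ, ?_⟩
      change ((Φ w y : ℝ) : UnitAddCircle) = _
      rw [← hact, map_mul, hy]
      rfl
  · rintro ⟨X, hX, hK⟩
    obtain ⟨x, hx⟩ := hX.nonempty
    refine ⟨(x : UnitAddCircle), (hX.finite.image fun x : ℝ => (x : UnitAddCircle)).subset ?_⟩
    rintro _ ⟨_, ⟨w, hw, rfl⟩, rfl⟩
    refine ⟨Int.fract (Φ w x), hX.fract_mem (hK w hw hx), ?_⟩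
    rw [hact]
    exact coe_eq_coe_iff.2 ⟨-⌊Φ w x⌋, by unfold Int.fract; push_cast; ring⟩

/-! ### Automorphisms of the free group that fix the surface relator -/

section SurfaceGroups

theorem map_surfaceComm {G H : Type*} [Group G] [Group H] (f : G →* H) (a b : G) :
    f (surfaceComm a b) = surfaceComm (f a) (f b) := by
  simp [surfaceComm]

theorem map_surfaceRelator {g : ℕ} {G : Type*} [Group G] (Ψ : FreeGroup (SurfaceGen g) →* G) :
    Ψ (surfaceRelator g) = ((List.ofFn fun i : Fin g =>
      surfaceComm (Ψ (FreeGroup.of (i, false))) (Ψ (FreeGroup.of (i, true)))).reverse).prod := by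
  rw [surfaceRelator, map_list_prod, List.map_reverse, List.map_ofFn]
  simp only [Function.comp_def, map_surfaceComm]

theorem prod_reverse_range_congr {G : Type*} [Group G] {c c' : ℕ → G} {k n : ℕ} (hk : k + 2 ≤ n)
    (h : ∀ j, j ≠ k → j ≠ k + 1 → c j = c' j) (h2 : c (k + 1) * c k = c' (k + 1) * c' k) :
    (((List.range n).map c).reverse).prod = (((List.range n).map c').reverse).prod := by
  have hlow : ∀ m, m ≤ k →
      (((List.range m).map c).reverse).prod = (((List.range m).map c').reverse).prod := by
    intro m hm
    congr 2
    refine List.map_congr_left fun j hj => ?_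
    have := List.mem_range.1 hj
    exact h j (by omega) (by omega)
  have hsucc : ∀ (c : ℕ → G) (m : ℕ), (((List.range (m + 1)).map c).reverse).prod
      = c m * (((List.range m).map c).reverse).prod := by
    intro c m
    rw [List.range_succ, List.map_append, List.reverse_append, List.prod_append]
    simp
  induction n, hk using Nat.le_induction with
  | base => rw [hsucc, hsucc, hsucc, hsucc, ← mul_assoc, ← mul_assoc, hlow k le_rfl, h2]
  | succ n hn ih => rw [hsucc, hsucc, ih, h n (by omega) (by omega)]

theorem ofFn_eq_map_range {G : Type*} [Group G] {n : ℕ} (c : Fin n → G) :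
    List.ofFn c = (List.range n).map fun j => if h : j < n then c ⟨j, h⟩ else 1 := by
  apply List.ext_getElem
  · simp
  · intro j h1 h2
    have : j < n := by simpa using h1
    simp [this]

theorem prod_reverse_ofFn_congr {G : Type*} [Group G] {n : ℕ} {c c' : Fin n → G} {i i' : Fin n}
    (hi : (i' : ℕ) = i + 1) (h : ∀ j, j ≠ i → j ≠ i' → c j = c' j)
    (h2 : c i' * c i = c' i' * c' i) :
    ((List.ofFn c).reverse).prod = ((List.ofFn c').reverse).prod := by
  rw [ofFn_eq_map_range, ofFn_eq_map_range]
  have hlt := i'.2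
  refine prod_reverse_range_congr (k := i) (by omega) (fun j hj hj' => ?_) ?_
  · by_cases hjn : j < n
    · rw [dif_pos hjn, dif_pos hjn]
      exact h _ (fun h => hj (congrArg Fin.val h)) fun h => hj' ((congrArg Fin.val h).trans hi)
    · rw [dif_neg hjn, dif_neg hjn]
  · have e : (⟨(i : ℕ) + 1, by omega⟩ : Fin n) = i' := Fin.ext hi.symm
    rw [dif_pos i.2, dif_pos (by omega), dif_pos i.2, dif_pos (by omega), e]
    exact h2

/-- The subgroup of the free group generated by the first `m` pairs of generators. -/
def handleSubgroup (g m : ℕ) : Subgroup (FreeGroup (SurfaceGen g)) :=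
  Subgroup.closure (FreeGroup.of '' {j | (j.1 : ℕ) < m})

theorem of_mem_handleSubgroup {g m : ℕ} {j : SurfaceGen g} (hj : (j.1 : ℕ) < m) :
    FreeGroup.of j ∈ handleSubgroup g m :=
  Subgroup.subset_closure (mem_image_of_mem _ hj)

theorem handleSubgroup_mono {g m m' : ℕ} (h : m ≤ m') : handleSubgroup g m ≤ handleSubgroup g m' :=
  Subgroup.closure_mono (image_mono fun _ hj => lt_of_lt_of_le hj h)

/-- The projection from the free group to the surface group. -/
abbrev surfaceMk (g : ℕ) : FreeGroup (SurfaceGen g) →* SurfaceGroup g :=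
  PresentedGroup.mk {surfaceRelator g}

theorem map_handleSubgroup (g m : ℕ) : (handleSubgroup g m).map (surfaceMk g)
    = Subgroup.closure ((fun j => (PresentedGroup.of j : SurfaceGroup g)) ''
      {j | (j.1 : ℕ) < m}) := by
  rw [handleSubgroup, MonoidHom.map_closure, image_image]
  rfl

/-- Automorphisms of the free group that fix the surface relator and preserve the subgroup
generated by the first `m` pairs of generators. -/
structure IsLevelAut {g : ℕ} (m : ℕ) (ψ : MulAut (FreeGroup (SurfaceGen g))) : Prop where
  map_relator : ψ (surfaceRelator g) = surfaceRelator g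
  mem_iff : ∀ w, ψ w ∈ handleSubgroup g m ↔ w ∈ handleSubgroup g m

theorem IsLevelAut.mul {g m : ℕ} {ψ ψ' : MulAut (FreeGroup (SurfaceGen g))} (h : IsLevelAut m ψ)
    (h' : IsLevelAut m ψ') : IsLevelAut m (ψ * ψ') :=
  ⟨by rw [MulAut.mul_apply, h'.map_relator, h.map_relator],
    fun w => by rw [MulAut.mul_apply, h.mem_iff, h'.mem_iff]⟩

theorem IsLevelAut.one {g m : ℕ} : IsLevelAut m (1 : MulAut (FreeGroup (SurfaceGen g))) :=
  ⟨rfl, fun _ => Iff.rfl⟩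

theorem lift_mem_handleSubgroup {g m : ℕ} {f : SurfaceGen g → FreeGroup (SurfaceGen g)}
    (hf : ∀ j, (j.1 : ℕ) < m → f j ∈ handleSubgroup g m) {w : FreeGroup (SurfaceGen g)}
    (hw : w ∈ handleSubgroup g m) : FreeGroup.lift f w ∈ handleSubgroup g m := by
  have h : handleSubgroup g m ≤ (handleSubgroup g m).comap (FreeGroup.lift f) := by
    rw [handleSubgroup, Subgroup.closure_le]
    rintro _ ⟨j, hj, rfl⟩
    rw [SetLike.mem_coe, Subgroup.mem_comap, FreeGroup.lift_apply_of]
    exact hf j hj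
  exact h hw

theorem exists_levelAut {g : ℕ} {f f' : SurfaceGen g → FreeGroup (SurfaceGen g)}
    (h1 : ∀ j, FreeGroup.lift f (f' j) = FreeGroup.of j)
    (h2 : ∀ j, FreeGroup.lift f' (f j) = FreeGroup.of j)
    (hr : FreeGroup.lift f (surfaceRelator g) = surfaceRelator g) :
    ∃ ψ : MulAut (FreeGroup (SurfaceGen g)), (∀ j, ψ (FreeGroup.of j) = f j) ∧
      ∀ m, (∀ j, (j.1 : ℕ) < m → f j ∈ handleSubgroup g m) →
        (∀ j, (j.1 : ℕ) < m → f' j ∈ handleSubgroup g m) → IsLevelAut m ψ := by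
  have e1 : (FreeGroup.lift f').comp (FreeGroup.lift f) = MonoidHom.id _ := by
    ext j; simp [h2]
  have e2 : (FreeGroup.lift f).comp (FreeGroup.lift f') = MonoidHom.id _ := by
    ext j; simp [h1]
  refine ⟨MonoidHom.toMulEquiv (FreeGroup.lift f) (FreeGroup.lift f') e1 e2, fun j => ?_,
    fun m hf hf' => ⟨hr, fun w => ⟨fun hw => ?_, fun hw => ?_⟩⟩⟩
  · exact FreeGroup.lift_apply_of
  · have h3 := lift_mem_handleSubgroup hf' hw
    have h4 : FreeGroup.lift f' (FreeGroup.lift f w) = w := DFunLike.congr_fun e1 w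
    exact h4 ▸ h3
  · exact lift_mem_handleSubgroup hf hw

theorem surfaceComm_zpow_mul_left {G : Type*} [Group G] (a b : G) (n : ℤ) :
    surfaceComm (b ^ n * a) b = surfaceComm a b := by
  simp only [surfaceComm, mul_inv_rev]
  group

theorem surfaceComm_zpow_mul_right {G : Type*} [Group G] (a b : G) (n : ℤ) :
    surfaceComm a (a ^ n * b) = surfaceComm a b := by
  simp only [surfaceComm, mul_inv_rev]
  group

/-- These are powers of Dehn twists about one curve of a handle: multiplying `a` by a power of `b`,
or conversely, leaves `[a, b]` unchanged. -/
theorem exists_twist {g : ℕ} (i : Fin g) (β : Bool) (n : ℤ) :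
    ∃ ψ : MulAut (FreeGroup (SurfaceGen g)), (∀ m, IsLevelAut m ψ) ∧
      ψ (FreeGroup.of (i, β)) = FreeGroup.of (i, !β) ^ n * FreeGroup.of (i, β) ∧
      ∀ j, j ≠ (i, β) → ψ (FreeGroup.of j) = FreeGroup.of j := by
  let f : ℤ → SurfaceGen g → FreeGroup (SurfaceGen g) := fun n j =>
    if j = (i, β) then FreeGroup.of (i, !β) ^ n * FreeGroup.of (i, β) else FreeGroup.of j
  have hf : ∀ n, f n (i, β) = FreeGroup.of (i, !β) ^ n * FreeGroup.of (i, β) := fun n => if_pos rfl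
  have hf' : ∀ n j, j ≠ (i, β) → f n j = FreeGroup.of j := fun n j hj => if_neg hj
  have hne : (i, !β) ≠ (i, β) := by simp
  have hinv : ∀ (n : ℤ) j, FreeGroup.lift (f n) (f (-n) j) = FreeGroup.of j := by
    intro n j
    by_cases hj : j = (i, β)
    · subst hj
      rw [hf, map_mul, map_zpow, FreeGroup.lift_apply_of, FreeGroup.lift_apply_of, hf, hf' _ _ hne]
      group
    · rw [hf' _ _ hj, FreeGroup.lift_apply_of, hf' _ _ hj]
  have hmem : ∀ (n : ℤ) (m : ℕ) (j : SurfaceGen g), (j.1 : ℕ) < m → f n j ∈ handleSubgroup g m := by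
    intro n m j hjm
    by_cases hj : j = (i, β)
    · subst hj
      rw [hf]
      exact mul_mem (zpow_mem (of_mem_handleSubgroup (j := (i, !β)) hjm) n) (of_mem_handleSubgroup hjm)
    · rw [hf' _ _ hj]
      exact of_mem_handleSubgroup hjm
  have hrel : FreeGroup.lift (f n) (surfaceRelator g) = surfaceRelator g := by
    rw [map_surfaceRelator]
    conv_rhs => rw [surfaceRelator]
    congr 3
    funext j
    rw [FreeGroup.lift_apply_of, FreeGroup.lift_apply_of]
    by_cases hj : j = i
    · subst hj
      cases β
      · rw [hf, hf' _ _ (by simp)]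
        exact surfaceComm_zpow_mul_left _ _ _
      · rw [hf, hf' _ _ (by simp)]
        exact surfaceComm_zpow_mul_right _ _ _
    · rw [hf' _ _ (by simp [hj]), hf' _ _ (by simp [hj])]
  obtain ⟨ψ, hψ, hψ'⟩ := exists_levelAut (hinv n)
    (fun j => by simpa using hinv (-n) j) hrel
  exact ⟨ψ, fun m => hψ' m (hmem n m) (hmem (-n) m), by rw [hψ, hf],
    fun j hj => by rw [hψ, hf' _ _ hj]⟩

/-- Images of the generators under an endomorphism that changes two pairs only. -/
def pairMap {g : ℕ} (i i' : Fin g) (A₁ B₁ A₂ B₂ : FreeGroup (SurfaceGen g)) (j : SurfaceGen g) :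
    FreeGroup (SurfaceGen g) :=
  if j.1 = i then (if j.2 then B₁ else A₁) else
    if j.1 = i' then (if j.2 then B₂ else A₂) else FreeGroup.of j

/-- The relator sees the two adjacent handles only through the product of their commutators. The
primed words give the inverse endomorphism, and `hmem` says that all eight words are written in the
four generators of these handles. -/
theorem exists_pairAut {g : ℕ} {i i' : Fin g} (hi : (i' : ℕ) = i + 1)
    {A₁ B₁ A₂ B₂ A₁' B₁' A₂' B₂' : FreeGroup (SurfaceGen g)}
    (hr : surfaceComm A₂ B₂ * surfaceComm A₁ B₁
      = surfaceComm (FreeGroup.of (i', false)) (FreeGroup.of (i', true))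
        * surfaceComm (FreeGroup.of (i, false)) (FreeGroup.of (i, true)))
    (h1 : FreeGroup.lift (pairMap i i' A₁ B₁ A₂ B₂) A₁' = FreeGroup.of (i, false))
    (h2 : FreeGroup.lift (pairMap i i' A₁ B₁ A₂ B₂) B₁' = FreeGroup.of (i, true))
    (h3 : FreeGroup.lift (pairMap i i' A₁ B₁ A₂ B₂) A₂' = FreeGroup.of (i', false))
    (h4 : FreeGroup.lift (pairMap i i' A₁ B₁ A₂ B₂) B₂' = FreeGroup.of (i', true))
    (h1' : FreeGroup.lift (pairMap i i' A₁' B₁' A₂' B₂') A₁ = FreeGroup.of (i, false))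
    (h2' : FreeGroup.lift (pairMap i i' A₁' B₁' A₂' B₂') B₁ = FreeGroup.of (i, true))
    (h3' : FreeGroup.lift (pairMap i i' A₁' B₁' A₂' B₂') A₂ = FreeGroup.of (i', false))
    (h4' : FreeGroup.lift (pairMap i i' A₁' B₁' A₂' B₂') B₂ = FreeGroup.of (i', true))
    (hmem : ∀ K : Subgroup (FreeGroup (SurfaceGen g)), FreeGroup.of (i, false) ∈ K →
      FreeGroup.of (i, true) ∈ K → FreeGroup.of (i', false) ∈ K → FreeGroup.of (i', true) ∈ K →
      (A₁ ∈ K ∧ B₁ ∈ K ∧ A₂ ∈ K ∧ B₂ ∈ K) ∧ A₁' ∈ K ∧ B₁' ∈ K ∧ A₂' ∈ K ∧ B₂' ∈ K) :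
    ∃ ψ : MulAut (FreeGroup (SurfaceGen g)), (∀ m, (i' : ℕ) < m → IsLevelAut m ψ) ∧
      ∀ j, ψ (FreeGroup.of j) = pairMap i i' A₁ B₁ A₂ B₂ j := by
  have hii : i' ≠ i := fun h => by rw [h] at hi; omega
  have hinv : ∀ {A₁ B₁ A₂ B₂ A₁' B₁' A₂' B₂' : FreeGroup (SurfaceGen g)},
      FreeGroup.lift (pairMap i i' A₁ B₁ A₂ B₂) A₁' = FreeGroup.of (i, false) →
      FreeGroup.lift (pairMap i i' A₁ B₁ A₂ B₂) B₁' = FreeGroup.of (i, true) →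
      FreeGroup.lift (pairMap i i' A₁ B₁ A₂ B₂) A₂' = FreeGroup.of (i', false) →
      FreeGroup.lift (pairMap i i' A₁ B₁ A₂ B₂) B₂' = FreeGroup.of (i', true) →
      ∀ j, FreeGroup.lift (pairMap i i' A₁ B₁ A₂ B₂) (pairMap i i' A₁' B₁' A₂' B₂' j)
        = FreeGroup.of j := by
    intro A₁ B₁ A₂ B₂ A₁' B₁' A₂' B₂' h1 h2 h3 h4 j
    obtain ⟨j, β⟩ := j
    by_cases hj : j = i
    · subst hj
      cases β
      · simpa [pairMap] using h1
      · simpa [pairMap] using h2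
    · by_cases hj' : j = i'
      · subst hj'
        cases β
        · simpa [pairMap, hii] using h3
        · simpa [pairMap, hii] using h4
      · simp [pairMap, hj, hj']
  have hrel : FreeGroup.lift (pairMap i i' A₁ B₁ A₂ B₂) (surfaceRelator g) = surfaceRelator g := by
    rw [map_surfaceRelator]
    conv_rhs => rw [surfaceRelator]
    refine prod_reverse_ofFn_congr hi (fun j hj hj' => ?_) ?_
    · simp [pairMap, hj, hj']
    · simpa [pairMap, hii] using hr
  obtain ⟨ψ, hψ, hψ'⟩ := exists_levelAut (hinv h1 h2 h3 h4) (hinv h1' h2' h3' h4') hrel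
  refine ⟨ψ, fun m hm => ?_, hψ⟩
  obtain ⟨⟨m1, m2, m3, m4⟩, m1', m2', m3', m4'⟩ := hmem (handleSubgroup g m)
    (of_mem_handleSubgroup (show (i : ℕ) < m by omega))
    (of_mem_handleSubgroup (show (i : ℕ) < m by omega))
    (of_mem_handleSubgroup hm) (of_mem_handleSubgroup hm)
  refine hψ' m (fun j hj => ?_) (fun j hj => ?_)
  · unfold pairMap
    split_ifs <;> first | assumption | exact of_mem_handleSubgroup hj
  · unfold pairMap
    split_ifs <;> first | assumption | exact of_mem_handleSubgroup hj

theorem pairMap_of_ne {g : ℕ} {i i' j : Fin g} (h : j ≠ i) (h' : j ≠ i')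
    (A₁ B₁ A₂ B₂ : FreeGroup (SurfaceGen g)) (β : Bool) :
    pairMap i i' A₁ B₁ A₂ B₂ (j, β) = FreeGroup.of (j, β) := by
  simp [pairMap, h, h']

set_option linter.unusedSimpArgs false in
/-- Interchange of two adjacent handles. -/
theorem exists_swapAut {g : ℕ} {i i' : Fin g} (hi : (i' : ℕ) = i + 1) :
    ∃ ψ : MulAut (FreeGroup (SurfaceGen g)), (∀ m, (i' : ℕ) < m → IsLevelAut m ψ) ∧
      (∀ β, ψ (FreeGroup.of (i, β)) = FreeGroup.of (i', β)) ∧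
      ∀ j : Fin g, (j : ℕ) < i → ∀ β, ψ (FreeGroup.of (j, β)) = FreeGroup.of (j, β) := by
  have hii : i' ≠ i := fun h => by rw [h] at hi; omega
  set a₁ := FreeGroup.of (i, false)
  set b₁ := FreeGroup.of (i, true)
  set a₂ := FreeGroup.of (i', false)
  set b₂ := FreeGroup.of (i', true)
  have e1 : ∀ A₁ B₁ A₂ B₂, pairMap i i' A₁ B₁ A₂ B₂ (i, false) = A₁ := by intros; simp [pairMap]
  have e2 : ∀ A₁ B₁ A₂ B₂, pairMap i i' A₁ B₁ A₂ B₂ (i, true) = B₁ := by intros; simp [pairMap]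
  have e3 : ∀ A₁ B₁ A₂ B₂, pairMap i i' A₁ B₁ A₂ B₂ (i', false) = A₂ := by
    intros; simp [pairMap, hii]
  have e4 : ∀ A₁ B₁ A₂ B₂, pairMap i i' A₁ B₁ A₂ B₂ (i', true) = B₂ := by
    intros; simp [pairMap, hii]
  obtain ⟨ψ, hψ, hψ'⟩ := exists_pairAut hi (A₁ := a₂) (B₁ := b₂)
    (A₂ := surfaceComm a₂ b₂ * a₁ * (surfaceComm a₂ b₂)⁻¹)
    (B₂ := surfaceComm a₂ b₂ * b₁ * (surfaceComm a₂ b₂)⁻¹)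
    (A₁' := (surfaceComm a₁ b₁)⁻¹ * a₂ * surfaceComm a₁ b₁)
    (B₁' := (surfaceComm a₁ b₁)⁻¹ * b₂ * surfaceComm a₁ b₁) (A₂' := a₁) (B₂' := b₁)
    (by simp only [surfaceComm, a₁, b₁, a₂, b₂]; group)
    (by simp only [surfaceComm, map_mul, map_inv, FreeGroup.lift_apply_of, a₁, b₁, a₂, b₂,
          e1, e2, e3, e4]; group)
    (by simp only [surfaceComm, map_mul, map_inv, FreeGroup.lift_apply_of, a₁, b₁, a₂, b₂,
          e1, e2, e3, e4]; group)
    (by simp only [FreeGroup.lift_apply_of, a₁, a₂, e1])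
    (by simp only [FreeGroup.lift_apply_of, b₁, b₂, e2])
    (by simp only [FreeGroup.lift_apply_of, a₁, a₂, e3])
    (by simp only [FreeGroup.lift_apply_of, b₁, b₂, e4])
    (by simp only [surfaceComm, map_mul, map_inv, FreeGroup.lift_apply_of, a₁, b₁, a₂, b₂,
          e1, e2, e3, e4]; group)
    (by simp only [surfaceComm, map_mul, map_inv, FreeGroup.lift_apply_of, a₁, b₁, a₂, b₂,
          e1, e2, e3, e4]; group)
    (fun K k1 k2 k3 k4 => by
      refine ⟨⟨k3, k4, ?_, ?_⟩, ?_, ?_, k1, k2⟩ <;> unfold surfaceComm <;>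
      repeat' first | assumption | apply mul_mem | apply inv_mem)
  refine ⟨ψ, hψ, fun β => ?_, fun j hj β => ?_⟩
  · rw [hψ']
    cases β
    · exact e1 _ _ _ _
    · exact e2 _ _ _ _
  · rw [hψ', pairMap_of_ne]
    · intro h; rw [h] at hj; omega
    · intro h; rw [h] at hj; omega

set_option linter.unusedSimpArgs false in
/-- An automorphism mixing two adjacent handles. -/
theorem exists_mixAut {g : ℕ} {i i' : Fin g} (hi : (i' : ℕ) = i + 1) :
    ∃ ψ : MulAut (FreeGroup (SurfaceGen g)), (∀ m, (i' : ℕ) < m → IsLevelAut m ψ) ∧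
      ψ (FreeGroup.of (i, false)) = FreeGroup.of (i, true) * FreeGroup.of (i, false) ∧
      ψ (FreeGroup.of (i, true)) = FreeGroup.of (i, true) * FreeGroup.of (i', false)
        * (FreeGroup.of (i, true))⁻¹ * (FreeGroup.of (i, false))⁻¹ ∧
      ∀ j : Fin g, (j : ℕ) < i → ∀ β, ψ (FreeGroup.of (j, β)) = FreeGroup.of (j, β) := by
  have hii : i' ≠ i := fun h => by rw [h] at hi; omega
  set a₁ := FreeGroup.of (i, false)
  set b₁ := FreeGroup.of (i, true)
  set a₂ := FreeGroup.of (i', false)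
  set b₂ := FreeGroup.of (i', true)
  have e1 : ∀ A₁ B₁ A₂ B₂, pairMap i i' A₁ B₁ A₂ B₂ (i, false) = A₁ := by intros; simp [pairMap]
  have e2 : ∀ A₁ B₁ A₂ B₂, pairMap i i' A₁ B₁ A₂ B₂ (i, true) = B₁ := by intros; simp [pairMap]
  have e3 : ∀ A₁ B₁ A₂ B₂, pairMap i i' A₁ B₁ A₂ B₂ (i', false) = A₂ := by
    intros; simp [pairMap, hii]
  have e4 : ∀ A₁ B₁ A₂ B₂, pairMap i i' A₁ B₁ A₂ B₂ (i', true) = B₂ := by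
    intros; simp [pairMap, hii]
  -- The new first handle involves `a₂` but not `b₂`, so bending `a₂` along the centralizer of `b₂`
  -- acts on it.
  obtain ⟨ψ, hψ, hψ'⟩ := exists_pairAut hi (A₁ := b₁ * a₁) (B₁ := b₁ * a₂ * b₁⁻¹ * a₁⁻¹)
    (A₂ := (a₂ * b₁⁻¹ * a₁⁻¹)⁻¹ * a₂ * (a₂ * b₁⁻¹ * a₁⁻¹))
    (B₂ := (a₂ * b₁⁻¹ * a₁⁻¹)⁻¹ * b₂)
    (A₁' := a₂ * b₁⁻¹ * a₁⁻¹ * b₁ * b₁⁻¹ * a₁)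
    (B₁' := b₁ * (a₂ * b₁⁻¹ * a₁⁻¹ * b₁)⁻¹)
    (A₂' := a₂ * b₁⁻¹ * a₁⁻¹ * b₁ * a₂ * (a₂ * b₁⁻¹ * a₁⁻¹ * b₁)⁻¹)
    (B₂' := a₂ * b₁⁻¹ * a₁⁻¹ * b₁ * b₂)
    (by simp only [surfaceComm, a₁, b₁, a₂, b₂]; group)
    (by simp only [map_mul, map_inv, FreeGroup.lift_apply_of, a₁, b₁, a₂, b₂,
          e1, e2, e3, e4]; group)
    (by simp only [map_mul, map_inv, FreeGroup.lift_apply_of, a₁, b₁, a₂, b₂,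
          e1, e2, e3, e4]; group)
    (by simp only [map_mul, map_inv, FreeGroup.lift_apply_of, a₁, b₁, a₂, b₂,
          e1, e2, e3, e4]; group)
    (by simp only [map_mul, map_inv, FreeGroup.lift_apply_of, a₁, b₁, a₂, b₂,
          e1, e2, e3, e4]; group)
    (by simp only [map_mul, map_inv, FreeGroup.lift_apply_of, a₁, b₁, a₂, b₂,
          e1, e2, e3, e4]; group)
    (by simp only [map_mul, map_inv, FreeGroup.lift_apply_of, a₁, b₁, a₂, b₂,
          e1, e2, e3, e4]; group)
    (by simp only [map_mul, map_inv, FreeGroup.lift_apply_of, a₁, b₁, a₂, b₂,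
          e1, e2, e3, e4]; group)
    (by simp only [map_mul, map_inv, FreeGroup.lift_apply_of, a₁, b₁, a₂, b₂,
          e1, e2, e3, e4]; group)
    (fun K k1 k2 k3 k4 => by
      refine ⟨⟨?_, ?_, ?_, ?_⟩, ?_, ?_, ?_, ?_⟩ <;>
      repeat' first | assumption | apply mul_mem | apply inv_mem)
  refine ⟨ψ, hψ, ?_, ?_, fun j hj β => ?_⟩
  · rw [hψ']; exact e1 _ _ _ _
  · rw [hψ']; exact e2 _ _ _ _
  · rw [hψ', pairMap_of_ne]
    · intro h; rw [h] at hj; omega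
    · intro h; rw [h] at hj; omega

end SurfaceGroups

/-! ### Rotation rigidity and bending -/

/-- The rotation numbers of all elements are constant on the path component of `σ`. -/
def CircleRep.IsRotationRigid {Γ : Type*} [Group Γ] (σ : CircleRep Γ) : Prop :=
  ∀ σ' : CircleRep Γ, Joined σ σ' → ∀ γ, rotationNumber (σ' γ) = rotationNumber (σ γ)

namespace CircleRep

theorem PathRigid.isRotationRigid {Γ : Type*} [Group Γ] {σ : CircleRep Γ} (h : σ.PathRigid) :
    σ.IsRotationRigid :=
  fun _ hσ' γ => (ChiEquiv.rotationNumber_eq (h hσ') γ).symm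

theorem continuous_comp {Γ Γ' : Type*} [Group Γ] [Group Γ'] (θ : Γ' →* Γ) :
    Continuous fun σ : CircleRep Γ => (MonoidHom.comp σ θ : CircleRep Γ') := by
  rw [continuous_induced_rng]
  exact continuous_pi fun γ => (continuous_apply (θ γ)).comp continuous_induced_dom

theorem IsRotationRigid.comp {Γ Γ' : Type*} [Group Γ] [Group Γ'] {σ : CircleRep Γ}
    (h : σ.IsRotationRigid) (θ : Γ' ≃* Γ) :
    IsRotationRigid (MonoidHom.comp σ θ.toMonoidHom : CircleRep Γ') := by
  intro σ' hσ' γ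
  have h1 := hσ'.map (continuous_comp θ.symm.toMonoidHom)
  have h2 : (MonoidHom.comp (MonoidHom.comp σ θ.toMonoidHom) θ.symm.toMonoidHom : CircleRep Γ)
      = σ := by
    ext γ; simp
  rw [h2] at h1
  have h3 := h _ h1 (θ γ)
  simpa using h3

theorem hasFiniteOrbit_comp_iff {Γ Γ' : Type*} [Group Γ] [Group Γ'] (σ : CircleRep Γ)
    (θ : Γ' →* Γ) (K : Subgroup Γ') :
    HasFiniteOrbit (MonoidHom.comp σ θ : CircleRep Γ') K ↔ σ.HasFiniteOrbit (K.map θ) := by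
  unfold HasFiniteOrbit
  simp

end CircleRep

theorem joined_of_continuous {X : Type*} [TopologicalSpace X] {f : ℝ → X} (hf : Continuous f)
    (s t : ℝ) : Joined (f s) (f t) :=
  (PathConnectedSpace.joined s t).map hf

/-- `Φ` consists of lifts of the representation `σ` of the surface group. -/
def IsRepLift {g : ℕ} (Φ : FreeGroup (SurfaceGen g) →* CircleDeg1Liftˣ)
    (σ : CircleRep (SurfaceGroup g)) : Prop :=
  ∀ w, toHomeoPlus (Φ w) = σ (surfaceMk g w)

theorem exists_isRepLift {g : ℕ} (σ : CircleRep (SurfaceGroup g)) : ∃ Φ, IsRepLift Φ σ := by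
  refine ⟨FreeGroup.lift fun j => someLift (σ (PresentedGroup.of j)), fun w => ?_⟩
  have h : toHomeoPlus.comp (FreeGroup.lift fun j => someLift (σ (PresentedGroup.of j)))
      = MonoidHom.comp σ (surfaceMk g) := by
    ext1 j
    simp
    rfl
  exact DFunLike.congr_fun h w

theorem exists_rep_of_lift {g : ℕ} {Φ : FreeGroup (SurfaceGen g) →* CircleDeg1Liftˣ}
    (h : toHomeoPlus (Φ (surfaceRelator g)) = 1) : ∃ σ, IsRepLift Φ σ := by
  have e : FreeGroup.lift (fun j => toHomeoPlus (Φ (FreeGroup.of j))) = toHomeoPlus.comp Φ := by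
    ext1 j
    simp
  refine ⟨PresentedGroup.toGroup (f := fun j => toHomeoPlus (Φ (FreeGroup.of j))) ?_, fun w => ?_⟩
  · intro r hr
    rw [mem_singleton_iff.1 hr, e]
    exact h
  · exact (DFunLike.congr_fun e w).symm

theorem pointwiseContinuous_freeGroup_lift {α Y : Type*} [TopologicalSpace Y]
    {G : Y → α → CircleDeg1Liftˣ} (hG : ∀ j, PointwiseContinuous fun s => G s j)
    (w : FreeGroup α) : PointwiseContinuous fun s => FreeGroup.lift (G s) w := by
  induction w using FreeGroup.induction_on with
  | C1 => simpa using PointwiseContinuous.const 1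
  | of j => simpa using hG j
  | inv_of j h => simpa only [map_inv] using h.inv
  | mul v w hv hw => simpa only [map_mul] using hv.mul hw

/-- A rotation-rigid representation is semiconjugate to each of its bendings. -/
theorem exists_semiconj_of_bend {g : ℕ} {σ : CircleRep (SurfaceGroup g)}
    (hσ : σ.IsRotationRigid) {Φ : FreeGroup (SurfaceGen g) →* CircleDeg1Liftˣ}
    (hΦ : IsRepLift Φ σ) {δ : ℝ → SurfaceGen g → CircleDeg1Liftˣ}
    (hδ : ∀ j, PointwiseContinuous fun s => δ s j) (hδ0 : ∀ j, δ 0 j = 1)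
    (hcomm : ∀ s i, surfaceComm (δ s (i, false) * Φ (FreeGroup.of (i, false)))
        (δ s (i, true) * Φ (FreeGroup.of (i, true)))
      = surfaceComm (Φ (FreeGroup.of (i, false))) (Φ (FreeGroup.of (i, true)))) :
    ∃ ξ : CircleDeg1Lift, ∀ (w : FreeGroup (SurfaceGen g)) (x : ℝ),
      ξ (Φ w x) = FreeGroup.lift (fun j => δ 1 j * Φ (FreeGroup.of j)) w (ξ x) := by
  set Ψ : ℝ → FreeGroup (SurfaceGen g) →* CircleDeg1Liftˣ := fun s =>
    FreeGroup.lift fun j => δ s j * Φ (FreeGroup.of j) with hΨ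
  have hΨ0 : Ψ 0 = Φ := by
    ext1 j
    simp [hΨ, hδ0]
  have hrel : ∀ s, Ψ s (surfaceRelator g) = Φ (surfaceRelator g) := by
    intro s
    rw [map_surfaceRelator, map_surfaceRelator]
    simp only [hΨ, FreeGroup.lift_apply_of, hcomm]
  have hrel1 : toHomeoPlus (Φ (surfaceRelator g)) = 1 := by
    rw [hΦ]
    have : surfaceMk g (surfaceRelator g) = 1 :=
      PresentedGroup.one_of_mem (mem_singleton _)
    rw [this, map_one]
  choose σs hσs using fun s => exists_rep_of_lift (Φ := Ψ s) (by rw [hrel, hrel1])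
  have hpt : ∀ w, PointwiseContinuous fun s => Ψ s w :=
    pointwiseContinuous_freeGroup_lift fun j => (hδ j).mul (PointwiseContinuous.const _)
  have hcont : Continuous σs := by
    rw [continuous_induced_rng]
    refine continuous_pi fun γ => ?_
    obtain ⟨w, rfl⟩ := PresentedGroup.mk_surjective _ γ
    refine (hpt w).toHomeoPlus.congr fun s => hσs s w
  have hσ0 : σs 0 = σ := by
    refine MonoidHom.ext fun γ => ?_
    obtain ⟨w, rfl⟩ := PresentedGroup.mk_surjective _ γ
    exact (hσs 0 w).symm.trans ((congrArg (fun Θ : _ →* _ => toHomeoPlus (Θ w)) hΨ0).trans (hΦ w))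
  -- Rotation numbers are constant along the bending, so the continuous translation numbers are
  -- constant too. This is the hypothesis of Ghys' theorem.
  have hτ : ∀ w, translationNumber (Ψ 1 w) = translationNumber (Φ w) := by
    intro w
    have h1 := eq_of_continuous_of_coe_eq (hpt w).translationNumber (fun s => by
      have h2 := hσ (σs s) (hσ0 ▸ joined_of_continuous hcont 0 s) (surfaceMk g w)
      rw [← hσs s w, rotationNumber_toHomeoPlus, ← hΦ w, rotationNumber_toHomeoPlus] at h2
      rw [h2, hΨ0]) 1
    rw [h1, hΨ0]
  obtain ⟨ξ, hξ⟩ := semiconj_of_group_action_of_forall_translationNumber_eq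
    ((Units.coeHom CircleDeg1Lift).comp Φ) ((Units.coeHom CircleDeg1Lift).comp (Ψ 1))
    fun w => (hτ w).symm
  exact ⟨ξ, fun w x => hξ w x⟩

theorem surfaceComm_mul_left_of_commute {G : Type*} [Group G] {a b d : G} (h : Commute d b) :
    surfaceComm (d * a) b = surfaceComm a b := by
  have h' : d⁻¹ * b * d = b := by rw [mul_assoc, ← h.eq, inv_mul_cancel_left]
  calc surfaceComm (d * a) b = b⁻¹ * a⁻¹ * (d⁻¹ * b * d) * a := by
        simp only [surfaceComm, mul_inv_rev]; group
    _ = surfaceComm a b := by rw [h']; rfl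

theorem surfaceComm_mul_right_of_commute {G : Type*} [Group G] {a b d : G} (h : Commute d a) :
    surfaceComm a (d * b) = surfaceComm a b := by
  have h' : d⁻¹ * a⁻¹ * d = a⁻¹ := by
    rw [mul_assoc, ← h.inv_right.eq, inv_mul_cancel_left]
  calc surfaceComm a (d * b) = b⁻¹ * (d⁻¹ * a⁻¹ * d) * b * a := by
        simp only [surfaceComm, mul_inv_rev]; group
    _ = surfaceComm a b := by rw [h']; rfl

/-- A rotation-rigid representation is semiconjugate to the bendings of the second generator of the
handle `i` and of the first generator of the handle `i'`. -/
theorem exists_semiconj_of_bend_two {g : ℕ} {σ : CircleRep (SurfaceGroup g)}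
    (hσ : σ.IsRotationRigid) {Φ : FreeGroup (SurfaceGen g) →* CircleDeg1Liftˣ}
    (hΦ : IsRepLift Φ σ) {i i' : Fin g} (hii : i' ≠ i) {δ δ' : ℝ → CircleDeg1Liftˣ}
    (hδ : PointwiseContinuous δ) (hδ0 : δ 0 = 1)
    (hδc : ∀ s, Commute (δ s) (Φ (FreeGroup.of (i, false))))
    (hδ' : PointwiseContinuous δ') (hδ0' : δ' 0 = 1)
    (hδc' : ∀ s, Commute (δ' s) (Φ (FreeGroup.of (i', true)))) :
    ∃ (ξ : CircleDeg1Lift) (Ψ : FreeGroup (SurfaceGen g) →* CircleDeg1Liftˣ),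
      (∀ (w : FreeGroup (SurfaceGen g)) (x : ℝ), ξ (Φ w x) = Ψ w (ξ x)) ∧
      Ψ (FreeGroup.of (i, true)) = δ 1 * Φ (FreeGroup.of (i, true)) ∧
      Ψ (FreeGroup.of (i', false)) = δ' 1 * Φ (FreeGroup.of (i', false)) ∧
      ∀ j, j ≠ (i, true) → j ≠ (i', false) → Ψ (FreeGroup.of j) = Φ (FreeGroup.of j) := by
  let d : ℝ → SurfaceGen g → CircleDeg1Liftˣ := fun s j =>
    if j = (i, true) then δ s else if j = (i', false) then δ' s else 1
  have d1 : ∀ s, d s (i, true) = δ s := fun s => if_pos rfl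
  have d2 : ∀ s, d s (i', false) = δ' s := fun s => by simp [d]
  have d3 : ∀ s j, j ≠ (i, true) → j ≠ (i', false) → d s j = 1 := fun s j h h' => by
    simp only [d, if_neg h, if_neg h']
  have c1 : ∀ j, PointwiseContinuous fun s => d s j := by
    intro j
    by_cases h : j = (i, true)
    · subst h; simpa only [d1] using hδ
    · by_cases h' : j = (i', false)
      · subst h'; simpa only [d2] using hδ'
      · simpa only [d3 _ _ h h'] using PointwiseContinuous.const 1
  have c2 : ∀ j, d 0 j = 1 := by
    intro j
    by_cases h : j = (i, true)
    · subst h; rw [d1, hδ0]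
    · by_cases h' : j = (i', false)
      · subst h'; rw [d2, hδ0']
      · exact d3 _ _ h h'
  obtain ⟨ξ, hξ⟩ := exists_semiconj_of_bend hσ hΦ c1 c2 fun s k => by
    by_cases hk : k = i
    · subst hk
      rw [d1, d3 _ _ (by simp) (by simp [hii.symm]), one_mul]
      exact surfaceComm_mul_right_of_commute (hδc s)
    · by_cases hk' : k = i'
      · subst hk'
        rw [d2, d3 _ (k, true) (by simp [hk]) (by simp), one_mul]
        exact surfaceComm_mul_left_of_commute (hδc' s)
      · rw [d3 _ _ (by simp) (by simp [hk']), d3 _ _ (by simp [hk]) (by simp), one_mul, one_mul]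
  refine ⟨ξ, _, hξ, ?_, ?_, fun j h h' => ?_⟩
  · rw [FreeGroup.lift_apply_of, d1]
  · rw [FreeGroup.lift_apply_of, d2]
  · rw [FreeGroup.lift_apply_of, d3 _ _ h h', one_mul]

/-! ### Very good lifts under change of the standard system -/

/-- `Φ` consists of lifts of a rotation-rigid representation for which all one-holed tori in the
subsurface formed by the first `h` handles have finite orbits. -/
def IsVeryGoodLift {g : ℕ} (h : ℕ) (Φ : FreeGroup (SurfaceGen g) →* CircleDeg1Liftˣ) : Prop :=
  ∃ σ : CircleRep (SurfaceGroup g), IsRepLift Φ σ ∧ σ.IsRotationRigid ∧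
    ∀ K, IsOneHoledSubsurfaceGroup 1 K → K ≤ (handleSubgroup g h).map (surfaceMk g) →
      σ.HasFiniteOrbit K

theorem IsOneHoledSubsurfaceGroup.map {g m : ℕ} {K : Subgroup (SurfaceGroup g)}
    (h : IsOneHoledSubsurfaceGroup m K) (θ : SurfaceGroup g ≃* SurfaceGroup g) :
    IsOneHoledSubsurfaceGroup m (K.map θ.toMonoidHom) := by
  obtain ⟨s, ⟨φ, hφ⟩, rfl⟩ := h
  refine ⟨fun j => θ (s j), ⟨φ.trans θ, fun j => by simp [hφ]⟩, ?_⟩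
  rw [MonoidHom.map_closure, image_image]
  rfl

/-- The automorphism of the surface group induced by an automorphism of the free group that fixes
the relator. -/
theorem exists_surfaceGroup_aut {g : ℕ} {ψ : MulAut (FreeGroup (SurfaceGen g))}
    (h : ψ (surfaceRelator g) = surfaceRelator g) :
    ∃ θ : SurfaceGroup g ≃* SurfaceGroup g, ∀ w, θ (surfaceMk g w) = surfaceMk g (ψ w) := by
  refine ⟨QuotientGroup.congr _ _ ψ ?_, fun w => rfl⟩
  have h1 := Subgroup.map_normalClosure {surfaceRelator g} ψ.toMonoidHom ψ.surjective
  refine h1.trans ?_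
  simp [h]

/-- One-holed tori are permuted by automorphisms of the surface group, and a level automorphism
keeps them inside the subsurface. This is what lets the induction hypothesis be applied to other
systems of handles. -/
theorem IsVeryGoodLift.comp {g h : ℕ} {Φ : FreeGroup (SurfaceGen g) →* CircleDeg1Liftˣ}
    (hΦ : IsVeryGoodLift h Φ) {ψ : MulAut (FreeGroup (SurfaceGen g))} (hψ : IsLevelAut h ψ) :
    IsVeryGoodLift h (Φ.comp ψ.toMonoidHom) := by
  obtain ⟨σ, hΦσ, hσ, hK⟩ := hΦ
  obtain ⟨θ, hθ⟩ := exists_surfaceGroup_aut hψ.map_relator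
  refine ⟨MonoidHom.comp σ θ.toMonoidHom, fun w => ?_, hσ.comp θ, fun K h1 hle => ?_⟩
  · exact (hΦσ (ψ w)).trans (congrArg σ (hθ w).symm)
  · rw [CircleRep.hasFiniteOrbit_comp_iff]
    refine hK _ (h1.map θ) ?_
    rintro _ ⟨γ, hγ, rfl⟩
    obtain ⟨w, hw, rfl⟩ := hle hγ
    exact ⟨ψ w, (hψ.mem_iff w).2 hw, (hθ w).symm⟩

theorem IsVeryGoodLift.finiteOrbitOn_one {g h : ℕ} {Φ : FreeGroup (SurfaceGen g) →* CircleDeg1Liftˣ}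
    (hΦ : IsVeryGoodLift h Φ) (hh : 1 ≤ h) : FiniteOrbitOn Φ (handleSubgroup g 1) := by
  obtain ⟨σ, hΦσ, hσ, hK⟩ := hΦ
  rw [← hasFiniteOrbit_map_iff hΦσ]
  refine hK _ ⟨fun j => PresentedGroup.of j, ⟨MulEquiv.refl _, fun j => rfl⟩, ?_⟩
    (Subgroup.map_mono (handleSubgroup_mono hh))
  exact map_handleSubgroup g 1

theorem FiniteOrbitOn.comp_levelAut_iff {g m : ℕ}
    {Φ : FreeGroup (SurfaceGen g) →* CircleDeg1Liftˣ} {ψ : MulAut (FreeGroup (SurfaceGen g))}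
    (hψ : IsLevelAut m ψ) :
    FiniteOrbitOn (Φ.comp ψ.toMonoidHom) (handleSubgroup g m) ↔
      FiniteOrbitOn Φ (handleSubgroup g m) := by
  constructor
  · rintro ⟨X, hX, h⟩
    refine ⟨X, hX, fun w hw => ?_⟩
    have h1 := h (ψ.symm w) ((hψ.mem_iff _).1 (by simpa using hw))
    simpa using h1
  · rintro ⟨X, hX, h⟩
    exact ⟨X, hX, fun w hw => h (ψ w) ((hψ.mem_iff w).2 hw)⟩

/-! ### Limits of normalized semiconjugacies -/

theorem exists_ultrafilter_limit (η : ℕ → ℝ → ℝ) (h : ∀ n x, |η n x - x| ≤ 2) :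
    ∃ (U : Ultrafilter ℕ) (ζ : ℝ → ℝ), (U : Filter ℕ) ≤ atTop ∧
      ∀ x, Tendsto (fun n => η n x) U (𝓝 (ζ x)) := by
  have hex : ∀ x : ℝ, ∃ a, Tendsto (fun n => η n x) (hyperfilter ℕ : Ultrafilter ℕ) (𝓝 a) := by
    intro x
    obtain ⟨a, -, ha⟩ := (isCompact_Icc (a := x - 2) (b := x + 2)).ultrafilter_le_nhds
      ((hyperfilter ℕ : Ultrafilter ℕ).map fun n => η n x) (by
        rw [le_principal_iff]
        refine Eventually.of_forall (f := ((hyperfilter ℕ : Ultrafilter ℕ) : Filter ℕ)) fun n => ?_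
        have := abs_le.1 (h n x)
        exact ⟨by linarith, by linarith⟩)
    exact ⟨a, ha⟩
  choose ζ hζ using hex
  exact ⟨hyperfilter ℕ, ζ, by rw [← Nat.cofinite_eq_atTop]; exact hyperfilter_le_cofinite, hζ⟩

theorem eq_of_tendsto_of_abs_sub_lt {l : Filter ℕ} [l.NeBot] (hl : l ≤ atTop) {u v : ℕ → ℝ}
    {a b : ℝ} (hu : Tendsto u l (𝓝 a)) (hv : Tendsto v l (𝓝 b))
    (h : ∀ n : ℕ, |u n - v n| < 1 / (n + 1)) : a = b := by
  have h1 : Tendsto (fun n => u n - v n) l (𝓝 0) := by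
    refine squeeze_zero_norm (fun n => ?_) (tendsto_one_div_add_atTop_nhds_zero_nat.mono_left hl)
    rw [Real.norm_eq_abs]
    exact (h n).le
  exact sub_eq_zero.1 (tendsto_nhds_unique (hu.sub hv) h1)

namespace CircleDeg1Lift

/-- A degree-one lift is within two of the identity after a suitable integer translation. This
uniform bound, independent of `U` and `ξ`, gives the compactness needed for the limit. -/
theorem exists_int_abs_sub_le (U : CircleDeg1Liftˣ) (ξ : CircleDeg1Lift) :
    ∃ n : ℤ, ∀ x : ℝ, |U (ξ x + n) - x| ≤ 2 := by
  set ζ : CircleDeg1Lift := U * ξ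
  refine ⟨-⌊ζ 0⌋, fun x => ?_⟩
  have h0 : U (ξ x + (-⌊ζ 0⌋ : ℤ)) = ζ x + (-⌊ζ 0⌋ : ℤ) := by rw [map_add_int]; rfl
  rw [h0]
  have h1 := ζ.le_map_of_map_zero x
  have h2 := ζ.map_le_of_map_zero x
  have h3 := Int.floor_le (ζ 0)
  have h4 := Int.lt_floor_add_one (ζ 0)
  have h5 := Int.lt_floor_add_one x
  have h6 := Int.ceil_lt_add_one x
  rw [abs_le]
  push_cast
  constructor <;> linarith

theorem isClosed_periodic_set (F : CircleDeg1Liftˣ) (n : ℕ) (m : ℝ) :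
    IsClosed {y : ℝ | (F ^ n) y = y + m} :=
  isClosed_eq (continuous_units (F ^ n)) (continuous_id.add continuous_const)

theorem add_int_mem_periodic_set (F : CircleDeg1Liftˣ) (n : ℕ) (m : ℝ) (x : ℝ) (k : ℤ) :
    x + k ∈ {y : ℝ | (F ^ n) y = y + m} ↔ x ∈ {y : ℝ | (F ^ n) y = y + m} := by
  change (F ^ n) (x + k) = x + k + m ↔ (F ^ n) x = x + m
  rw [map_add_int]
  constructor <;> intro h <;> linarith

theorem interior_preimage_eq_empty (U : CircleDeg1Liftˣ) {N : Set ℝ} (h : interior N = ∅) :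
    interior ((U : ℝ → ℝ) ⁻¹' N) = ∅ := by
  have h1 := ((toOrderIso U).toHomeomorph).preimage_interior N
  rw [h, preimage_empty] at h1
  exact h1.symm

theorem semiconj_pow {η : ℝ → ℝ} {F G : CircleDeg1Liftˣ} (h : ∀ x : ℝ, η (F x) = G (η x)) (n : ℕ)
    (x : ℝ) : η ((F ^ n) x) = (G ^ n) (η x) := by
  induction n with
  | zero => simp
  | succ n ih => rw [pow_succ', pow_succ', units_mul_apply, units_mul_apply, h, ih]

/-- The identity can be joined in the centralizer of `Z` to an element nearly fixing those points
of `U ⁻¹' N` that it maps to `N`. -/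
theorem exists_path_commute_squeeze_periodic {Z F : CircleDeg1Liftˣ} {q : ℝ} (hq : Z q = q)
    (U : CircleDeg1Liftˣ) {n : ℕ} {m : ℝ} (hi : interior {y : ℝ | (F ^ n) y = y + m} = ∅) {ε : ℝ}
    (hε : 0 < ε) :
    ∃ δ : ℝ → CircleDeg1Liftˣ, PointwiseContinuous δ ∧ δ 0 = 1 ∧ (∀ s, Commute (δ s) Z) ∧
      ∀ y : ℝ, (F ^ n) y = y + m → (F ^ n) (δ 1 (U y)) = δ 1 (U y) + m →
        |δ 1 (U y) - U y| < ε ∧ |Z (U y) - U y| < ε := by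
  obtain ⟨δ, h1, h2, h3, h4⟩ := exists_path_commute_squeeze hq
    ((isClosed_periodic_set F n m).preimage (continuous_units U⁻¹))
    (interior_preimage_eq_empty U⁻¹ hi) (isClosed_periodic_set F n m) hi
    (fun x k => by
      rw [mem_preimage, mem_preimage, map_add_int]
      exact add_int_mem_periodic_set F n m _ k)
    (add_int_mem_periodic_set F n m) hε
  refine ⟨δ, h1, h2, h3, fun y hy hy' => h4 (U y) ?_ hy'⟩
  rw [mem_preimage, units_inv_apply_apply]
  exact hy

end CircleDeg1Lift

/-! ### Enlarging the group with a finite orbit by bending -/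

section Phases

variable {g : ℕ} {σ : CircleRep (SurfaceGroup g)}
  {Φ : FreeGroup (SurfaceGen g) →* CircleDeg1Liftˣ} {i i' : Fin g}

/-- Bend `a₂` by a small flow `C` commuting with `b₂`, and `b₁` by a squeezing `D` commuting with
`a₁`. On `X` the second mixed generator has a common period, so `η` sends `X` into the nowhere dense
set `N` of corresponding periodic points. As `x` and `B₁ (A₁ x)` are both in `X`, the point `A₁ (B₁
(η x))` is carried by `D` into `N`, and the squeezing property applies to it. -/
theorem exists_approx_semiconj_mix (hσ : σ.IsRotationRigid) (hΦ : IsRepLift Φ σ) (hii : i' ≠ i)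
    {A₁ B₁ A₂ : CircleDeg1Liftˣ} (hA₁ : Φ (FreeGroup.of (i, false)) = A₁)
    (hB₁ : Φ (FreeGroup.of (i, true)) = B₁) (hA₂ : Φ (FreeGroup.of (i', false)) = A₂)
    {q : ℝ} (hq : A₁ q = q) (S : ChartSystem (Φ (FreeGroup.of (i', true))))
    {X : Set ℝ} (hX : IsPeriodicFinite X) (hXP : MapsTo (B₁ * A₁ : CircleDeg1Liftˣ) X X)
    (hXS : MapsTo (B₁ * A₂ * B₁⁻¹ * A₁⁻¹ : CircleDeg1Liftˣ) X X) {ε : ℝ} (hε : 0 < ε) :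
    ∃ (t : ℝ) (η : ℝ → ℝ), |t| < ε ∧ (∀ x, |η x - x| ≤ 2) ∧
      (∀ (x : ℝ) (n : ℤ), η (x + n) = η x + n) ∧
      (∀ x ∈ X, |η (B₁ (A₁ x)) - A₁ (B₁ (η x))| < ε ∧
        |A₁ (A₁ (B₁ (η x))) - A₁ (B₁ (η x))| < ε) ∧
      (∀ x, S.flow t ((A₂ * B₁⁻¹ * A₁⁻¹ * B₁) (η x))
        = η ((B₁ * A₂ * B₁⁻¹ * A₁⁻¹ : CircleDeg1Liftˣ) x)) ∧
      ∀ j : Fin g, j ≠ i → j ≠ i' → ∀ β x, Φ (FreeGroup.of (j, β)) (A₁⁻¹ (η (B₁ (A₁ x))))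
        = A₁⁻¹ (η (B₁ (A₁ (Φ (FreeGroup.of (j, β)) x)))) := by
  obtain ⟨n, hn, hper⟩ := hX.exists_period
  obtain ⟨m, -, hm⟩ := hper _ hXS
  obtain ⟨t, ht0, htε, hti⟩ := S.exists_flow_periodic_interior_empty
    (A₂ * B₁⁻¹ * A₁⁻¹ * B₁) hn (m : ℝ) hε
  obtain ⟨δ, hδ, hδ0, hδc, hsq⟩ := exists_path_commute_squeeze_periodic hq (A₁ * B₁) hti hε
  have hflow : PointwiseContinuous fun s : ℝ => S.flow (s * t) := fun x =>
    (ChartSystem.pointwiseContinuous_flow x).comp (continuous_id.mul continuous_const)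
  obtain ⟨ξ, Ψ, hξ, hΨ1, hΨ2, hΨ⟩ := exists_semiconj_of_bend_two hσ hΦ hii hδ hδ0
    (by rwa [hA₁]) hflow (by simp only [zero_mul]; exact ChartSystem.flow_zero)
    (fun s => ChartSystem.commute_flow _)
  rw [hB₁] at hΨ1
  rw [one_mul, hA₂] at hΨ2
  set D := δ 1 with hD
  set C := S.flow t with hC
  have hDc : Commute D A₁ := hδc 1
  have hΨA : Ψ (FreeGroup.of (i, false)) = A₁ := by
    rw [hΨ _ (by simp) (by simp [hii.symm]), hA₁]
  obtain ⟨k, hk⟩ := exists_int_abs_sub_le (D * B₁)⁻¹ ξ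
  set ζ : ℝ → ℝ := fun x => ξ x + k with hζ
  have hζs : ∀ (w : FreeGroup (SurfaceGen g)) (x : ℝ), ζ (Φ w x) = Ψ w (ζ x) := by
    intro w x
    simp only [hζ, map_add_int, hξ]
  set η : ℝ → ℝ := fun x => (D * B₁)⁻¹ (ζ x) with hη
  have hζη : ∀ x, ζ x = D (B₁ (η x)) := fun x => by
    rw [hη, ← units_mul_apply, units_apply_inv_apply]
  have hηP : ∀ x, η (B₁ (A₁ x)) = A₁ (ζ x) := by
    intro x
    have h1 := hζs (FreeGroup.of (i, true) * FreeGroup.of (i, false)) x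
    rw [map_mul, map_mul, hΨ1, hΨA, hA₁, hB₁] at h1
    simp only [hη]
    rw [units_inv_eq_iff]
    exact h1
  have hηP' : ∀ x, η (B₁ (A₁ x)) = D ((A₁ * B₁) (η x)) := by
    intro x
    rw [hηP, hζη, units_mul_apply A₁, ← units_mul_apply D A₁, hDc.eq, units_mul_apply]
  have hηS : ∀ x : ℝ, η ((B₁ * A₂ * B₁⁻¹ * A₁⁻¹ : CircleDeg1Liftˣ) x)
      = (C * (A₂ * B₁⁻¹ * A₁⁻¹ * B₁)) (η x) := by
    intro x
    have h1 := hζs (FreeGroup.of (i, true) * FreeGroup.of (i', false)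
      * (FreeGroup.of (i, true))⁻¹ * (FreeGroup.of (i, false))⁻¹) x
    simp only [map_mul, map_inv, hΨ1, hΨ2, hΨA, hA₁, hB₁, hA₂] at h1
    -- Since `D` commutes with `A₁`, the bent second generator is a conjugate by `D B₁` of a word
    -- not containing `D`.
    have h2 : D * B₁ * (C * A₂) * (D * B₁)⁻¹ * A₁⁻¹
        = D * B₁ * (C * (A₂ * B₁⁻¹ * A₁⁻¹ * B₁)) * (D * B₁)⁻¹ := by
      have h3 : D⁻¹ * A₁⁻¹ = A₁⁻¹ * D⁻¹ := by rw [← mul_inv_rev, ← mul_inv_rev, hDc.eq]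
      calc D * B₁ * (C * A₂) * (D * B₁)⁻¹ * A₁⁻¹
          = D * B₁ * (C * A₂) * B₁⁻¹ * (D⁻¹ * A₁⁻¹) := by group
        _ = D * B₁ * (C * (A₂ * B₁⁻¹ * A₁⁻¹ * B₁)) * (D * B₁)⁻¹ := by rw [h3]; group
    rw [h2] at h1
    simp only [hη]
    rw [h1, units_mul_apply _ (D * B₁)⁻¹, units_mul_apply (D * B₁), units_inv_apply_apply]
  have hηint : ∀ (x : ℝ) (n : ℤ), η (x + n) = η x + n := by
    intro x n
    have h1 : ζ (x + n) = ζ x + n := by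
      simp only [hζ, map_add_int]; ring
    change (D * B₁)⁻¹ (ζ (x + n)) = (D * B₁)⁻¹ (ζ x) + n
    rw [h1, map_add_int]
  have hηN : ∀ x ∈ X, ((C * (A₂ * B₁⁻¹ * A₁⁻¹ * B₁)) ^ n) (η x) = η x + m := by
    intro x hx
    rw [← semiconj_pow hηS, hm x hx, hηint]
  refine ⟨t, η, by rwa [abs_of_pos ht0], hk, hηint, fun x hx => ?_, fun x => (hηS x).symm,
    fun j hj hj' β x => ?_⟩
  · rw [hηP']
    refine hsq (η x) (hηN x hx) ?_
    rw [← hηP']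
    exact hηN _ (hXP hx)
  -- It is `ζ`, not `η`, that is equivariant for the unbent handles; the relation `ζ x = A₁⁻¹ (η (B₁
  -- (A₁ x)))` expresses this without `D`.
  · rw [hηP, hηP, units_inv_apply_apply, units_inv_apply_apply, hζs, hΨ _ (by simp [hj])
      (by simp [hj'])]

/-- If the group generated by `b₁ a₁`, `b₁ a₂ b₁⁻¹ a₁⁻¹` and some other handles has a finite orbit,
so has the group generated by `a₁`, `b₁`, `a₂` and these handles. -/
theorem exists_periodicFinite_of_mix (hσ : σ.IsRotationRigid) (hΦ : IsRepLift Φ σ) (hii : i' ≠ i)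
    {q q' : ℝ} (hq : Φ (FreeGroup.of (i, false)) q = q)
    (hq' : Φ (FreeGroup.of (i', true)) q' = q') {J : Set (Fin g)} (hJ : i ∉ J) (hJ' : i' ∉ J)
    {X : Set ℝ} (hX : IsPeriodicFinite X)
    (hXJ : ∀ j ∈ J, ∀ β, MapsTo (Φ (FreeGroup.of (j, β))) X X)
    (hXP : MapsTo (Φ (FreeGroup.of (i, true) * FreeGroup.of (i, false))) X X)
    (hXS : MapsTo (Φ (FreeGroup.of (i, true) * FreeGroup.of (i', false)
      * (FreeGroup.of (i, true))⁻¹ * (FreeGroup.of (i, false))⁻¹)) X X) :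
    ∃ E : Set ℝ, IsPeriodicFinite E ∧ (∀ j ∈ J, ∀ β, MapsTo (Φ (FreeGroup.of (j, β))) E E) ∧
      (∀ β, MapsTo (Φ (FreeGroup.of (i, β))) E E) ∧ MapsTo (Φ (FreeGroup.of (i', false))) E E := by
  obtain ⟨S⟩ := nonempty_chartSystem hq'
  set A₁ := Φ (FreeGroup.of (i, false)) with hA₁
  set B₁ := Φ (FreeGroup.of (i, true)) with hB₁
  set A₂ := Φ (FreeGroup.of (i', false)) with hA₂
  simp only [map_mul, map_inv, ← hA₁, ← hB₁, ← hA₂] at hXP hXS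
  choose t η ht hη2 hηint hηP hηS hηJ using fun k : ℕ =>
    exists_approx_semiconj_mix hσ hΦ hii hA₁.symm hB₁.symm hA₂.symm hq S hX hXP hXS
      (ε := 1 / (k + 1)) (by positivity)
  obtain ⟨U, ζ, hU, hζ⟩ := exists_ultrafilter_limit η hη2
  have hcont : ∀ (F : CircleDeg1Liftˣ) {u : ℕ → ℝ} {a : ℝ}, Tendsto u U (𝓝 a) →
      Tendsto (fun k => F (u k)) U (𝓝 (F a)) := fun F _ a h =>
    ((continuous_units F).tendsto a).comp h
  have ht0 : Tendsto t U (𝓝 0) := by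
    refine squeeze_zero_norm (fun k => ?_) (tendsto_one_div_add_atTop_nhds_zero_nat.mono_left hU)
    rw [Real.norm_eq_abs]
    exact (ht k).le
  have hζint : ∀ (x : ℝ) (n : ℤ), ζ (x + n) = ζ x + n := fun x n =>
    tendsto_nhds_unique (hζ (x + n)) (((hζ x).add_const (n : ℝ)).congr fun k => (hηint k x n).symm)
  have h1 : ∀ x ∈ X, ζ (B₁ (A₁ x)) = A₁ (B₁ (ζ x)) := fun x hx =>
    eq_of_tendsto_of_abs_sub_lt hU (hζ _) (hcont A₁ (hcont B₁ (hζ x))) fun k => (hηP k x hx).1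
  have h2 : ∀ x ∈ X, A₁ (A₁ (B₁ (ζ x))) = A₁ (B₁ (ζ x)) := fun x hx =>
    eq_of_tendsto_of_abs_sub_lt hU (hcont A₁ (hcont A₁ (hcont B₁ (hζ x))))
      (hcont A₁ (hcont B₁ (hζ x))) fun k => (hηP k x hx).2
  -- The flow times tend to zero, so the bending of `a₂` disappears in the limit.
  have h3 : ∀ x, (A₂ * B₁⁻¹ * A₁⁻¹ * B₁) (ζ x)
      = ζ ((B₁ * A₂ * B₁⁻¹ * A₁⁻¹ : CircleDeg1Liftˣ) x) := by
    intro x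
    have hlim : Tendsto (fun k => S.flow (t k) ((A₂ * B₁⁻¹ * A₁⁻¹ * B₁) (η k x))) U
        (𝓝 ((1 : CircleDeg1Lift) ((A₂ * B₁⁻¹ * A₁⁻¹ * B₁) (ζ x)))) := by
      refine tendsto_apply_of_pointwise (G := fun k => (S.flow (t k) : CircleDeg1Lift))
        continuous_id (fun y => ?_) (hcont _ (hζ x))
      have h4 := ((ChartSystem.pointwiseContinuous_flow (S := S) y).tendsto 0).comp ht0
      rw [ChartSystem.flow_zero] at h4
      exact h4
    exact tendsto_nhds_unique hlim ((hζ _).congr fun k => (hηS k x).symm)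
  have h4 : ∀ j ∈ J, ∀ β x, Φ (FreeGroup.of (j, β)) (A₁⁻¹ (ζ (B₁ (A₁ x))))
      = A₁⁻¹ (ζ (B₁ (A₁ (Φ (FreeGroup.of (j, β)) x)))) := fun j hj β x =>
    tendsto_nhds_unique (hcont _ (hcont A₁⁻¹ (hζ _))) ((hcont A₁⁻¹ (hζ _)).congr fun k =>
      (hηJ k j (fun h => hJ (h ▸ hj)) (fun h => hJ' (h ▸ hj)) β x).symm)
  have hinvP : MapsTo ((B₁ * A₁)⁻¹ : CircleDeg1Liftˣ) X X := hX.mapsTo_inv hXP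
  have hPinv : ∀ x, B₁ (A₁ ((B₁ * A₁ : CircleDeg1Liftˣ)⁻¹ x)) = x := fun x => by
    rw [← units_mul_apply, units_apply_inv_apply]
  -- In the limit `A₁` fixes `ζ (B₁ (A₁ x))` for every `x ∈ X`, and `B₁ A₁` maps `X` onto itself.
  have hfix : ∀ x ∈ X, A₁ (ζ x) = ζ x := by
    intro x hx
    have h5 := h2 _ (hinvP hx)
    rw [← h1 _ (hinvP hx), hPinv] at h5
    exact h5
  have hfix' : ∀ x ∈ X, A₁⁻¹ (ζ x) = ζ x := fun x hx =>
    (units_inv_eq_iff A₁).2 (hfix x hx).symm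
  have hb : ∀ x ∈ X, B₁ (ζ x) = ζ (B₁ (A₁ x)) := by
    intro x hx
    rw [h1 x hx]
    have h5 := h2 x hx
    exact ((strictMono_units A₁).injective h5).symm
  refine ⟨ζ '' X, hX.image hζint, ?_, ?_, ?_⟩
  · rintro j hj β _ ⟨x, hx, rfl⟩
    have hy := hinvP hx
    have h5 := h4 j hj β ((B₁ * A₁ : CircleDeg1Liftˣ)⁻¹ x)
    have h6 : B₁ (A₁ (Φ (FreeGroup.of (j, β)) ((B₁ * A₁ : CircleDeg1Liftˣ)⁻¹ x))) ∈ X :=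
      hXP (hXJ j hj β hy)
    rw [hPinv, hfix' x hx, hfix' _ h6] at h5
    exact ⟨_, h6, h5.symm⟩
  · rintro (_ | _) _ ⟨x, hx, rfl⟩
    · exact ⟨x, hx, (hfix x hx).symm⟩
    · exact ⟨_, hXP hx, (hb x hx).symm⟩
  · rintro _ ⟨x, hx, rfl⟩
    refine ⟨_, hXS hx, ?_⟩
    rw [← h3]
    change A₂ (B₁⁻¹ (A₁⁻¹ (B₁ (ζ x)))) = A₂ (ζ x)
    have h5 : A₁⁻¹ (ζ (B₁ (A₁ x))) = ζ (B₁ (A₁ x)) := hfix' _ (hXP hx)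
    rw [hb x hx, h5, ← hb x hx, units_inv_apply_apply]

/-- Here the flow commutes with `a₁` and bends `b₁`, making the periodic points of `b₁` nowhere
dense, while the squeezing commutes with `b₂` and bends `a₂`. As `X` is invariant under `b₁` and
`a₂`, the squeezing forces `b₂` to almost fix `A₂ (η x)`. -/
theorem exists_approx_semiconj_pair (hσ : σ.IsRotationRigid) (hΦ : IsRepLift Φ σ) (hii : i' ≠ i)
    {B₁ A₂ B₂ : CircleDeg1Liftˣ} (hB₁ : Φ (FreeGroup.of (i, true)) = B₁)
    (hA₂ : Φ (FreeGroup.of (i', false)) = A₂) (hB₂ : Φ (FreeGroup.of (i', true)) = B₂)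
    {q : ℝ} (hq : B₂ q = q) (S : ChartSystem (Φ (FreeGroup.of (i, false))))
    {X : Set ℝ} (hX : IsPeriodicFinite X) (hXB : MapsTo B₁ X X) (hXA : MapsTo A₂ X X) {ε : ℝ}
    (hε : 0 < ε) :
    ∃ (t : ℝ) (η : ℝ → ℝ), |t| < ε ∧ (∀ x, |η x - x| ≤ 2) ∧
      (∀ (x : ℝ) (n : ℤ), η (x + n) = η x + n) ∧
      (∀ x ∈ X, |η (A₂ x) - A₂ (η x)| < ε ∧ |B₂ (A₂ (η x)) - A₂ (η x)| < ε) ∧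
      (∀ x, S.flow t (B₁ (η x)) = η (B₁ x)) ∧
      ∀ j, j ≠ (i, true) → j.1 ≠ i' → ∀ x,
        Φ (FreeGroup.of j) (η x) = η (Φ (FreeGroup.of j) x) := by
  obtain ⟨n, hn, hper⟩ := hX.exists_period
  obtain ⟨m, -, hm⟩ := hper _ hXB
  obtain ⟨t, ht0, htε, hti⟩ := S.exists_flow_periodic_interior_empty B₁ hn (m : ℝ) hε
  obtain ⟨δ, hδ, hδ0, hδc, hsq⟩ := exists_path_commute_squeeze_periodic hq A₂ hti hε
  have hflow : PointwiseContinuous fun s : ℝ => S.flow (s * t) := fun x =>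
    (ChartSystem.pointwiseContinuous_flow x).comp (continuous_id.mul continuous_const)
  obtain ⟨ξ, Ψ, hξ, hΨ1, hΨ2, hΨ⟩ := exists_semiconj_of_bend_two hσ hΦ hii hflow
    (by simp only [zero_mul]; exact ChartSystem.flow_zero)
    (fun s => ChartSystem.commute_flow _) hδ hδ0 (by rwa [hB₂])
  rw [one_mul, hB₁] at hΨ1
  rw [hA₂] at hΨ2
  obtain ⟨k, hk⟩ := exists_int_abs_sub_le 1 ξ
  set η : ℝ → ℝ := fun x => ξ x + k with hη
  have hηs : ∀ (w : FreeGroup (SurfaceGen g)) (x : ℝ), η (Φ w x) = Ψ w (η x) := by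
    intro w x
    simp only [hη, map_add_int, hξ]
  have hηB : ∀ x : ℝ, η (B₁ x) = (S.flow t * B₁) (η x) := by
    intro x; rw [← hΨ1, ← hηs, hB₁]
  have hηA : ∀ x : ℝ, η (A₂ x) = δ 1 (A₂ (η x)) := by
    intro x; rw [← units_mul_apply, ← hΨ2, ← hηs, hA₂]
  have hηint : ∀ (x : ℝ) (n : ℤ), η (x + n) = η x + n := by
    intro x n
    simp only [hη, map_add_int]; ring
  have hηN : ∀ x ∈ X, ((S.flow t * B₁) ^ n) (η x) = η x + m := by
    intro x hx
    rw [← semiconj_pow hηB, hm x hx, hηint]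
  refine ⟨t, η, by rwa [abs_of_pos ht0], hk, hηint, fun x hx => ?_, fun x => (hηB x).symm,
    fun j hj hj' x => ?_⟩
  · rw [hηA]
    refine hsq (η x) (hηN x hx) ?_
    rw [← hηA]
    exact hηN _ (hXA hx)
  · rw [hηs, hΨ _ hj (fun h => hj' (congrArg Prod.fst h))]

/-- If the group generated by `a₁`, `b₁`, `a₂` and some other handles has a finite orbit, so has
the group generated by `a₁`, `b₁`, `a₂`, `b₂` and these handles. -/
theorem exists_periodicFinite_of_pair (hσ : σ.IsRotationRigid) (hΦ : IsRepLift Φ σ) (hii : i' ≠ i)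
    {q q' : ℝ} (hq : Φ (FreeGroup.of (i, false)) q = q)
    (hq' : Φ (FreeGroup.of (i', true)) q' = q') {J : Set (Fin g)} (hJ : i ∉ J) (hJ' : i' ∉ J)
    {X : Set ℝ} (hX : IsPeriodicFinite X)
    (hXJ : ∀ j ∈ J, ∀ β, MapsTo (Φ (FreeGroup.of (j, β))) X X)
    (hXi : ∀ β, MapsTo (Φ (FreeGroup.of (i, β))) X X)
    (hXi' : MapsTo (Φ (FreeGroup.of (i', false))) X X) :
    ∃ E : Set ℝ, IsPeriodicFinite E ∧ (∀ j ∈ J, ∀ β, MapsTo (Φ (FreeGroup.of (j, β))) E E) ∧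
      (∀ β, MapsTo (Φ (FreeGroup.of (i, β))) E E) ∧
      ∀ β, MapsTo (Φ (FreeGroup.of (i', β))) E E := by
  obtain ⟨S⟩ := nonempty_chartSystem hq
  choose t η ht hη2 hηint hηA hηB hηj using fun k : ℕ =>
    exists_approx_semiconj_pair hσ hΦ hii rfl rfl rfl hq' S hX (hXi true) hXi'
      (ε := 1 / (k + 1)) (by positivity)
  obtain ⟨U, ζ, hU, hζ⟩ := exists_ultrafilter_limit η hη2
  have hcont : ∀ (F : CircleDeg1Liftˣ) {u : ℕ → ℝ} {a : ℝ}, Tendsto u U (𝓝 a) →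
      Tendsto (fun k => F (u k)) U (𝓝 (F a)) := fun F _ a h =>
    ((continuous_units F).tendsto a).comp h
  have ht0 : Tendsto t U (𝓝 0) := by
    refine squeeze_zero_norm (fun k => ?_) (tendsto_one_div_add_atTop_nhds_zero_nat.mono_left hU)
    rw [Real.norm_eq_abs]
    exact (ht k).le
  have hζint : ∀ (x : ℝ) (n : ℤ), ζ (x + n) = ζ x + n := fun x n =>
    tendsto_nhds_unique (hζ (x + n)) (((hζ x).add_const (n : ℝ)).congr fun k => (hηint k x n).symm)
  have h1 : ∀ x ∈ X, ζ (Φ (FreeGroup.of (i', false)) x) = Φ (FreeGroup.of (i', false)) (ζ x) :=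
    fun x hx => eq_of_tendsto_of_abs_sub_lt hU (hζ _) (hcont _ (hζ x)) fun k => (hηA k x hx).1
  have h2 : ∀ x ∈ X, Φ (FreeGroup.of (i', true)) (Φ (FreeGroup.of (i', false)) (ζ x))
      = Φ (FreeGroup.of (i', false)) (ζ x) := fun x hx =>
    eq_of_tendsto_of_abs_sub_lt hU (hcont _ (hcont _ (hζ x))) (hcont _ (hζ x))
      fun k => (hηA k x hx).2
  have h3 : ∀ x, Φ (FreeGroup.of (i, true)) (ζ x) = ζ (Φ (FreeGroup.of (i, true)) x) := by
    intro x
    have hlim : Tendsto (fun k => S.flow (t k) (Φ (FreeGroup.of (i, true)) (η k x))) U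
        (𝓝 ((1 : CircleDeg1Lift) (Φ (FreeGroup.of (i, true)) (ζ x)))) := by
      refine tendsto_apply_of_pointwise (G := fun k => (S.flow (t k) : CircleDeg1Lift))
        continuous_id (fun y => ?_) (hcont _ (hζ x))
      have h4 := ((ChartSystem.pointwiseContinuous_flow (S := S) y).tendsto 0).comp ht0
      rw [ChartSystem.flow_zero] at h4
      exact h4
    exact tendsto_nhds_unique hlim ((hζ _).congr fun k => (hηB k x).symm)
  have h4 : ∀ j, j ≠ (i, true) → j.1 ≠ i' → ∀ x,
      Φ (FreeGroup.of j) (ζ x) = ζ (Φ (FreeGroup.of j) x) := fun j hj hj' x =>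
    tendsto_nhds_unique (hcont _ (hζ x)) ((hζ _).congr fun k => (hηj k j hj hj' x).symm)
  refine ⟨ζ '' X, hX.image hζint, ?_, ?_, ?_⟩
  · rintro j hj β _ ⟨x, hx, rfl⟩
    refine ⟨_, hXJ j hj β hx, (h4 _ (fun h => hJ ?_) (fun h => hJ' (h ▸ hj)) x).symm⟩
    have h5 : j = i := congrArg Prod.fst h
    exact h5 ▸ hj
  · rintro (_ | _) _ ⟨x, hx, rfl⟩
    · exact ⟨_, hXi false hx, (h4 _ (by simp) (fun h => hii h.symm) x).symm⟩
    · exact ⟨_, hXi true hx, (h3 x).symm⟩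
  · rintro (_ | _) _ ⟨x, hx, rfl⟩
    · exact ⟨_, hXi' hx, h1 x hx⟩
    -- The limit statement that `b₂` fixes the points `A₂ (ζ x)` covers all of `ζ '' X`, because
    -- `A₂` permutes `X`. So the new generator acts trivially on the new orbit.
    · refine ⟨x, hx, ?_⟩
      have h5 := h2 _ (hX.mapsTo_inv hXi' hx)
      rw [← h1 _ (hX.mapsTo_inv hXi' hx), units_apply_inv_apply] at h5
      exact h5.symm

end Phases

/-! ### Euclid's algorithm on translation numbers -/

section Normalization

/-- When `x` does not divide `y`, this is two divisions with remainder. When it does, `y` is first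
turned into `x`, so that subtracting it yields `0`. -/
theorem exists_natAbs_lt (x y : ℤ) (hx : x ≠ 0) :
    ∃ q p : ℤ, (x + p * (y + q * x)).natAbs < x.natAbs := by
  by_cases h : y % x = 0
  · refine ⟨1 - y / x, -1, ?_⟩
    have h1 : y + (1 - y / x) * x = x := by
      have := Int.emod_add_mul_ediv y x
      linarith
    rw [h1]
    have : x + -1 * x = 0 := by ring
    rw [this]
    simpa [Int.natAbs_pos] using hx
  · refine ⟨-(y / x), -(x / (y % x)), ?_⟩
    have h1 : y + -(y / x) * x = y % x := by
      have := Int.emod_add_mul_ediv y x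
      linarith
    have h2 : x + -(x / (y % x)) * (y % x) = x % (y % x) := by
      have := Int.emod_add_mul_ediv x (y % x)
      linarith
    rw [h1, h2]
    have h3 := Int.emod_nonneg y hx
    have h4 := Int.emod_lt_abs y hx
    have h5 := Int.emod_nonneg x h
    have h6 := Int.emod_lt_abs x h
    rw [abs_of_nonneg h3] at h6
    rw [Int.abs_eq_natAbs] at h4
    omega

theorem CircleDeg1Lift.IsPeriodicFinite.mapsTo_zpow {X : Set ℝ} (hX : IsPeriodicFinite X)
    {F : CircleDeg1Liftˣ} (hF : MapsTo F X X) (n : ℤ) :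
    MapsTo ((F ^ n : CircleDeg1Liftˣ) : ℝ → ℝ) X X := by
  obtain ⟨k, rfl | rfl⟩ := n.eq_nat_or_neg
  · rw [zpow_natCast]; exact mapsTo_pow hF k
  · rw [zpow_neg, zpow_natCast]; exact hX.mapsTo_inv (mapsTo_pow hF k)

/-- If a handle group has a finite orbit, twists of the handle make the translation number of a
generator vanish. -/
theorem exists_levelAut_translationNumber_eq_zero {g : ℕ} (i : Fin g) (β : Bool)
    (Φ : FreeGroup (SurfaceGen g) →* CircleDeg1Liftˣ) {X : Set ℝ} (hX : IsPeriodicFinite X)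
    (hXi : ∀ γ, MapsTo (Φ (FreeGroup.of (i, γ))) X X) :
    ∃ ψ : MulAut (FreeGroup (SurfaceGen g)), (∀ m, IsLevelAut m ψ) ∧
      (∀ j : Fin g, j ≠ i → ∀ γ, ψ (FreeGroup.of (j, γ)) = FreeGroup.of (j, γ)) ∧
      translationNumber (Φ (ψ (FreeGroup.of (i, β)))) = 0 := by
  obtain ⟨n, hn, hper⟩ := hX.exists_period
  have hn' : (n : ℝ) ≠ 0 := Nat.cast_ne_zero.2 hn
  obtain ⟨x, hx, -⟩ := hper _ (hXi β)
  induction hN : x.natAbs using Nat.strong_induction_on generalizing Φ x with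
  | _ N ih =>
  subst hN
  by_cases hx0 : x = 0
  · refine ⟨1, fun _ => IsLevelAut.one, fun _ _ _ => rfl, ?_⟩
    rw [hx0, Int.cast_zero, eq_comm, mul_eq_zero] at hx
    exact hx.resolve_left hn'
  obtain ⟨y, hy, -⟩ := hper _ (hXi !β)
  obtain ⟨q, p, hlt⟩ := exists_natAbs_lt x y hx0
  obtain ⟨ψ₁, hψ₁, h₁, h₁'⟩ := exists_twist i (!β) q
  obtain ⟨ψ₂, hψ₂, h₂, h₂'⟩ := exists_twist i β p
  rw [Bool.not_not] at h₁
  set A := Φ (FreeGroup.of (i, β)) with hA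
  set B := Φ (FreeGroup.of (i, !β)) with hB
  have hne : (i, β) ≠ (i, !β) := by simp
  have e1 : Φ (ψ₁ (FreeGroup.of (i, !β))) = A ^ q * B := by
    rw [h₁, map_mul, map_zpow]
  have e2 : Φ (ψ₁ (FreeGroup.of (i, β))) = A := by rw [h₁' _ hne]
  have e3 : (Φ.comp (ψ₁ * ψ₂).toMonoidHom) (FreeGroup.of (i, β)) = (A ^ q * B) ^ p * A := by
    change Φ (ψ₁ (ψ₂ (FreeGroup.of (i, β)))) = _
    rw [h₂, map_mul, map_zpow, map_mul, map_zpow, e1, e2]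
  have e4 : (Φ.comp (ψ₁ * ψ₂).toMonoidHom) (FreeGroup.of (i, !β)) = A ^ q * B := by
    change Φ (ψ₁ (ψ₂ (FreeGroup.of (i, !β)))) = _
    rw [h₂' _ hne.symm, e1]
  have mA : MapsTo A X X := hXi β
  have mB : MapsTo B X X := hXi !β
  have mAB : MapsTo (A ^ q * B : CircleDeg1Liftˣ) X X := fun z hz => hX.mapsTo_zpow mA q (mB hz)
  have mABA : MapsTo ((A ^ q * B) ^ p * A : CircleDeg1Liftˣ) X X := fun z hz =>
    hX.mapsTo_zpow mAB p (mA hz)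
  have hτ : ((x + p * (y + q * x) : ℤ) : ℝ)
      = n * translationNumber ((A ^ q * B) ^ p * A : CircleDeg1Liftˣ) := by
    rw [hX.translationNumber_mul (hX.mapsTo_zpow mAB p) mA, translationNumber_zpow,
      hX.translationNumber_mul (hX.mapsTo_zpow mA q) mB, translationNumber_zpow]
    push_cast
    rw [hx, hy]
    ring
  obtain ⟨ψ, hψ, hψi, hψ0⟩ := ih _ hlt (Φ.comp (ψ₁ * ψ₂).toMonoidHom) (fun γ => by
    by_cases hγ : γ = β
    · subst hγ; rw [e3]; exact mABA
    · have : γ = !β := by cases γ <;> cases β <;> simp_all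
      subst this; rw [e4]; exact mAB) (x + p * (y + q * x)) (by rw [e3]; exact hτ) rfl
  refine ⟨ψ₁ * ψ₂ * ψ, fun m => ((hψ₁ m).mul (hψ₂ m)).mul (hψ m), fun j hj γ => ?_, hψ0⟩
  change ψ₁ (ψ₂ (ψ (FreeGroup.of (j, γ)))) = _
  rw [hψi j hj, h₂' _ (by simp [hj]), h₁' _ (by simp [hj])]

end Normalization

/-! ### Induction on the number of handles -/

theorem exists_fixed_of_translationNumber_eq_zero {F : CircleDeg1Liftˣ}
    (h : translationNumber F = 0) : ∃ q : ℝ, F q = q := by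
  obtain ⟨q, hq⟩ := exists_eq_add_translationNumber (F : CircleDeg1Lift) (continuous_units F)
  exact ⟨q, by rw [hq, h, add_zero]⟩

/-- The statement for `k + 1` handles is used for several lifts: for `Φ` itself, after a swap that
puts the new handle in the last old place, and after the mixing automorphism. The swap and the
mixing preserve the ambient subsurface but not the smaller one, which is why they give new
information. -/
theorem IsVeryGoodLift.finiteOrbitOn {g h : ℕ} (hhg : h < g) (k : ℕ) (hk : k + 1 ≤ h)
    (Φ : FreeGroup (SurfaceGen g) →* CircleDeg1Liftˣ) (hΦ : IsVeryGoodLift h Φ) :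
    FiniteOrbitOn Φ (handleSubgroup g (k + 1)) := by
  induction k generalizing Φ with
  | zero => exact hΦ.finiteOrbitOn_one hk
  | succ k ih =>
  let i : Fin g := ⟨k, by omega⟩
  let i' : Fin g := ⟨k + 1, by omega⟩
  have hii : i' ≠ i := fun h => by
    have h1 : k + 1 = k := congrArg Fin.val h
    omega
  have hmem : ∀ β, FreeGroup.of (i, β) ∈ handleSubgroup g (k + 1) := fun β =>
    of_mem_handleSubgroup (j := (i, β)) (Nat.lt_succ_self k)
  obtain ⟨X₁, hX₁, hX₁m⟩ := ih (by omega) Φ hΦ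
  obtain ⟨ψ₁, hψ₁, -, hψ₁0⟩ := exists_levelAut_translationNumber_eq_zero i false Φ hX₁
    fun γ => hX₁m _ (hmem γ)
  have hΦ₁ := hΦ.comp (hψ₁ h)
  obtain ⟨ω, hω, hωi, -⟩ := exists_swapAut (i := i) (i' := i') rfl
  obtain ⟨X₂, hX₂, hX₂m⟩ := ih (by omega) _ (hΦ₁.comp (hω h (by change k + 1 < h; omega)))
  obtain ⟨ψ₂, hψ₂, hψ₂i, hψ₂0⟩ := exists_levelAut_translationNumber_eq_zero i' true
    -- The swap serves only to see that the new handle has a finite orbit; the twist that follows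
    -- acts on the new handle alone and keeps the normalization of `a₁`.
    (Φ.comp ψ₁.toMonoidHom) hX₂ fun γ => by
      rw [← hωi γ]
      exact hX₂m _ (hmem γ)
  have hΦ₂ := hΦ₁.comp (hψ₂ h)
  rw [← FiniteOrbitOn.comp_levelAut_iff (hψ₁ _), ← FiniteOrbitOn.comp_levelAut_iff (hψ₂ _)]
  set Θ := (Φ.comp ψ₁.toMonoidHom).comp ψ₂.toMonoidHom with hΘ
  have hΘa : translationNumber (Θ (FreeGroup.of (i, false))) = 0 := by
    change translationNumber (Φ (ψ₁ (ψ₂ (FreeGroup.of (i, false))))) = 0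
    rw [hψ₂i _ hii.symm]
    exact hψ₁0
  obtain ⟨q, hq⟩ := exists_fixed_of_translationNumber_eq_zero hΘa
  obtain ⟨q', hq'⟩ := exists_fixed_of_translationNumber_eq_zero (F := Θ (FreeGroup.of (i', true)))
    hψ₂0
  obtain ⟨μ, hμ, hμP, hμS, hμj⟩ := exists_mixAut (i := i) (i' := i') rfl
  obtain ⟨X₃, hX₃, hX₃m⟩ := ih (by omega) _ (hΦ₂.comp (hμ h (by change k + 1 < h; omega)))
  obtain ⟨σ, hσΘ, hσ, -⟩ := hΦ₂
  let J : Set (Fin g) := {j | (j : ℕ) < k}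
  have hJ : i ∉ J := lt_irrefl k
  have hJ' : i' ∉ J := not_lt.2 (Nat.le_succ k)
  obtain ⟨X₄, hX₄, hX₄J, hX₄i, hX₄a⟩ := exists_periodicFinite_of_mix hσ hσΘ hii hq hq' hJ hJ' hX₃
    (fun j hj β => by
      have h1 := hX₃m (FreeGroup.of (j, β)) (of_mem_handleSubgroup (j := (j, β))
        (Nat.lt_succ_of_lt hj))
      change MapsTo (Θ (μ (FreeGroup.of (j, β)))) X₃ X₃ at h1
      rwa [hμj j hj] at h1)
    (by rw [← hμP]; exact hX₃m _ (hmem false))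
    (by rw [← hμS]; exact hX₃m _ (hmem true))
  obtain ⟨E, hE, hEJ, hEi, hEi'⟩ := exists_periodicFinite_of_pair hσ hσΘ hii hq hq' hJ hJ' hX₄
    hX₄J hX₄i hX₄a
  refine finiteOrbitOn_closure hE ?_
  rintro _ ⟨⟨j, β⟩, hj, rfl⟩
  have hj : (j : ℕ) < k + 2 := hj
  rcases lt_trichotomy (j : ℕ) k with h1 | h1 | h1
  · exact hEJ j h1 β
  · have : j = i := Fin.ext h1
    rw [this]; exact hEi β
  · have : j = i' := Fin.ext (show (j : ℕ) = k + 1 by omega)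
    rw [this]; exact hEi' β

theorem mainTheorem9 (g : ℕ) (hg : 2 ≤ g) (ρ : CircleRep (SurfaceGroup g)) (hρ : ρ.PathRigid)
    (h : ℕ) (hh : 1 ≤ h) (hhg : h < g) (H : Subgroup (SurfaceGroup g))
    (hH : IsOneHoledSubsurfaceGroup h H)
    (hT : ∀ K : Subgroup (SurfaceGroup g),
      IsOneHoledSubsurfaceGroup 1 K → K ≤ H → ρ.HasFiniteOrbit K) :
    ρ.HasFiniteOrbit H := by
  -- Precomposing with `φ` moves the subsurface to the standard one formed by the first `h` handles.
  obtain ⟨s, ⟨φ, hφ⟩, rfl⟩ := hH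
  have hHmap : Subgroup.closure (s '' {j | (j.1 : ℕ) < h})
      = ((handleSubgroup g h).map (surfaceMk g)).map φ.toMonoidHom := by
    rw [map_handleSubgroup, MonoidHom.map_closure, image_image]
    congr 1
    exact image_congr fun j _ => hφ j
  rw [hHmap] at hT ⊢
  obtain ⟨Φ, hΦ⟩ := exists_isRepLift (MonoidHom.comp ρ φ.toMonoidHom : CircleRep (SurfaceGroup g))
  rw [← CircleRep.hasFiniteOrbit_comp_iff, hasFiniteOrbit_map_iff hΦ]
  obtain ⟨k, rfl⟩ := Nat.exists_eq_succ_of_ne_zero (Nat.one_le_iff_ne_zero.1 hh)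
  refine IsVeryGoodLift.finiteOrbitOn hhg k le_rfl Φ
    ⟨_, hΦ, hρ.isRotationRigid.comp φ, fun K hK hle => ?_⟩
  rw [CircleRep.hasFiniteOrbit_comp_iff]
  exact hT _ (hK.map φ) (Subgroup.map_mono hle)
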